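/- **Model.** Let $I,J,M,D_{\max}$ be natural numbers, $M\ge 1$. There are $M$ servers; server $m$ has $R_{i,m}\ge 0$ units of resource $i\in\{1,\dots,I\}$, and a job of type $j\in\{1,\dots,J\}$ needs $r_{i,j}\ge 0$ units of resource $i$. A configuration of server $m$ is a vector $s\in\mathbb Z_+^J$ with $\sum_j s_j r_{i,j}\le R_{i,m}$ for all $i$; it is maximal if no $s+e_j$ is a configuration. Let $\mathcal C_m^*$ be the convex hull of the maximal configurations, $\mathcal C_m=\{x\in\mathbb R_+^J: x\le y\text{ for some }y\in\mathcal C_m^*\}$, and $\mathcal C=\sum_m\mathcal C_m$ (Minkowski sum). Write $\mathcal C=\{x\ge 0:\langle c^{(k)},x\rangle\le b^{(k)},\ k=1,\dots,K\}$ with $\|c^{(k)}\|=1$, $c^{(k)}\ge 0$, $b^{(k)}\ge 0$ and no inequality superfluous, $\mathcal H^{(k)}=\{x:\langle c^{(k)},x\rangle=b^{(k)}\}$ and $\mathcal F^{(k)}=\mathcal C\cap\mathcal H^{(k)}$. Assume that all servers are identical: $R_{i,m}=R_i$. Time is slotted. In each slot a finite list of jobs of each type arrives, with sizes in $\{1,\dots,D_{\max}\}$;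 the arrivals are i.i.d. across slots, and $a_j$ is the total size of the type-$j$ arrivals in a slot. Let $\lambda=(\mathbb E a_j)_j$ and $\sigma_j^2=\operatorname{var}(a_j)$; the $a_j$ of different types are uncorrelated. Let $q_{j,m}$ be the total remaining size of the type-$j$ jobs at server $m$. *JSQ routing:* all type-$j$ arrivals of a slot join a server with the smallest $q_{j,m}$, ties being broken uniformly at random (independently over the types). *MaxWeight scheduling:* server $m$ chooses, from the queue lengths before the arrivals, a configuration $\overline s^m\in\mathcal C_m^*$ that maximizes $\sum_j x_jq_{j,m}$ over $x\in\mathcal C_m^*$; after the arrivals have joined, it gives one unit of service to each of $\overline s^m_j$ jobs of type $j$, or to all of them if there are fewer. The choice among several maximizing configurations, and of the jobs to serve, is an arbitrary, possibly randomized, rule (a "MaxWeight policy"). The lists of remaining job sizes then form a Markov chain. For $\lambda\in\operatorname{int}\mathcal C$ let $\epsilon^{(k)}=\min_{s\in\mathcal H^{(k)}}\|\lambda-s\|$ and $\lambda^{(k)}=\lambda+\epsilon^{(k)}c^{(k)}$, and let $\mathcal K^o_\lambda$ be the set of $k$ such that $\lambda^{(k)}\in\mathcal C$ and $\lambda^{(k)}$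 lies in the relative interior of $\mathcal F^{(k)}$. Let $\mathbf c^{(k)}\in\mathbb R^{JM}$ have the entries $\mathbf c^{(k)}_{j,m}=c^{(k)}_j/\sqrt M$. **Proposition.** Fix $k$ and a point $\lambda^{(k)}$, and consider any family of arrival laws such that the squares $a_j^2$ are uniformly integrable over the family and such that for each law of the family the arrival rate $\lambda$ is in $\operatorname{int}\mathcal C$, $k\in\mathcal K^o_{\lambda}$, and the closest point to $\lambda$ on $\mathcal H^{(k)}$ is $\lambda^{(k)}$ (so that the rates approach the face along its normal). 1. There is a function $B_2$ with $B_2(\epsilon)\to 0$ as $\epsilon\downarrow 0$ such that, for every law of the family, with $\epsilon^{(k)}$ the distance of its rate to $\mathcal H^{(k)}$ and $\sigma_j^2$ its variances, and for every MaxWeight policy, the chain has a stationary distribution, and under every stationary distribution $\mathbb E\langle\mathbf c^{(k)},\mathbf q\rangle<\infty$ and $$\epsilon^{(k)}\,\mathbb E\langle\mathbf c^{(k)},\mathbf q\rangle\le\tfrac12\zeta^{(\epsilon,k)}+B_2(\epsilon^{(k)}),\qquad \zeta^{(\epsilon,k)}=\frac1{\sqrt M}\sum_j (c^{(k)}_j)^2\sigma_j^2+\frac{(\epsilon^{(k)})^2}{\sqrt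 M}.$$ 2. Along every sequence (or net, or filter) in the family with $\epsilon^{(k)}\downarrow0$ and variances converging to some $\sigma^2=(\sigma_j^2)_j$, and for any MaxWeight policies and stationary distributions, $$\epsilon^{(k)}\,\mathbb E\langle\mathbf c^{(k)},\mathbf q\rangle\ \longrightarrow\ \frac{\zeta^{(k)}}2=\frac1{2\sqrt M}\sum_j (c^{(k)}_j)^2\sigma_j^2 .$$ -/

import Mathlib

open Filter Topology
open scoped NNReal ENNReal

/-! ### Expectations under a discrete law -/

/-- `E[f]` under the discrete law `p`. Its convergence is always asserted or implied separately. -/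
noncomputable def pmfExpect {α : Type*} (p : PMF α) (f : α → ℝ) : ℝ :=
  ∑' x, (p x).toReal * f x

/-- Absolute convergence of `E[f]` under the discrete law `p`. -/
def PMFIntegrable {α : Type*} (p : PMF α) (f : α → ℝ) : Prop :=
  Summable fun x => (p x).toReal * f x

/-! ### Servers, configurations and the capacity region -/

/-- `I` resources, `J` job types, `M` servers: server `m` has `cap i m` units of resource `i`, and
a job of type `j` needs `req i j` units of it. -/
structure CloudSystem (I J M : ℕ) where
  cap : Fin I → Fin M → ℝ≥0
  req : Fin I → Fin J → ℝ≥0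

namespace CloudSystem

variable {I J M : ℕ}

/-- All servers have the same amount of every resource. -/
def Identical (sys : CloudSystem I J M) : Prop :=
  ∃ R : Fin I → ℝ≥0, ∀ i m, sys.cap i m = R i

/-- Feasible configurations of server `m`: `s j` jobs of type `j` fit simultaneously. -/
def configs (sys : CloudSystem I J M) (m : Fin M) : Set (Fin J → ℕ) :=
  {s | ∀ i, ∑ j, (s j : ℝ≥0) * sys.req i j ≤ sys.cap i m}

/-- Maximal configurations: feasible, and no further job of any type fits. -/
def maximalConfigs (sys : CloudSystem I J M) (m : Fin M) : Set (Fin J → ℕ) :=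
  {s | s ∈ sys.configs m ∧ ∀ j, s + Pi.single j 1 ∉ sys.configs m}

end CloudSystem

/-- An integer vector as a point of Euclidean `J`-space. -/
noncomputable def natVec {J : ℕ} (s : Fin J → ℕ) : EuclideanSpace ℝ (Fin J) :=
  WithLp.toLp 2 fun j => (s j : ℝ)

namespace CloudSystem

variable {I J M : ℕ}

/-- Convex hull of the maximal configurations of server `m`. -/
def maximalHull (sys : CloudSystem I J M) (m : Fin M) : Set (EuclideanSpace ℝ (Fin J)) :=
  convexHull ℝ (natVec '' sys.maximalConfigs m)

/-- Capacity region of server `m`: nonnegative vectors dominated by a point of the hull. -/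
def serverRegion (sys : CloudSystem I J M) (m : Fin M) : Set (EuclideanSpace ℝ (Fin J)) :=
  {x | (∀ j, 0 ≤ x j) ∧ ∃ y ∈ sys.maximalHull m, ∀ j, x j ≤ y j}

/-- Capacity region of the system: Minkowski sum of the regions of the servers. -/
def capacityRegion (sys : CloudSystem I J M) : Set (EuclideanSpace ℝ (Fin J)) :=
  {x | ∃ f : Fin M → EuclideanSpace ℝ (Fin J), (∀ m, f m ∈ sys.serverRegion m) ∧ x = ∑ m, f m}

end CloudSystem

/-! ### Hyperplanes and faces -/

/-- The region cut out of the nonnegative orthant by the inequalities with index in `T`. -/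
def orthantPolyhedron {J K : ℕ} (c : Fin K → EuclideanSpace ℝ (Fin J)) (b : Fin K → ℝ)
    (T : Set (Fin K)) : Set (EuclideanSpace ℝ (Fin J)) :=
  {x | (∀ j, 0 ≤ x j) ∧ ∀ k ∈ T, inner ℝ (c k) x ≤ b k}

/-- `C` is described, inside the nonnegative orthant, by the `K` hyperplanes `⟨c k, x⟩ = b k`
with nonnegative unit normals `c k`, and none of them can be left out. -/
structure IsHyperplaneDescription {J K : ℕ} (C : Set (EuclideanSpace ℝ (Fin J)))
    (c : Fin K → EuclideanSpace ℝ (Fin J)) (b : Fin K → ℝ) : Prop where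
  norm_eq_one : ∀ k, ‖c k‖ = 1
  normal_nonneg : ∀ k j, 0 ≤ c k j
  offset_nonneg : ∀ k, 0 ≤ b k
  eq_polyhedron : C = orthantPolyhedron c b Set.univ
  irredundant : ∀ k, orthantPolyhedron c b {k}ᶜ ≠ C

/-- The hyperplane `⟨c, x⟩ = b`. -/
def hyperplane {J : ℕ} (c : EuclideanSpace ℝ (Fin J)) (b : ℝ) : Set (EuclideanSpace ℝ (Fin J)) :=
  {x | inner ℝ c x = b}

/-- Distance of `lam` to the hyperplane `⟨c, x⟩ = b`. -/
noncomputable def hyperplaneDist {J : ℕ} (c : EuclideanSpace ℝ (Fin J)) (b : ℝ)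
    (lam : EuclideanSpace ℝ (Fin J)) : ℝ :=
  Metric.infDist lam (hyperplane c b)

/-- Closest point of the hyperplane to a point `lam` of the capacity region. -/
noncomputable def closestPoint {J : ℕ} (c : EuclideanSpace ℝ (Fin J)) (b : ℝ)
    (lam : EuclideanSpace ℝ (Fin J)) : EuclideanSpace ℝ (Fin J) :=
  lam + hyperplaneDist c b lam • c

/-- Indices `k` of the hyperplanes whose closest point to `lam` belongs to `C` and lies in the
relative interior of the face that the hyperplane cuts out of `C`. -/
def dominantFaces {J K : ℕ} (C : Set (EuclideanSpace ℝ (Fin J)))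
    (c : Fin K → EuclideanSpace ℝ (Fin J)) (b : Fin K → ℝ) (lam : EuclideanSpace ℝ (Fin J)) :
    Set (Fin K) :=
  {k | closestPoint (c k) (b k) lam ∈ C ∧
    closestPoint (c k) (b k) lam ∈ intrinsicInterior ℝ (C ∩ hyperplane (c k) (b k))}

/-! ### Jobs, arrivals and queues -/

/-- Possible (remaining) sizes of a job: `1, …, D`, where `D` is the maximal service time. -/
abbrev JobSize (D : ℕ) : Type := {d : ℕ // 1 ≤ d ∧ d ≤ D}

/-- Total size of a list of jobs. -/
def workload {D : ℕ} (L : List (JobSize D)) : ℕ := (L.map Subtype.val).sum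

/-- The jobs of each type that arrive in one time slot. -/
abbrev Arrivals (J D : ℕ) : Type := Fin J → List (JobSize D)

/-- State of the system: for each type `j` and server `m` the list of the remaining sizes of the
type-`j` jobs present at `m`. -/
abbrev CloudState (J M D : ℕ) : Type := Fin J → Fin M → List (JobSize D)

/-- Mean arrival rate (in units of work) of the law `μ` of the arrivals of one slot. -/
noncomputable def arrivalRate {J D : ℕ} (μ : PMF (Arrivals J D)) : EuclideanSpace ℝ (Fin J) :=
  WithLp.toLp 2 fun j => pmfExpect μ fun A => (workload (A j) : ℝ)

/-- Covariance of the amounts of work of types `j` and `j'` that arrive in one slot. -/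
noncomputable def arrivalCov {J D : ℕ} (μ : PMF (Arrivals J D)) (j j' : Fin J) : ℝ :=
  pmfExpect μ fun A =>
    ((workload (A j) : ℝ) - arrivalRate μ j) * ((workload (A j') : ℝ) - arrivalRate μ j')

/-- Variance of the amount of work of type `j` that arrives in one slot. -/
noncomputable def arrivalVar {J D : ℕ} (μ : PMF (Arrivals J D)) (j : Fin J) : ℝ :=
  arrivalCov μ j j

/-- The squares of the amounts of work arriving in one slot are uniformly integrable over a
family of arrival laws (in particular, all second moments are finite and bounded). -/
def UniformlySquareIntegrable {ι : Type*} {J D : ℕ} (μ : ι → PMF (Arrivals J D)) : Prop :=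
  ∀ η : ℝ≥0∞, η ≠ 0 → ∃ L : ℕ, ∀ i j,
    ∑' A : Arrivals J D, (if L < workload (A j) then μ i A * (workload (A j) : ℝ≥0∞) ^ 2 else 0)
      ≤ η

/-! ### Routing, scheduling, and the Markov chain -/

/-- The servers with the smallest type-`j` queue. -/
def shortestQueues {J M D : ℕ} (Y : CloudState J M D) (j : Fin J) : Finset (Fin M) :=
  Finset.univ.filter fun m => ∀ m', workload (Y j m) ≤ workload (Y j m')

theorem shortestQueues_nonempty {J M D : ℕ} [NeZero M] (Y : CloudState J M D) (j : Fin J) :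
    (shortestQueues Y j).Nonempty := by
  obtain ⟨m, -, hm⟩ := Finset.exists_min_image (Finset.univ : Finset (Fin M))
    (fun m => workload (Y j m)) ⟨0, Finset.mem_univ _⟩
  exact ⟨m, by simpa [shortestQueues] using fun m' => hm m' (Finset.mem_univ _)⟩

/-- Join-the-shortest-queue routing: each type chooses one of its shortest queues, ties being
broken uniformly at random, independently over the types. -/
noncomputable def jsqRoute {J M D : ℕ} [NeZero M] (Y : CloudState J M D) : PMF (Fin J → Fin M) :=
  PMF.uniformOfFinset (Fintype.piFinset fun j => shortestQueues Y j)
    (Fintype.piFinset_nonempty.2 fun j => shortestQueues_nonempty Y j)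

/-- The state after all type-`j` arrivals have joined server `ρ j`, for every `j`. -/
def afterArrivals {J M D : ℕ} (Y : CloudState J M D) (A : Arrivals J D) (ρ : Fin J → Fin M) :
    CloudState J M D :=
  fun j m => if m = ρ j then Y j m ++ A j else Y j m

/-- `ServeJobs n L L'`: exactly `n` of the jobs in `L` receive one unit of service each, finished
jobs leave, and `L'` is the resulting list. -/
inductive ServeJobs {D : ℕ} : ℕ → List (JobSize D) → List (JobSize D) → Prop
  | nil : ServeJobs 0 [] []
  | skip {n : ℕ} {L L' : List (JobSize D)} (x : JobSize D) (h : ServeJobs n L L') :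
      ServeJobs n (x :: L) (x :: L')
  | finish {n : ℕ} {L L' : List (JobSize D)} (x : JobSize D) (hx : x.1 = 1)
      (h : ServeJobs n L L') : ServeJobs (n + 1) (x :: L) L'
  | work {n : ℕ} {L L' : List (JobSize D)} (x y : JobSize D) (hxy : x.1 = y.1 + 1)
      (h : ServeJobs n L L') : ServeJobs (n + 1) (x :: L) (y :: L')

/-- `s` is a MaxWeight schedule of server `m` in state `Y`: a configuration in the hull of the
maximal configurations whose weight, with the queue lengths as weights, is largest in that hull. -/
def IsMaxWeight {I J M D : ℕ} (sys : CloudSystem I J M) (Y : CloudState J M D) (m : Fin M)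
    (s : Fin J → ℕ) : Prop :=
  s ∈ sys.configs m ∧ natVec s ∈ sys.maximalHull m ∧
    ∀ x ∈ sys.maximalHull m,
      ∑ j, x j * (workload (Y j m) : ℝ) ≤ ∑ j, (s j : ℝ) * (workload (Y j m) : ℝ)

/-- Everything the MaxWeight algorithm leaves open, possibly randomized: which of the MaxWeight
schedules is used in a state, and which jobs of a queue are then served. The schedule is
chosen before the arrivals are seen; then, after the arrivals have joined, `s m j` type-`j` jobs
at server `m` are served for one slot, or all of them if there are fewer than `s m j`. -/
structure MaxWeightPolicy {I J M : ℕ} (sys : CloudSystem I J M) (D : ℕ) where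
  sched : CloudState J M D → PMF (Fin M → Fin J → ℕ)
  sched_maxWeight : ∀ Y, ∀ s ∈ (sched Y).support, ∀ m, IsMaxWeight sys Y m (s m)
  serve : CloudState J M D → (Fin M → Fin J → ℕ) → PMF (CloudState J M D)
  serve_spec : ∀ Y s, ∀ Y' ∈ (serve Y s).support, ∀ j m,
    ServeJobs (min (s m j) (Y j m).length) (Y j m) (Y' j m)

/-- Transition law of the Markov chain of states under JSQ routing and MaxWeight scheduling, when
the arrivals of the successive slots are independent with law `μ`. -/
noncomputable def cloudStep {I J M D : ℕ} [NeZero M] {sys : CloudSystem I J M}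
    (P : MaxWeightPolicy sys D) (μ : PMF (Arrivals J D)) (Y : CloudState J M D) :
    PMF (CloudState J M D) :=
  μ.bind fun A => (jsqRoute Y).bind fun ρ => (P.sched Y).bind fun s =>
    P.serve (afterArrivals Y A ρ) s

/-- `π` is a steady-state (stationary) distribution of the chain. -/
def IsSteadyState {I J M D : ℕ} [NeZero M] {sys : CloudSystem I J M}
    (P : MaxWeightPolicy sys D) (μ : PMF (Arrivals J D)) (π : PMF (CloudState J M D)) : Prop :=
  π.bind (cloudStep P μ) = π

/-- The weighted queue length `⟨𝐜, 𝐪⟩`, where `𝐜` has the entries `c j / √M`. -/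
noncomputable def weightedQueue {J M D : ℕ} (c : EuclideanSpace ℝ (Fin J))
    (Y : CloudState J M D) : ℝ :=
  ∑ j, ∑ m, c j / Real.sqrt M * (workload (Y j m) : ℝ)

/-! Let `u = faceVec M c`, a unit vector, and let `y = ⟨u, q⟩` be the weighted queue length. In one
slot `y` changes by `α + W - b/√M`. Here `α` is the weighted arriving work, of mean `(b - ε)/√M`,
and the slack `W` is nonnegative and bounded; it collects the unused service and the distance of the
schedules from the face. Stationarity of the mean of `y` forces `E W ≤ ε/√M` (`lexp_meanSlack_le`).
Stationarity of the mean of `y²` would give `2 (ε/√M) E y = E (α + W - b/√M)² + 2 E (y W)`. As `W`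
is bounded with small mean, the first term on the right is the variance of `α`, that is `∑ c_j² σ_j²
/ M`, up to `o(1)`. After multiplication by `√M / 2` this is the asserted limit, provided that `E (y
W)` vanishes in the limit.

The lower bound (`weightedQueue_lower_bound`) just drops `y W ≥ 0`. The upper bound
(`weightedQueue_upper_bound`) rests on `y W ≤ C (1 + ‖q⊥‖) W`
(`FaceData.weightedQueue_mul_slack_le`), where `q⊥` is the part of `q` orthogonal to `u`: unused
service needs a short queue, and a schedule off the face can have maximal weight only if `q` is far
from the direction `u`. It remains to know that `‖q⊥‖` is uniformly integrable as `ε` tends to zero.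
This is state-space collapse (`exists_lexp_perpNorm_le`).

Collapse comes from a drift of `‖q⊥‖²` of order `-‖q⊥‖` (`FaceData.mean_drift_le`). A ball around
`λ^(k)` within the hyperplane lies in the capacity region, so MaxWeight pulls the queues of each
server towards the direction of `c`; every type has an arrival rate bounded away from zero, so JSQ
equalizes the servers. Only squares of the arrivals are uniformly integrable, so exponential moments
are out of reach. The Lyapunov function is the square of the excess of `‖q⊥‖` over a level `K`, used
once at a fixed level and once at a high one.

Stationary second moments of the queues are not known to be finite. Means are therefore taken in
`ℝ≥0∞`, and drift identities are replaced by truncated inequalities: `lexp_le_of_drift` from above,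
`linearizedSq` from below. Stationary laws exist by Foster's criterion with `‖q‖²`. All constants
depend on the face and on a common bound of the second moments, which makes the estimates uniform in
the law, the policy and the stationary law. -/

/-! ### Expectations of `ℝ≥0∞`-valued functions -/

/-- `E[f]` in `ℝ≥0∞` under the discrete law `p`. -/
noncomputable def lexp {α : Type*} (p : PMF α) (f : α → ℝ≥0∞) : ℝ≥0∞ := ∑' x, p x * f x

section lexp

variable {α β : Type*}

theorem lexp_bind (p : PMF α) (k : α → PMF β) (f : β → ℝ≥0∞) :
    lexp (p.bind k) f = lexp p fun x => lexp (k x) f := by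
  simp only [lexp, PMF.bind_apply, ← ENNReal.tsum_mul_right, ← ENNReal.tsum_mul_left]
  rw [ENNReal.tsum_comm]
  simp only [mul_assoc]

theorem lexp_pure (x : α) (f : α → ℝ≥0∞) : lexp (PMF.pure x) f = f x := by
  classical
  rw [lexp, tsum_eq_single x]
  · simp
  · intro y hy; simp [PMF.pure_apply, hy]

theorem lexp_const (p : PMF α) (a : ℝ≥0∞) : lexp p (fun _ => a) = a := by
  rw [lexp, ENNReal.tsum_mul_right, PMF.tsum_coe, one_mul]

theorem lexp_add (p : PMF α) (f g : α → ℝ≥0∞) :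
    lexp p (fun x => f x + g x) = lexp p f + lexp p g := by
  simp only [lexp, mul_add, ENNReal.tsum_add]

theorem lexp_const_mul (p : PMF α) (a : ℝ≥0∞) (f : α → ℝ≥0∞) :
    lexp p (fun x => a * f x) = a * lexp p f := by
  simp only [lexp, ← ENNReal.tsum_mul_left]
  exact tsum_congr fun x => by ring

theorem lexp_mono_support (p : PMF α) {f g : α → ℝ≥0∞} (h : ∀ x ∈ p.support, f x ≤ g x) :
    lexp p f ≤ lexp p g := by
  refine ENNReal.tsum_le_tsum fun x => ?_
  by_cases hx : p x = 0
  · simp [hx]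
  · exact mul_le_mul_right (h x ((PMF.mem_support_iff p x).2 hx)) _

theorem lexp_mono (p : PMF α) {f g : α → ℝ≥0∞} (h : ∀ x, f x ≤ g x) : lexp p f ≤ lexp p g :=
  lexp_mono_support p fun x _ => h x

theorem lexp_congr_support (p : PMF α) {f g : α → ℝ≥0∞} (h : ∀ x ∈ p.support, f x = g x) :
    lexp p f = lexp p g :=
  le_antisymm (lexp_mono_support p fun x hx => (h x hx).le)
    (lexp_mono_support p fun x hx => (h x hx).ge)

theorem lexp_iSup_nat (p : PMF α) (f : ℕ → α → ℝ≥0∞) (hf : ∀ x, Monotone fun n => f n x) :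
    lexp p (fun x => ⨆ n, f n x) = ⨆ n, lexp p (f n) := by
  simp only [lexp, ENNReal.mul_iSup]
  rw [ENNReal.tsum_eq_iSup_sum]
  simp only [ENNReal.tsum_eq_iSup_sum]
  rw [iSup_comm]
  refine iSup_congr fun s => ?_
  exact ENNReal.finsetSum_iSup_of_monotone fun x n m hnm => mul_le_mul_right (hf x hnm) _

/-- If the mean of `V` drifts by at most `h - g`, the stationary mean of `g` is at most that
of `h`, even if that of `V` is infinite. -/
theorem lexp_le_of_drift {π : PMF α} {k : α → PMF α} (hst : π.bind k = π)
    (V g h : α → ℝ≥0∞) (hV : ∀ x, V x ≠ ∞)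
    (hd : ∀ x, lexp (k x) V + g x ≤ V x + h x) : lexp π g ≤ lexp π h := by
  -- `V` may have infinite mean, but `min V n` has a finite one, which cancels by stationarity.
  -- Where `V > n` the truncated function cannot increase, so the drift inequality survives with `g`
  -- set to zero there.
  have key : ∀ n : ℕ, lexp π (fun x => if V x ≤ n then g x else 0) ≤ lexp π h := by
    intro n
    have h1 : ∀ x, lexp (k x) (fun y => min (V y) n) + (if V x ≤ n then g x else 0)
        ≤ min (V x) n + h x := by
      intro x
      by_cases hx : V x ≤ n
      · simp only [hx, if_true, min_eq_left]
        exact le_trans (add_le_add_left (lexp_mono _ fun y => min_le_left _ _) _) (hd x)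
      · simp only [hx, if_false, add_zero]
        rw [min_eq_right (not_le.1 hx).le]
        refine le_trans ?_ le_self_add
        calc _ ≤ lexp (k x) (fun _ => (n : ℝ≥0∞)) := lexp_mono _ fun y => min_le_right _ _
          _ = n := lexp_const _ _
    have h2 := lexp_mono π h1
    rw [lexp_add, lexp_add, ← lexp_bind, hst] at h2
    refine (ENNReal.add_le_add_iff_left ?_).1 h2
    refine ne_top_of_le_ne_top (ENNReal.natCast_ne_top n) ?_
    calc _ ≤ lexp π (fun _ => (n : ℝ≥0∞)) := lexp_mono _ fun y => min_le_right _ _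
      _ = n := lexp_const _ _
  have hsup : (fun x => ⨆ n : ℕ, if V x ≤ n then g x else 0) = g := by
    funext x
    refine le_antisymm (iSup_le fun n => by split_ifs <;> simp) ?_
    obtain ⟨n, hn⟩ := ENNReal.exists_nat_gt (hV x)
    exact le_iSup_of_le n (by simp [hn.le])
  rw [← hsup, lexp_iSup_nat]
  · exact iSup_le key
  · intro x n m hnm
    dsimp only
    split_ifs with h1 h2
    · exact le_rfl
    · exact absurd (h1.trans (by exact_mod_cast hnm)) h2
    · simp
    · simp

theorem lexp_stationary {π : PMF α} {k : α → PMF α} (hst : π.bind k = π) (f : α → ℝ≥0∞) :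
    lexp π (fun x => lexp (k x) f) = lexp π f := by
  rw [← lexp_bind, hst]

/-- Laws of a Markov chain started at `x₀`. -/
noncomputable def chainLaw (k : α → PMF α) (x₀ : α) : ℕ → PMF α
  | 0 => PMF.pure x₀
  | n + 1 => (chainLaw k x₀ n).bind k

/-- Cesàro averages of the laws of a Markov chain. -/
noncomputable def cesaroLaw (k : α → PMF α) (x₀ : α) (n : ℕ) (x : α) : ℝ≥0∞ :=
  ((n : ℝ≥0∞) + 1)⁻¹ * ∑ i ∈ Finset.range (n + 1), chainLaw k x₀ i x

theorem tsum_cesaroLaw_mul (k : α → PMF α) (x₀ : α) (n : ℕ) (f : α → ℝ≥0∞) :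
    ∑' x, cesaroLaw k x₀ n x * f x =
      ((n : ℝ≥0∞) + 1)⁻¹ * ∑ i ∈ Finset.range (n + 1), lexp (chainLaw k x₀ i) f := by
  simp only [cesaroLaw, lexp, mul_assoc, ENNReal.tsum_mul_left, Finset.sum_mul]
  rw [Summable.tsum_finsetSum fun i _ => ENNReal.summable]

/-- The drift inequality telescopes along the chain. -/
theorem sum_lexp_chainLaw_le (k : α → PMF α) (x₀ : α) (V g : α → ℝ≥0∞) (C : ℝ≥0∞)
    (hd : ∀ x, lexp (k x) V + g x ≤ V x + C) (n : ℕ) :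
    lexp (chainLaw k x₀ n) V + ∑ i ∈ Finset.range n, lexp (chainLaw k x₀ i) g
      ≤ V x₀ + n * C := by
  induction n with
  | zero => simp [chainLaw, lexp_pure]
  | succ n ih =>
    have h := lexp_mono (chainLaw k x₀ n) hd
    rw [lexp_add, lexp_add, lexp_const, ← lexp_bind] at h
    rw [Finset.sum_range_succ, chainLaw]
    calc _ = (lexp ((chainLaw k x₀ n).bind k) V + lexp (chainLaw k x₀ n) g)
          + ∑ i ∈ Finset.range n, lexp (chainLaw k x₀ i) g := by ring
      _ ≤ (lexp (chainLaw k x₀ n) V + C) + ∑ i ∈ Finset.range n, lexp (chainLaw k x₀ i) g := by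
          gcongr
      _ = (lexp (chainLaw k x₀ n) V + ∑ i ∈ Finset.range n, lexp (chainLaw k x₀ i) g) + C := by
          ring
      _ ≤ V x₀ + n * C + C := by gcongr
      _ = _ := by push_cast; ring

theorem inv_succ_mul_succ (n : ℕ) : ((n : ℝ≥0∞) + 1)⁻¹ * ((n : ℝ≥0∞) + 1) = 1 :=
  ENNReal.inv_mul_cancel (by simp) (by simp)

theorem tsum_cesaroLaw (k : α → PMF α) (x₀ : α) (n : ℕ) : ∑' x, cesaroLaw k x₀ n x = 1 := by
  have h := tsum_cesaroLaw_mul k x₀ n fun _ => 1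
  simp only [mul_one, lexp_const] at h
  rw [h]
  simp [inv_succ_mul_succ]

theorem tsum_cesaroLaw_mul_le (k : α → PMF α) (x₀ : α) (V g : α → ℝ≥0∞) (C : ℝ≥0∞)
    (hd : ∀ x, lexp (k x) V + g x ≤ V x + C) (n : ℕ) :
    ∑' x, cesaroLaw k x₀ n x * g x ≤ V x₀ + C := by
  rw [tsum_cesaroLaw_mul]
  calc _ ≤ ((n : ℝ≥0∞) + 1)⁻¹ * (V x₀ + (n + 1 : ℕ) * C) := by
        gcongr
        exact le_trans le_add_self (sum_lexp_chainLaw_le k x₀ V g C hd (n + 1))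
    _ ≤ ((n : ℝ≥0∞) + 1)⁻¹ * (((n : ℝ≥0∞) + 1) * (V x₀ + C)) := by
        refine mul_le_mul_right ?_ _
        push_cast
        rw [mul_add _ (V x₀)]
        exact add_le_add_left (le_mul_of_one_le_left (by simp) (by simp)) _
    _ = _ := by rw [← mul_assoc, inv_succ_mul_succ, one_mul]

/-- A step of the chain shifts the averaged laws by one, so the average changes only by its two end
terms. Limits of the averages are therefore invariant. -/
theorem tsum_cesaroLaw_step_le (k : α → PMF α) (x₀ : α) (n : ℕ) (y : α) :
    ∑' x, cesaroLaw k x₀ n x * k x y ≤ cesaroLaw k x₀ n y + ((n : ℝ≥0∞) + 1)⁻¹ := by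
  rw [tsum_cesaroLaw_mul]
  have h : ∀ i, lexp (chainLaw k x₀ i) (fun x => k x y) = chainLaw k x₀ (i + 1) y := fun i => by
    rw [chainLaw, PMF.bind_apply, lexp]
  simp only [h, cesaroLaw]
  have h2 : ∑ i ∈ Finset.range (n + 1), chainLaw k x₀ (i + 1) y ≤
      ∑ i ∈ Finset.range (n + 1), chainLaw k x₀ i y + 1 := by
    rw [Finset.sum_range_succ, Finset.sum_range_succ' (fun i => chainLaw k x₀ i y) n]
    exact add_le_add le_self_add (PMF.coe_le_one _ _)
  calc _ ≤ ((n : ℝ≥0∞) + 1)⁻¹ * (∑ i ∈ Finset.range (n + 1), chainLaw k x₀ i y + 1) :=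
        mul_le_mul_right h2 _
    _ = _ := by rw [mul_add, mul_one]

/-- A Markov chain on a discrete space with a Foster–Lyapunov function has a stationary law. -/
theorem exists_stationary_of_drift (k : α → PMF α) (x₀ : α) (V g : α → ℝ≥0∞) (C : ℝ≥0∞)
    (hC : C ≠ ∞) (hV : V x₀ ≠ ∞) (hg : ∀ L : ℕ, {x | g x ≤ L}.Finite)
    (hd : ∀ x, lexp (k x) V + g x ≤ V x + C) : ∃ π : PMF α, π.bind k = π := by
  classical
  -- By compactness of `ℝ≥0∞`, a nonprincipal ultrafilter makes the averages converge at all states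
  -- simultaneously, without subsequences.
  let U : Ultrafilter ℕ := hyperfilter ℕ
  have hU : (U : Filter ℕ) ≤ atTop := by
    rw [← Nat.cofinite_eq_atTop]; exact hyperfilter_le_cofinite
  let m := cesaroLaw k x₀
  let p : α → ℝ≥0∞ := fun x => (U.map fun n => m n x).lim
  have hp : ∀ x, Tendsto (fun n => m n x) U (𝓝 (p x)) := fun x =>
    (U.map fun n => m n x).le_nhds_lim
  have hinv : Tendsto (fun n : ℕ => ((n : ℝ≥0∞) + 1)⁻¹) U (𝓝 0) := by
    have := (tendsto_add_atTop_iff_nat 1).2 ENNReal.tendsto_inv_nat_nhds_zero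
    refine Tendsto.mono_left ?_ hU
    simpa using this
  have hp1 : ∑' x, p x ≤ 1 := by
    rw [ENNReal.tsum_eq_iSup_sum]
    refine iSup_le fun s => ?_
    refine le_of_tendsto (tendsto_finsetSum s fun x _ => hp x) (Eventually.of_forall fun n => ?_)
    exact (ENNReal.sum_le_tsum s).trans (tsum_cesaroLaw k x₀ n).le
  -- Tightness: the averages of `g` are bounded by `V x₀ + C` and the sublevel sets of `g` are
  -- finite, so by Markov's inequality a finite set carries all but an arbitrarily small part of the
  -- mass, uniformly in `n`.
  have hp2 : 1 ≤ ∑' x, p x := by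
    have h1 : ∀ L : ℕ, 1 ≤ ∑' x, p x + (V x₀ + C) * ((L : ℝ≥0∞) + 1)⁻¹ := by
      intro L
      let s := (hg (L + 1)).toFinset
      have h2 : ∀ n, 1 ≤ ∑ x ∈ s, m n x + (V x₀ + C) * ((L : ℝ≥0∞) + 1)⁻¹ := by
        intro n
        calc 1 = ∑' x, m n x := (tsum_cesaroLaw k x₀ n).symm
          _ ≤ ∑' x, ((if x ∈ s then m n x else 0) + m n x * g x * ((L : ℝ≥0∞) + 1)⁻¹) := by
              refine ENNReal.tsum_le_tsum fun x => ?_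
              by_cases hx : x ∈ s
              · simp [hx]
              · simp only [hx, if_false, zero_add]
                have : ((L : ℝ≥0∞) + 1) ≤ g x := by
                  have : ¬ g x ≤ ((L + 1 : ℕ) : ℝ≥0∞) := by simpa [s] using hx
                  push_cast at this
                  exact (not_le.1 this).le
                calc m n x = m n x * (((L : ℝ≥0∞) + 1)⁻¹ * ((L : ℝ≥0∞) + 1)) := by
                      rw [inv_succ_mul_succ, mul_one]
                  _ ≤ m n x * (((L : ℝ≥0∞) + 1)⁻¹ * g x) := by gcongr
                  _ = _ := by ring
          _ ≤ _ := by
              rw [ENNReal.tsum_add, ENNReal.tsum_mul_right]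
              refine add_le_add ?_ ?_
              · rw [tsum_eq_sum (s := s) fun x hx => by simp [hx]]
                exact (Finset.sum_congr rfl fun x hx => by simp [hx]).le
              · gcongr
                exact tsum_cesaroLaw_mul_le k x₀ V g C hd n
      have h3 : 1 ≤ ∑ x ∈ s, p x + (V x₀ + C) * ((L : ℝ≥0∞) + 1)⁻¹ :=
        ge_of_tendsto ((tendsto_finsetSum s fun x _ => hp x).add_const _)
          (Eventually.of_forall h2)
      exact h3.trans (by gcongr; exact ENNReal.sum_le_tsum s)
    have h4 : Tendsto (fun L : ℕ => ∑' x, p x + (V x₀ + C) * ((L : ℝ≥0∞) + 1)⁻¹) U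
        (𝓝 (∑' x, p x + (V x₀ + C) * 0)) :=
      tendsto_const_nhds.add (ENNReal.Tendsto.const_mul hinv
        (Or.inr (ENNReal.add_ne_top.2 ⟨hV, hC⟩)))
    simpa using ge_of_tendsto h4 (Eventually.of_forall h1)
  have hsum : HasSum p 1 := (le_antisymm hp1 hp2) ▸ ENNReal.summable.hasSum
  let π : PMF α := ⟨p, hsum⟩
  -- The limit over finite partial sums yields only that `π` dominates its image. Both have total
  -- mass one, so a strict inequality at one state is impossible.
  have hle : ∀ y, (π.bind k) y ≤ π y := by
    intro y
    rw [PMF.bind_apply, ENNReal.tsum_eq_iSup_sum]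
    refine iSup_le fun s => ?_
    have h1 : Tendsto (fun n => ∑ x ∈ s, m n x * k x y) U (𝓝 (∑ x ∈ s, p x * k x y)) :=
      tendsto_finsetSum s fun x _ =>
        ENNReal.Tendsto.mul_const (hp x) (Or.inr (PMF.apply_ne_top _ _))
    have h2 : Tendsto (fun n : ℕ => m n y + ((n : ℝ≥0∞) + 1)⁻¹) U (𝓝 (p y + 0)) :=
      (hp y).add hinv
    rw [add_zero] at h2
    exact le_of_tendsto_of_tendsto' h1 h2 fun n =>
      (ENNReal.sum_le_tsum s).trans (tsum_cesaroLaw_step_le k x₀ n y)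
  refine ⟨π, PMF.ext fun y => le_antisymm (hle y) ?_⟩
  by_contra hy
  have := ENNReal.tsum_lt_tsum (i := y) (by rw [PMF.tsum_coe]; simp) hle (not_le.1 hy)
  rw [PMF.tsum_coe, PMF.tsum_coe] at this
  exact lt_irrefl _ this

end lexp

/-! ### Real-valued expectations -/

section pmfExpect

variable {α β : Type*} {p : PMF α} {f g : α → ℝ}

theorem ofReal_toReal_mul (p : PMF α) (f : α → ℝ) (x : α) :
    ENNReal.ofReal ((p x).toReal * f x) = p x * ENNReal.ofReal (f x) := by
  rw [ENNReal.ofReal_mul ENNReal.toReal_nonneg, ENNReal.ofReal_toReal (PMF.apply_ne_top p x)]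

theorem pmfIntegrable_iff : PMFIntegrable p f ↔ lexp p (fun x => ENNReal.ofReal |f x|) ≠ ∞ := by
  have h : ∀ x, p x * ENNReal.ofReal |f x| = ENNReal.ofReal |(p x).toReal * f x| := fun x => by
    rw [abs_mul, abs_of_nonneg ENNReal.toReal_nonneg]
    exact (ofReal_toReal_mul p (fun x => |f x|) x).symm
  rw [PMFIntegrable, ← summable_abs_iff, lexp]
  simp only [h]
  constructor
  · intro hs; exact hs.tsum_ofReal_ne_top
  · intro hs
    have := ENNReal.summable_toReal hs
    simpa [ENNReal.toReal_ofReal, abs_nonneg] using this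

theorem PMFIntegrable.mono (hg : PMFIntegrable p g) (h : ∀ x ∈ p.support, |f x| ≤ g x) :
    PMFIntegrable p f := by
  rw [pmfIntegrable_iff] at *
  refine ne_top_of_le_ne_top hg (lexp_mono_support p fun x hx => ENNReal.ofReal_le_ofReal ?_)
  exact (h x hx).trans (le_abs_self _)

theorem PMFIntegrable.add (hf : PMFIntegrable p f) (hg : PMFIntegrable p g) :
    PMFIntegrable p fun x => f x + g x := by
  have := Summable.add hf hg
  simpa only [PMFIntegrable, mul_add] using this

theorem PMFIntegrable.sub (hf : PMFIntegrable p f) (hg : PMFIntegrable p g) :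
    PMFIntegrable p fun x => f x - g x := by
  have := Summable.sub hf hg
  simpa only [PMFIntegrable, mul_sub] using this

theorem PMFIntegrable.const_mul (hf : PMFIntegrable p f) (a : ℝ) :
    PMFIntegrable p fun x => a * f x := by
  have := Summable.mul_left a hf
  simpa only [PMFIntegrable, mul_left_comm] using this

theorem pmfIntegrable_const (p : PMF α) (a : ℝ) : PMFIntegrable p fun _ => a := by
  rw [pmfIntegrable_iff, lexp_const]; exact ENNReal.ofReal_ne_top

theorem PMFIntegrable.sum {κ : Type*} (s : Finset κ) {F : κ → α → ℝ}
    (h : ∀ i ∈ s, PMFIntegrable p (F i)) : PMFIntegrable p fun x => ∑ i ∈ s, F i x := by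
  have := summable_sum h
  simpa only [PMFIntegrable, Finset.mul_sum] using this

theorem pmfExpect_add (hf : PMFIntegrable p f) (hg : PMFIntegrable p g) :
    pmfExpect p (fun x => f x + g x) = pmfExpect p f + pmfExpect p g := by
  simp only [pmfExpect, mul_add]; exact Summable.tsum_add hf hg

theorem pmfExpect_sub (hf : PMFIntegrable p f) (hg : PMFIntegrable p g) :
    pmfExpect p (fun x => f x - g x) = pmfExpect p f - pmfExpect p g := by
  simp only [pmfExpect, mul_sub]; exact Summable.tsum_sub hf hg

theorem pmfExpect_const_mul (p : PMF α) (f : α → ℝ) (a : ℝ) :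
    pmfExpect p (fun x => a * f x) = a * pmfExpect p f := by
  simp only [pmfExpect, mul_left_comm]; exact tsum_mul_left

theorem pmfExpect_const (p : PMF α) (a : ℝ) : pmfExpect p (fun _ => a) = a := by
  rw [pmfExpect, tsum_mul_right, ← ENNReal.tsum_toReal_eq fun x => PMF.apply_ne_top p x,
    PMF.tsum_coe]; simp

theorem pmfExpect_sum {κ : Type*} (s : Finset κ) {F : κ → α → ℝ}
    (h : ∀ i ∈ s, PMFIntegrable p (F i)) :
    pmfExpect p (fun x => ∑ i ∈ s, F i x) = ∑ i ∈ s, pmfExpect p (F i) := by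
  simp only [pmfExpect, Finset.mul_sum]; exact Summable.tsum_finsetSum h

theorem pmfExpect_congr (h : ∀ x ∈ p.support, f x = g x) : pmfExpect p f = pmfExpect p g := by
  refine tsum_congr fun x => ?_
  by_cases hx : p x = 0
  · simp [hx]
  · rw [h x ((PMF.mem_support_iff p x).2 hx)]

theorem pmfExpect_mono (hf : PMFIntegrable p f) (hg : PMFIntegrable p g)
    (h : ∀ x ∈ p.support, f x ≤ g x) : pmfExpect p f ≤ pmfExpect p g := by
  refine Summable.tsum_le_tsum (fun x => ?_) hf hg
  by_cases hx : p x = 0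
  · simp [hx]
  · exact mul_le_mul_of_nonneg_left (h x ((PMF.mem_support_iff p x).2 hx)) ENNReal.toReal_nonneg

theorem pmfExpect_nonneg (h : ∀ x, 0 ≤ f x) : 0 ≤ pmfExpect p f :=
  tsum_nonneg fun x => mul_nonneg ENNReal.toReal_nonneg (h x)

theorem lexp_ofReal (hf : PMFIntegrable p f) (h : ∀ x, 0 ≤ f x) :
    lexp p (fun x => ENNReal.ofReal (f x)) = ENNReal.ofReal (pmfExpect p f) := by
  simp only [lexp, pmfExpect, ← ofReal_toReal_mul]
  exact (ENNReal.ofReal_tsum_of_nonneg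
    (fun x => mul_nonneg ENNReal.toReal_nonneg (h x)) hf).symm

theorem pmfIntegrable_of_lexp (h : ∀ x, 0 ≤ f x)
    (hf : lexp p (fun x => ENNReal.ofReal (f x)) ≠ ∞) : PMFIntegrable p f := by
  rw [pmfIntegrable_iff]; simpa only [abs_of_nonneg (h _)] using hf

/-- A nonnegative function below an integrable one. -/
theorem lexp_le_ofReal (hg : PMFIntegrable p g) (h0 : ∀ x ∈ p.support, 0 ≤ g x)
    (h : ∀ x ∈ p.support, f x ≤ g x) :
    lexp p (fun x => ENNReal.ofReal (f x)) ≤ ENNReal.ofReal (pmfExpect p g) := by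
  have h1 : PMFIntegrable p fun x => |g x| := by
    rw [pmfIntegrable_iff] at *; simpa using hg
  have h2 : pmfExpect p g = pmfExpect p fun x => |g x| :=
    pmfExpect_congr fun x hx => (abs_of_nonneg (h0 x hx)).symm
  rw [h2, ← lexp_ofReal h1 fun x => abs_nonneg _]
  exact lexp_mono_support p fun x hx =>
    ENNReal.ofReal_le_ofReal ((h x hx).trans (le_abs_self _))

theorem lexp_map (p : PMF α) (φ : α → β) (F : β → ℝ≥0∞) :
    lexp (p.map φ) F = lexp p fun x => F (φ x) := by
  rw [PMF.map, lexp_bind]; simp only [Function.comp, lexp_pure]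

theorem pmfIntegrable_map {φ : α → β} {F : β → ℝ} :
    PMFIntegrable (p.map φ) F ↔ PMFIntegrable p fun x => F (φ x) := by
  rw [pmfIntegrable_iff, pmfIntegrable_iff, lexp_map]

theorem pmfExpect_map {φ : α → β} {F : β → ℝ} (h : PMFIntegrable (p.map φ) F) :
    pmfExpect (p.map φ) F = pmfExpect p fun x => F (φ x) := by
  -- The change of variables is inherited from `ℝ≥0∞`, hence first for nonnegative functions;
  -- positive and negative parts give the rest.
  have key : ∀ G : β → ℝ, (∀ x, 0 ≤ G x) → PMFIntegrable (p.map φ) G →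
      pmfExpect (p.map φ) G = pmfExpect p fun x => G (φ x) := by
    intro G h0 hG
    have h1 := lexp_ofReal hG h0
    rw [lexp_map, lexp_ofReal (pmfIntegrable_map.1 hG) fun x => h0 _] at h1
    rw [← ENNReal.toReal_ofReal (pmfExpect_nonneg h0), ← h1,
      ENNReal.toReal_ofReal (pmfExpect_nonneg fun x => h0 _)]
  have hp : PMFIntegrable (p.map φ) fun x => max (F x) 0 := by
    rw [pmfIntegrable_iff] at *
    refine ne_top_of_le_ne_top h (lexp_mono _ fun x => ENNReal.ofReal_le_ofReal ?_)
    rw [abs_of_nonneg (le_max_right _ _)]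
    exact max_le (le_abs_self _) (abs_nonneg _)
  have hn : PMFIntegrable (p.map φ) fun x => max (-F x) 0 := by
    rw [pmfIntegrable_iff] at *
    refine ne_top_of_le_ne_top h (lexp_mono _ fun x => ENNReal.ofReal_le_ofReal ?_)
    rw [abs_of_nonneg (le_max_right _ _)]
    exact max_le (neg_le_abs _) (abs_nonneg _)
  have hF : ∀ x, F x = max (F x) 0 - max (-F x) 0 := fun x => by
    rcases le_total 0 (F x) with h | h
    · rw [max_eq_left h, max_eq_right (by linarith)]; ring
    · rw [max_eq_right h, max_eq_left (by linarith)]; ring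
  calc pmfExpect (p.map φ) F = pmfExpect (p.map φ) fun x => max (F x) 0 - max (-F x) 0 :=
        pmfExpect_congr fun x _ => hF x
    _ = pmfExpect p (fun x => max (F (φ x)) 0) - pmfExpect p (fun x => max (-F (φ x)) 0) := by
        rw [pmfExpect_sub hp hn, key _ (fun x => le_max_right _ _) hp,
          key _ (fun x => le_max_right _ _) hn]
    _ = pmfExpect p fun x => max (F (φ x)) 0 - max (-F (φ x)) 0 :=
        (pmfExpect_sub (pmfIntegrable_map.1 hp) (pmfIntegrable_map.1 hn)).symm
    _ = _ := pmfExpect_congr fun x _ => (hF _).symm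

end pmfExpect

/-! ### One slot of the queueing dynamics -/

section dynamics

variable {I J M D : ℕ}

theorem workload_append (L L' : List (JobSize D)) :
    workload (L ++ L') = workload L + workload L' := by
  simp [workload]

theorem workload_cons (x : JobSize D) (L : List (JobSize D)) :
    workload (x :: L) = x.1 + workload L := by
  simp [workload]

theorem length_le_workload (L : List (JobSize D)) : L.length ≤ workload L := by
  induction L with
  | nil => simp
  | cons x L ih => rw [workload_cons, List.length_cons]; have := x.2.1; omega

theorem workload_le_mul_length (L : List (JobSize D)) : workload L ≤ D * L.length := by
  induction L with
  | nil => simp [workload]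
  | cons x L ih =>
    rw [workload_cons, List.length_cons, mul_add, mul_one]; have := x.2.2; omega

theorem ServeJobs.workload_add {n : ℕ} {L L' : List (JobSize D)} (h : ServeJobs n L L') :
    workload L' + n = workload L := by
  induction h with
  | nil => simp [workload]
  | skip x _ ih => simp only [workload_cons]; omega
  | finish x hx _ ih => simp only [workload_cons]; omega
  | work x y hxy _ ih => simp only [workload_cons]; omega

/-- Jobs have size at least one, so the workload bounds the lengths of the lists, whose entries come
from a finite set. This gives the finite sublevel sets that Foster's criterion needs. -/
theorem finite_setOf_workload_le (L : ℕ) :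
    {Y : CloudState J M D | ∑ j, ∑ m, workload (Y j m) ≤ L}.Finite := by
  have hD : Finite (JobSize D) :=
    Set.Finite.to_subtype ((Set.finite_Iic D).subset fun d hd => hd.2)
  have h1 : {l : List (JobSize D) | l.length ≤ L}.Finite := List.finite_length_le _ L
  have h2 : (Set.univ.pi fun _ : Fin J => Set.univ.pi fun _ : Fin M =>
      {l : List (JobSize D) | l.length ≤ L}).Finite :=
    Set.Finite.pi' (fun _ => Set.Finite.pi' fun _ => h1) |>.subset fun Y hY j m =>
      hY j trivial m trivial
  refine h2.subset fun Y hY j _ m _ => ?_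
  calc (Y j m).length ≤ workload (Y j m) := length_le_workload _
    _ ≤ ∑ m, workload (Y j m) :=
        Finset.single_le_sum (f := fun m => workload (Y j m)) (fun _ _ => Nat.zero_le _)
          (Finset.mem_univ m)
    _ ≤ ∑ j, ∑ m, workload (Y j m) :=
        Finset.single_le_sum (f := fun j => ∑ m, workload (Y j m)) (fun _ _ => Nat.zero_le _)
          (Finset.mem_univ j)
    _ ≤ L := hY

/-- Arrivals, routing decisions and schedules of one slot. -/
abbrev SlotInput (J M D : ℕ) : Type :=
  Arrivals J D × (Fin J → Fin M) × (Fin M → Fin J → ℕ)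

/-- Joint law of arrivals, routing and schedules in a slot that starts in state `Y`. -/
noncomputable def slotLaw [NeZero M] {sys : CloudSystem I J M} (P : MaxWeightPolicy sys D)
    (μ : PMF (Arrivals J D)) (Y : CloudState J M D) : PMF (SlotInput J M D) :=
  μ.bind fun A => (jsqRoute Y).bind fun ρ => (P.sched Y).map fun s => (A, ρ, s)

section slotLaw

variable [NeZero M] {sys : CloudSystem I J M} (P : MaxWeightPolicy sys D)
  (μ : PMF (Arrivals J D)) (Y : CloudState J M D)

theorem cloudStep_eq_bind_slotLaw : cloudStep P μ Y =
    (slotLaw P μ Y).bind fun ω => P.serve (afterArrivals Y ω.1 ω.2.1) ω.2.2 := by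
  simp [cloudStep, slotLaw, PMF.bind_bind, PMF.bind_map, Function.comp_def]

theorem slotLaw_map_fst : (slotLaw P μ Y).map Prod.fst = μ := by
  have h : ∀ A : Arrivals J D, (P.sched Y).map (fun _ => A) = PMF.pure A := fun A => PMF.map_const _ A
  simp only [slotLaw, PMF.map_bind, PMF.map_comp, Function.comp_def, PMF.bind_const, h]
  exact PMF.bind_pure μ

theorem mem_support_slotLaw {ω : SlotInput J M D} (h : ω ∈ (slotLaw P μ Y).support) :
    (∀ j m, workload (Y j (ω.2.1 j)) ≤ workload (Y j m)) ∧
      ∀ m, IsMaxWeight sys Y m (ω.2.2 m) := by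
  simp only [slotLaw, PMF.mem_support_bind_iff, PMF.mem_support_map_iff] at h
  obtain ⟨A, -, ρ, hρ, s, hs, rfl⟩ := h
  refine ⟨fun j m => ?_, P.sched_maxWeight Y s hs⟩
  rw [jsqRoute, PMF.mem_support_uniformOfFinset_iff, Fintype.mem_piFinset] at hρ
  have := hρ j
  simp only [shortestQueues, Finset.mem_filter] at this
  exact this.2 m

theorem lexp_slotLaw_fst (F : Arrivals J D → ℝ≥0∞) :
    lexp (slotLaw P μ Y) (fun ω => F ω.1) = lexp μ F := by
  conv_rhs => rw [← slotLaw_map_fst P μ Y]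
  rw [lexp_map]

theorem pmfIntegrable_slotLaw_fst {F : Arrivals J D → ℝ} :
    PMFIntegrable (slotLaw P μ Y) (fun ω => F ω.1) ↔ PMFIntegrable μ F := by
  conv_rhs => rw [← slotLaw_map_fst P μ Y]
  rw [pmfIntegrable_map]

theorem pmfExpect_slotLaw_fst {F : Arrivals J D → ℝ} (hF : PMFIntegrable μ F) :
    pmfExpect (slotLaw P μ Y) (fun ω => F ω.1) = pmfExpect μ F := by
  conv_rhs => rw [← slotLaw_map_fst P μ Y]
  rw [pmfExpect_map]
  rwa [slotLaw_map_fst]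

end slotLaw

/-- Number of type-`j` jobs that server `m` serves. -/
def servedJobs (Y : CloudState J M D) (ω : SlotInput J M D) (j : Fin J) (m : Fin M) : ℕ :=
  min (ω.2.2 m j) (afterArrivals Y ω.1 ω.2.1 j m).length

/-- Unused service. -/
def unusedService (Y : CloudState J M D) (ω : SlotInput J M D) (j : Fin J) (m : Fin M) : ℝ :=
  (ω.2.2 m j : ℝ) - servedJobs Y ω j m

/-- The queue lengths as a vector. -/
noncomputable def queueVec (Y : CloudState J M D) : EuclideanSpace ℝ (Fin J × Fin M) :=
  WithLp.toLp 2 fun p => (workload (Y p.1 p.2) : ℝ)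

/-- Work routed to each queue in the slot. -/
noncomputable def routedWork (ω : SlotInput J M D) (j : Fin J) (m : Fin M) : ℝ :=
  if m = ω.2.1 j then (workload (ω.1 j) : ℝ) else 0

/-- Increment of the vector of queue lengths in the slot. -/
noncomputable def queueIncr (Y : CloudState J M D) (ω : SlotInput J M D) :
    EuclideanSpace ℝ (Fin J × Fin M) :=
  WithLp.toLp 2 fun p => routedWork ω p.1 p.2 - servedJobs Y ω p.1 p.2

theorem queueVec_apply (Y : CloudState J M D) (p : Fin J × Fin M) :
    queueVec Y p = (workload (Y p.1 p.2) : ℝ) := rfl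

theorem queueIncr_apply (Y : CloudState J M D) (ω : SlotInput J M D) (p : Fin J × Fin M) :
    queueIncr Y ω p = routedWork ω p.1 p.2 - servedJobs Y ω p.1 p.2 := rfl

theorem queueIncr_apply' (Y : CloudState J M D) (ω : SlotInput J M D) (p : Fin J × Fin M) :
    queueIncr Y ω p = routedWork ω p.1 p.2 - ω.2.2 p.2 p.1 + unusedService Y ω p.1 p.2 := by
  rw [queueIncr_apply, unusedService]; ring

theorem unusedService_nonneg (Y : CloudState J M D) (ω : SlotInput J M D) (j : Fin J)
    (m : Fin M) : 0 ≤ unusedService Y ω j m := by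
  have : servedJobs Y ω j m ≤ ω.2.2 m j := min_le_left _ _
  rw [unusedService, sub_nonneg]; exact_mod_cast this

theorem unusedService_le (Y : CloudState J M D) (ω : SlotInput J M D) (j : Fin J)
    (m : Fin M) : unusedService Y ω j m ≤ ω.2.2 m j := by
  rw [unusedService]; linarith [(servedJobs Y ω j m).cast_nonneg (α := ℝ)]

theorem workload_afterArrivals (Y : CloudState J M D) (ω : SlotInput J M D) (j : Fin J)
    (m : Fin M) : (workload (afterArrivals Y ω.1 ω.2.1 j m) : ℝ) =
      workload (Y j m) + routedWork ω j m := by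
  simp only [afterArrivals, routedWork]
  split_ifs
  · rw [workload_append]; push_cast; rfl
  · simp

theorem routedWork_nonneg (ω : SlotInput J M D) (j : Fin J) (m : Fin M) :
    0 ≤ routedWork ω j m := by
  rw [routedWork]; split_ifs <;> positivity

theorem sum_routedWork_mul (ω : SlotInput J M D) (j : Fin J) (f : Fin M → ℝ) :
    ∑ m, f m * routedWork ω j m = f (ω.2.1 j) * workload (ω.1 j) := by
  simp [routedWork]

/-- Service is wasted only on short queues. -/
theorem queue_mul_unusedService_le (Y : CloudState J M D) (ω : SlotInput J M D) (j : Fin J)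
    (m : Fin M) : (workload (Y j m) : ℝ) * unusedService Y ω j m ≤
      D * ω.2.2 m j * unusedService Y ω j m := by
  by_cases h : unusedService Y ω j m = 0
  · simp [h]
  · refine mul_le_mul_of_nonneg_right ?_ (unusedService_nonneg _ _ _ _)
    -- Service is left over only if every job of the queue is served; then the queue has at most as
    -- many jobs as the schedule provides for, each of size at most `D`.
    have h1 : (afterArrivals Y ω.1 ω.2.1 j m).length ≤ ω.2.2 m j := by
      by_contra hc
      refine h ?_
      rw [unusedService, servedJobs, min_eq_left (not_le.1 hc).le, sub_self]
    have h2 : workload (afterArrivals Y ω.1 ω.2.1 j m) ≤ D * ω.2.2 m j :=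
      (workload_le_mul_length _).trans (Nat.mul_le_mul_left _ h1)
    have h3 : (workload (afterArrivals Y ω.1 ω.2.1 j m) : ℝ) ≤ D * ω.2.2 m j := by
      exact_mod_cast h2
    rw [workload_afterArrivals] at h3
    linarith [routedWork_nonneg ω j m]

/-- Serving `n` jobs removes exactly `n` units of work, whichever jobs are chosen
(`ServeJobs.workload_add`). The rule `P.serve` thus has no influence on functions of the queue
lengths, and `slotLaw` suffices from here on. -/
theorem lexp_cloudStep_queueVec [NeZero M] {sys : CloudSystem I J M} (P : MaxWeightPolicy sys D)
    (μ : PMF (Arrivals J D)) (Y : CloudState J M D)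
    (F : EuclideanSpace ℝ (Fin J × Fin M) → ℝ≥0∞) :
    lexp (cloudStep P μ Y) (fun Y' => F (queueVec Y')) =
      lexp (slotLaw P μ Y) fun ω => F (queueVec Y + queueIncr Y ω) := by
  rw [cloudStep_eq_bind_slotLaw, lexp_bind]
  congr 1
  funext ω
  rw [← lexp_const (P.serve (afterArrivals Y ω.1 ω.2.1) ω.2.2) (F (queueVec Y + queueIncr Y ω))]
  refine lexp_congr_support _ fun Y' hY' => ?_
  congr 1
  ext p
  have h := (P.serve_spec _ _ Y' hY' p.1 p.2).workload_add
  have h2 := workload_afterArrivals Y ω p.1 p.2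
  rw [← h] at h2
  push_cast at h2
  simp only [PiLp.add_apply, queueVec_apply, queueIncr_apply, servedJobs]
  push_cast
  linarith

end dynamics

/-! ### Geometry of the capacity region -/

section geometry

variable {I J M D K : ℕ}

theorem inner_eq_sum_mul {κ : Type*} [Fintype κ] (x y : EuclideanSpace ℝ κ) :
    inner ℝ x y = ∑ i, x i * y i := by
  simp [PiLp.inner_apply, mul_comm]

theorem natVec_apply (s : Fin J → ℕ) (j : Fin J) : natVec s j = (s j : ℝ) := rfl

/-! ### Consequences of identical servers. -/

namespace CloudSystem

variable {sys : CloudSystem I J M}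

theorem Identical.maximalHull_eq (h : sys.Identical) (m m' : Fin M) :
    sys.maximalHull m = sys.maximalHull m' := by
  obtain ⟨R, hR⟩ := h
  simp only [maximalHull, maximalConfigs, configs, hR]

theorem maximalHull_nonneg {m : Fin M} {v : EuclideanSpace ℝ (Fin J)} (hv : v ∈ sys.maximalHull m)
    (j : Fin J) : 0 ≤ v j := by
  have hconv : Convex ℝ {x : EuclideanSpace ℝ (Fin J) | 0 ≤ x j} :=
    convex_halfSpace_ge (f := fun x : EuclideanSpace ℝ (Fin J) => x j)
      ⟨fun _ _ => rfl, fun _ _ => rfl⟩ 0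
  refine convexHull_min ?_ hconv hv
  rintro _ ⟨s, -, rfl⟩
  exact Nat.cast_nonneg (α := ℝ) (s j)

theorem Identical.smul_mem_capacityRegion (h : sys.Identical) {m : Fin M}
    {v : EuclideanSpace ℝ (Fin J)} (hv : v ∈ sys.maximalHull m) :
    (M : ℝ) • v ∈ sys.capacityRegion := by
  refine ⟨fun _ => v, fun m' => ⟨maximalHull_nonneg hv, v, ?_, fun _ => le_rfl⟩, ?_⟩
  · rwa [h.maximalHull_eq m' m]
  · rw [Finset.sum_const, Finset.card_univ, Fintype.card_fin, Nat.cast_smul_eq_nsmul]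

/-- All servers share one convex hull, so the average of the dominating points of the servers
belongs to it. -/
theorem Identical.exists_mem_maximalHull [NeZero M] (h : sys.Identical) (m : Fin M)
    {x : EuclideanSpace ℝ (Fin J)} (hx : x ∈ sys.capacityRegion) :
    ∃ y ∈ sys.maximalHull m, ∀ j, x j ≤ M * y j := by
  obtain ⟨f, hf, rfl⟩ := hx
  choose hf0 y hy hfy using hf
  have hM : (0 : ℝ) < M := by exact_mod_cast NeZero.pos M
  refine ⟨∑ m', (M : ℝ)⁻¹ • y m', ?_, fun j => ?_⟩
  · refine Convex.sum_mem (convex_convexHull ℝ _) (fun _ _ => by positivity) ?_ fun m' _ => ?_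
    · simp [hM.ne']
    · exact h.maximalHull_eq m' m ▸ hy m'
  · simp only [WithLp.ofLp_sum, Finset.sum_apply, PiLp.smul_apply, smul_eq_mul, Finset.mul_sum]
    refine Finset.sum_le_sum fun m' _ => ?_
    rw [← mul_assoc, mul_inv_cancel₀ hM.ne', one_mul]
    exact hfy m' j

/-- Links the local maximization at one server to the capacity region of the whole system: `x / M`
is dominated by a competitor in the hull of every server. -/
theorem Identical.weight_le [NeZero M] (h : sys.Identical) {Y : CloudState J M D} {m : Fin M}
    {s : Fin J → ℕ} (hs : IsMaxWeight sys Y m s) {x : EuclideanSpace ℝ (Fin J)}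
    (hx : x ∈ sys.capacityRegion) :
    ∑ j, x j * (workload (Y j m) : ℝ) ≤ M * ∑ j, (s j : ℝ) * (workload (Y j m) : ℝ) := by
  obtain ⟨y, hy, hxy⟩ := h.exists_mem_maximalHull m hx
  calc _ ≤ ∑ j, M * y j * (workload (Y j m) : ℝ) :=
        Finset.sum_le_sum fun j _ => mul_le_mul_of_nonneg_right (hxy j) (Nat.cast_nonneg _)
    _ = M * ∑ j, y j * (workload (Y j m) : ℝ) := by simp only [Finset.mul_sum, mul_assoc]
    _ ≤ _ := mul_le_mul_of_nonneg_left (hs.2.2 y hy) (Nat.cast_nonneg _)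

/-- A nonempty capacity region provides a maximal configuration. A type that needs no resource could
be added to it, so every type needs a positive amount of some resource, whose capacity bounds the
number of jobs. -/
theorem Identical.exists_config_bound [NeZero M] (h : sys.Identical)
    (hne : sys.capacityRegion.Nonempty) :
    ∃ S : ℕ, ∀ m, ∀ s ∈ sys.configs m, ∀ j, s j ≤ S := by
  obtain ⟨x, hx⟩ := hne
  obtain ⟨y, hy, -⟩ := h.exists_mem_maximalHull ⟨0, NeZero.pos M⟩ hx
  obtain ⟨_, ⟨s₀, hs₀, -⟩⟩ := convexHull_nonempty_iff.1 ⟨y, hy⟩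
  obtain ⟨R, hR⟩ := h
  have hreq : ∀ j, ∃ i, sys.req i j ≠ 0 := by
    intro j
    by_contra! hj
    refine hs₀.2 j fun i => ?_
    refine le_trans (le_of_eq ?_) (hs₀.1 i)
    refine Finset.sum_congr rfl fun j' _ => ?_
    by_cases hjj : j' = j
    · subst hjj; simp [hj]
    · simp [hjj]
  choose i hi using hreq
  refine ⟨∑ j, ⌈R (i j) / sys.req (i j) j⌉₊, fun m s hs j => ?_⟩
  refine le_trans ?_ (Finset.single_le_sum (f := fun j => ⌈R (i j) / sys.req (i j) j⌉₊)
    (fun _ _ => Nat.zero_le _) (Finset.mem_univ j))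
  have h1 : (s j : ℝ≥0) * sys.req (i j) j ≤ R (i j) := by
    rw [← hR (i j) m]
    exact (Finset.single_le_sum (f := fun j' => (s j' : ℝ≥0) * sys.req (i j) j')
      (fun _ _ => zero_le) (Finset.mem_univ j)).trans (hs (i j))
  have h2 : (s j : ℝ≥0) ≤ R (i j) / sys.req (i j) j := (le_div_iff₀ (pos_iff_ne_zero.2 (hi j))).2 h1
  exact_mod_cast h2.trans (Nat.le_ceil _)

end CloudSystem

/-- Used to make positivity uniform over finite sets: the entries of `lamk`, the nonzero entries of
`c`, and the distances of the off-face configurations from the face. -/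
theorem exists_pos_gap (T : Set ℝ) (hT : T.Finite) : ∃ η > 0, ∀ x ∈ T, 0 < x → η ≤ x := by
  induction T, hT using Set.Finite.induction_on with
  | empty => exact ⟨1, one_pos, by simp⟩
  | @insert a T _ _ ih =>
    obtain ⟨η, hη, h⟩ := ih
    by_cases ha : 0 < a
    · refine ⟨min η a, lt_min hη ha, fun x hx hx0 => ?_⟩
      rcases hx with rfl | hx
      · exact min_le_right _ _
      · exact (min_le_left _ _).trans (h x hx hx0)
    · refine ⟨η, hη, fun x hx hx0 => ?_⟩
      rcases hx with rfl | hx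
      · exact absurd hx0 ha
      · exact h x hx hx0

/-! ### Facets of the capacity region and their relative interior. -/

section polyhedron

variable {C : Set (EuclideanSpace ℝ (Fin J))} {c : Fin K → EuclideanSpace ℝ (Fin J)}
  {b : Fin K → ℝ}

theorem exists_ball_subset_of_mem_interior {x : EuclideanSpace ℝ (Fin J)} (hx : x ∈ interior C) :
    ∃ δ > 0, ∀ v : EuclideanSpace ℝ (Fin J), ‖v‖ ≤ δ → x + v ∈ C := by
  obtain ⟨δ, hδ, hb⟩ := Metric.isOpen_iff.1 isOpen_interior x hx
  refine ⟨δ / 2, by positivity, fun v hv => interior_subset (hb ?_)⟩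
  rw [Metric.mem_ball, dist_eq_norm, add_sub_cancel_left]
  linarith

theorem IsHyperplaneDescription.convex (h : IsHyperplaneDescription C c b) : Convex ℝ C := by
  rw [h.eq_polyhedron]
  intro x hx y hy s t hs ht hst
  refine ⟨fun j => ?_, fun k hk => ?_⟩
  · simp only [PiLp.add_apply, PiLp.smul_apply, smul_eq_mul]
    exact add_nonneg (mul_nonneg hs (hx.1 j)) (mul_nonneg ht (hy.1 j))
  · rw [inner_add_right, inner_smul_right, inner_smul_right]
    calc s * inner ℝ (c k) x + t * inner ℝ (c k) y ≤ s * b k + t * b k :=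
          add_le_add (mul_le_mul_of_nonneg_left (hx.2 k hk) hs)
            (mul_le_mul_of_nonneg_left (hy.2 k hk) ht)
      _ = b k := by rw [← add_mul, hst, one_mul]

theorem IsHyperplaneDescription.inner_le (h : IsHyperplaneDescription C c b)
    {x : EuclideanSpace ℝ (Fin J)} (hx : x ∈ C) (k : Fin K) : inner ℝ (c k) x ≤ b k := by
  rw [h.eq_polyhedron] at hx; exact hx.2 k trivial

theorem IsHyperplaneDescription.pos_of_mem_interior (h : IsHyperplaneDescription C c b)
    {x : EuclideanSpace ℝ (Fin J)} (hx : x ∈ interior C) (j : Fin J) : 0 < x j := by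
  obtain ⟨δ, hδ, hb⟩ := exists_ball_subset_of_mem_interior hx
  have h1 := hb (-EuclideanSpace.single j δ) (by simp [abs_of_pos hδ])
  rw [h.eq_polyhedron] at h1
  have := h1.1 j
  simp at this
  linarith

theorem IsHyperplaneDescription.inner_lt (h : IsHyperplaneDescription C c b)
    {x : EuclideanSpace ℝ (Fin J)} (hx : x ∈ interior C) (k : Fin K) : inner ℝ (c k) x < b k := by
  obtain ⟨δ, hδ, hb⟩ := exists_ball_subset_of_mem_interior hx
  have h1 := h.inner_le (hb (δ • c k) (by
    rw [norm_smul, h.norm_eq_one k, Real.norm_of_nonneg hδ.le, mul_one])) k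
  rw [inner_add_right, inner_smul_right, real_inner_self_eq_norm_sq, h.norm_eq_one k] at h1
  linarith

theorem hyperplaneDist_eq {c : EuclideanSpace ℝ (Fin J)} (hc : ‖c‖ = 1) {b : ℝ}
    {x : EuclideanSpace ℝ (Fin J)} (hx : inner ℝ c x ≤ b) :
    hyperplaneDist c b x = b - inner ℝ c x := by
  have hcc : inner ℝ c c = (1 : ℝ) := by rw [real_inner_self_eq_norm_sq, hc, one_pow]
  have hmem : x + (b - inner ℝ c x) • c ∈ hyperplane c b := by
    simp only [hyperplane, Set.mem_ofPred_eq, inner_add_right, inner_smul_right, hcc]; ring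
  refine le_antisymm ?_ ?_
  · refine (Metric.infDist_le_dist_of_mem hmem).trans ?_
    rw [dist_eq_norm, sub_add_cancel_left, norm_neg, norm_smul, hc, mul_one,
      Real.norm_of_nonneg (by linarith)]
  · refine (Metric.le_infDist ⟨_, hmem⟩).2 fun y hy => ?_
    have hy' : inner ℝ c y = b := hy
    have := real_inner_le_norm c (y - x)
    rw [inner_sub_right, hy', hc, one_mul] at this
    rwa [dist_comm, dist_eq_norm]

/-- Some point of the face `k` is strictly inside all other constraints. -/
theorem IsHyperplaneDescription.exists_facet_ball (h : IsHyperplaneDescription C c b)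
    {x₀ : EuclideanSpace ℝ (Fin J)} (hx₀ : x₀ ∈ interior C) (k : Fin K) :
    ∃ p ∈ C ∩ hyperplane (c k) (b k), ∃ r > 0, ∀ v : EuclideanSpace ℝ (Fin J), ‖v‖ ≤ r →
      inner ℝ (c k) v = 0 → p + v ∈ C ∩ hyperplane (c k) (b k) := by
  -- Irredundancy gives a point violating the constraint `k` alone. The segment to it from the
  -- interior point `x₀` crosses the hyperplane at the point `p` with parameter `t` below.
  obtain ⟨y, hyT, hyC⟩ : ∃ y ∈ orthantPolyhedron c b {k}ᶜ, y ∉ C := by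
    by_contra! hcon
    refine h.irredundant k (Set.Subset.antisymm hcon ?_)
    rw [h.eq_polyhedron]
    exact fun y hy => ⟨hy.1, fun k' _ => hy.2 k' trivial⟩
  have hyk : b k < inner ℝ (c k) y := by
    by_contra! hcon
    refine hyC ?_
    rw [h.eq_polyhedron]
    refine ⟨hyT.1, fun k' _ => ?_⟩
    by_cases hk : k' = k
    · rw [hk]; exact hcon
    · exact hyT.2 k' hk
  have hxk := h.inner_lt hx₀ k
  set t : ℝ := (b k - inner ℝ (c k) x₀) / (inner ℝ (c k) y - inner ℝ (c k) x₀) with ht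
  have hden : 0 < inner ℝ (c k) y - inner ℝ (c k) x₀ := by linarith
  have ht0 : 0 < t := div_pos (by linarith) hden
  have ht1 : t < 1 := (div_lt_one hden).2 (by linarith)
  have htk : t * (inner ℝ (c k) y - inner ℝ (c k) x₀) = b k - inner ℝ (c k) x₀ :=
    div_mul_cancel₀ _ hden.ne'
  set p : EuclideanSpace ℝ (Fin J) := (1 - t) • x₀ + t • y with hp
  have hpk : inner ℝ (c k) p = b k := by
    rw [hp, inner_add_right, inner_smul_right, inner_smul_right]; linarith
  obtain ⟨δ, hδ, hb⟩ := exists_ball_subset_of_mem_interior hx₀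
  -- Contracting the ball around `x₀` towards `y` gives radius `(1 - t) * δ` at `p`. The other
  -- constraints hold at both ends of each segment, and constraint `k` is an equality for tangential
  -- `v`.
  have hball : ∀ v : EuclideanSpace ℝ (Fin J), ‖v‖ ≤ (1 - t) * δ →
      inner ℝ (c k) v = 0 → p + v ∈ C ∩ hyperplane (c k) (b k) := by
    intro v hv hvk
    have hin : x₀ + (1 - t)⁻¹ • v ∈ C := hb _ (by
      rw [norm_smul, Real.norm_of_nonneg (inv_nonneg.2 (by linarith)), inv_mul_le_iff₀ (by linarith)]
      exact hv)
    have hpv : p + v = (1 - t) • (x₀ + (1 - t)⁻¹ • v) + t • y := by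
      rw [smul_add, smul_smul, mul_inv_cancel₀ (by linarith), one_smul, hp]; abel
    have hpvk : inner ℝ (c k) (p + v) = b k := by rw [inner_add_right, hpk, hvk, add_zero]
    refine ⟨?_, hpvk⟩
    rw [h.eq_polyhedron] at hin ⊢
    refine ⟨fun j => ?_, fun k' _ => ?_⟩
    · rw [hpv, PiLp.add_apply, PiLp.smul_apply, PiLp.smul_apply]
      exact add_nonneg (mul_nonneg (by linarith) (hin.1 j)) (mul_nonneg ht0.le (hyT.1 j))
    · by_cases hk : k' = k
      · rw [hk, hpvk]
      · rw [hpv, inner_add_right, inner_smul_right (c k') y, inner_smul_right]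
        have h1 := mul_le_mul_of_nonneg_left (hin.2 k' trivial) (by linarith : 0 ≤ 1 - t)
        have h2 := mul_le_mul_of_nonneg_left (hyT.2 k' hk) ht0.le
        linarith
  refine ⟨p, ?_, (1 - t) * δ, mul_pos (by linarith) hδ, hball⟩
  have := hball 0 (by rw [norm_zero]; exact (mul_pos (by linarith) hδ).le) (inner_zero_right _)
  rwa [add_zero] at this

/-- A relatively interior point of a facet has a neighbourhood, within the hyperplane, that
belongs to the region. -/
theorem IsHyperplaneDescription.exists_ball_of_mem_intrinsicInterior
    (h : IsHyperplaneDescription C c b) {x₀ : EuclideanSpace ℝ (Fin J)} (hx₀ : x₀ ∈ interior C)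
    {k : Fin K} {z : EuclideanSpace ℝ (Fin J)}
    (hz : z ∈ intrinsicInterior ℝ (C ∩ hyperplane (c k) (b k))) :
    ∃ r > 0, ∀ v : EuclideanSpace ℝ (Fin J), ‖v‖ ≤ r → inner ℝ (c k) v = 0 → z + v ∈ C := by
  -- The intrinsic interior is relative to the affine span of the face, which could a priori be
  -- smaller than the hyperplane. The ball around `p` excludes this.
  obtain ⟨p, hp, r, hr, hball⟩ := h.exists_facet_ball hx₀ k
  set F := C ∩ hyperplane (c k) (b k) with hF
  obtain ⟨z', hz', rfl⟩ := hz
  have hpA : p ∈ affineSpan ℝ F := subset_affineSpan ℝ F hp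
  let φ : ℝ → affineSpan ℝ F := fun t =>
    ⟨AffineMap.lineMap (z' : EuclideanSpace ℝ (Fin J)) p t, AffineMap.lineMap_mem t z'.2 hpA⟩
  have hφ : Continuous φ := by
    refine Continuous.subtype_mk ?_ _
    exact AffineMap.lineMap_continuous
  have hφ0 : φ 0 = z' := Subtype.ext (by simp [φ])
  have hnhds : ∀ᶠ t in 𝓝 (0 : ℝ), φ t ∈ ((↑) ⁻¹' F : Set (affineSpan ℝ F)) := by
    refine hφ.continuousAt.eventually_mem ?_
    rw [hφ0]
    exact mem_interior_iff_mem_nhds.1 hz'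
  obtain ⟨τ, hτ, hτF⟩ := Metric.eventually_nhds_iff.1 hnhds
  -- Moving from `z'` slightly away from `p` stays in the face, so `z'` lies strictly between a
  -- point of the face and `p`.
  have hy : φ (-(τ / 2)) ∈ ((↑) ⁻¹' F : Set (affineSpan ℝ F)) := hτF (by
    rw [Real.dist_eq, sub_zero, abs_neg, abs_of_pos (by positivity)]; linarith)
  set t := τ / 2 with ht
  have ht0 : 0 < t := by positivity
  have hyC : AffineMap.lineMap (z' : EuclideanSpace ℝ (Fin J)) p (-t) ∈ C := hy.1
  rw [AffineMap.lineMap_apply_module'] at hyC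
  -- With `y = (1 + t) z - t p` one has `z + v = y / (1 + t) + t / (1 + t) * (p + ((1 + t) / t) v)`:
  -- the ball of radius `r` at `p` shrinks by the factor `t / (1 + t)`.
  refine ⟨t / (1 + t) * r, by positivity, fun v hv hvk => ?_⟩
  have h1 : p + ((1 + t) / t) • v ∈ C := (hball _ (by
    rw [norm_smul, Real.norm_of_nonneg (by positivity)]
    calc (1 + t) / t * ‖v‖ ≤ (1 + t) / t * (t / (1 + t) * r) := by gcongr
      _ = r := by field_simp) (by rw [inner_smul_right, hvk, mul_zero])).1
  have hconv : Convex ℝ C := h.convex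
  have h2 := hconv hyC h1 (show 0 ≤ 1 / (1 + t) by positivity)
    (show 0 ≤ t / (1 + t) by positivity) (by field_simp)
  convert h2 using 1
  simp only [smul_add, smul_sub, smul_smul]
  have e1 : t / (1 + t) * ((1 + t) / t) = 1 := by field_simp
  rw [e1]
  match_scalars <;> field_simp <;> ring

end polyhedron

end geometry

/-! ### Drift of the queue lengths orthogonal to the face direction -/

section perp

variable {E : Type*} [NormedAddCommGroup E] [InnerProductSpace ℝ E]

/-- Component of `x` orthogonal to the unit vector `u`. -/
noncomputable def perp (u x : E) : E := x - (inner ℝ u x : ℝ) • u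

theorem inner_perp {u : E} (hu : ‖u‖ = 1) (x : E) : inner ℝ u (perp u x) = (0 : ℝ) := by
  rw [perp, inner_sub_right, inner_smul_right, real_inner_self_eq_norm_sq, hu]; ring

theorem perp_add (u x z : E) : perp u (x + z) = perp u x + perp u z := by
  rw [perp, perp, perp, inner_add_right, add_smul]; abel

theorem inner_perp_right {u : E} (hu : ‖u‖ = 1) (x z : E) :
    inner ℝ (perp u x) (perp u z) = (inner ℝ (perp u x) z : ℝ) := by
  rw [perp.eq_1 u z, inner_sub_right, inner_smul_right, real_inner_comm u, inner_perp hu]; ring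

theorem inner_perp_left (u x z : E) :
    (inner ℝ (perp u x) z : ℝ) = inner ℝ x z - inner ℝ u x * inner ℝ u z := by
  rw [perp, inner_sub_left, inner_smul_left]; simp

theorem norm_perp_sq {u : E} (hu : ‖u‖ = 1) (x : E) :
    ‖perp u x‖ ^ 2 = (inner ℝ (perp u x) x : ℝ) := by
  rw [← inner_perp_right hu, real_inner_self_eq_norm_sq]

theorem norm_perp_le {u : E} (hu : ‖u‖ = 1) (x : E) : ‖perp u x‖ ≤ ‖x‖ := by
  have h := norm_perp_sq hu x
  have h2 := real_inner_le_norm (perp u x) x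
  by_contra! hc
  nlinarith [norm_nonneg x, norm_nonneg (perp u x)]

theorem norm_perp_add_sq_le {u : E} (hu : ‖u‖ = 1) (x z : E) :
    ‖perp u (x + z)‖ ^ 2 ≤ ‖perp u x‖ ^ 2 + 2 * inner ℝ (perp u x) z + ‖z‖ ^ 2 := by
  rw [perp_add, norm_add_sq_real, inner_perp_right hu]
  have := pow_le_pow_left₀ (norm_nonneg _) (norm_perp_le hu z) 2
  linarith

theorem abs_norm_perp_add_sub_le {u : E} (hu : ‖u‖ = 1) (x z : E) :
    |‖perp u (x + z)‖ - ‖perp u x‖| ≤ ‖z‖ := by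
  refine (abs_norm_sub_norm_le _ _).trans ?_
  rw [perp_add, add_sub_cancel_left]
  exact norm_perp_le hu z

end perp

/-! ### Pathwise inequalities for one slot. -/

section collapse

variable {I J M D : ℕ}

/-- The direction of state-space collapse. -/
noncomputable def faceVec (M : ℕ) {J : ℕ} (c : EuclideanSpace ℝ (Fin J)) :
    EuclideanSpace ℝ (Fin J × Fin M) :=
  WithLp.toLp 2 fun p => c p.1 / Real.sqrt M

theorem faceVec_apply (c : EuclideanSpace ℝ (Fin J)) (p : Fin J × Fin M) :
    faceVec M c p = c p.1 / Real.sqrt M := rfl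

theorem norm_faceVec [NeZero M] {c : EuclideanSpace ℝ (Fin J)} (hc : ‖c‖ = 1) :
    ‖faceVec M c‖ = 1 := by
  have hM : (0 : ℝ) < M := by exact_mod_cast NeZero.pos M
  have h1 : ‖faceVec M c‖ ^ 2 = 1 := by
    rw [EuclideanSpace.real_norm_sq_eq, Fintype.sum_prod_type]
    simp only [faceVec_apply, div_pow, Real.sq_sqrt hM.le, Finset.sum_const, Finset.card_univ,
      Fintype.card_fin, nsmul_eq_mul]
    calc _ = ∑ j, c j ^ 2 := Finset.sum_congr rfl fun j _ => by field_simp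
      _ = 1 := by rw [← EuclideanSpace.real_norm_sq_eq, hc, one_pow]
  exact (pow_eq_one_iff_of_nonneg (norm_nonneg _) two_ne_zero).1 h1

theorem weightedQueue_eq_inner (c : EuclideanSpace ℝ (Fin J)) (Y : CloudState J M D) :
    weightedQueue c Y = inner ℝ (faceVec M c) (queueVec Y) := by
  rw [inner_eq_sum_mul, Fintype.sum_prod_type]; rfl

/-- Length of the shortest queue of type `j`. -/
noncomputable def minQueue [NeZero M] (Y : CloudState J M D) (j : Fin J) : ℝ :=
  Finset.univ.inf' ⟨0, Finset.mem_univ _⟩ fun m : Fin M => (workload (Y j m) : ℝ)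

theorem minQueue_le [NeZero M] (Y : CloudState J M D) (j : Fin J) (m : Fin M) :
    minQueue Y j ≤ workload (Y j m) :=
  Finset.inf'_le _ (Finset.mem_univ m)

theorem minQueue_eq [NeZero M] {Y : CloudState J M D} {j : Fin J} {m : Fin M}
    (h : ∀ m', workload (Y j m) ≤ workload (Y j m')) : (workload (Y j m) : ℝ) = minQueue Y j :=
  le_antisymm ((Finset.le_inf'_iff _ _).2 fun m' _ => by exact_mod_cast h m') (minQueue_le _ _ _)

/-- Weighted amount of arriving work. -/
noncomputable def weightedArrival (M : ℕ) (c : EuclideanSpace ℝ (Fin J)) (A : Arrivals J D) : ℝ :=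
  ∑ j, c j / Real.sqrt M * (workload (A j) : ℝ)

/-- Total offered service. -/
noncomputable def offeredWeight (Y : CloudState J M D) (ω : SlotInput J M D) : ℝ :=
  ∑ j, ∑ m, (workload (Y j m) : ℝ) * ω.2.2 m j

/-- The data of a face of the capacity region used in the drift estimates: a bound `S` for the
configurations, the radius `r` of a ball around `lamk` in the hyperplane that belongs to the
region, the gap `η` between the face and the configurations off it, a lower bound `ℓ` of the
entries of `lamk` and a lower bound `κ` of the nonzero entries of `c`. -/
structure FaceData (D : ℕ) (sys : CloudSystem I J M) (c lamk : EuclideanSpace ℝ (Fin J))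
    (b S r η ℓ κ : ℝ) : Prop where
  norm_normal : ‖c‖ = 1
  normal_nonneg : ∀ j, 0 ≤ c j
  normal_gap : ∀ j, c j = 0 ∨ κ ≤ c j
  offset_nonneg : 0 ≤ b
  inner_point : inner ℝ c lamk = b
  le_point : ∀ j, ℓ ≤ lamk j
  bound_nonneg : 0 ≤ S
  radius_pos : 0 < r
  gap_pos : 0 < η
  point_pos : 0 < ℓ
  normal_gap_pos : 0 < κ
  config_le : ∀ (Y : CloudState J M D) m s, IsMaxWeight sys Y m s → ∀ j, (s j : ℝ) ≤ S
  inner_le : ∀ (Y : CloudState J M D) m s, IsMaxWeight sys Y m s → inner ℝ c (natVec s) ≤ b / M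
  gap : ∀ (Y : CloudState J M D) m s, IsMaxWeight sys Y m s →
    inner ℝ c (natVec s) = b / M ∨ inner ℝ c (natVec s) ≤ b / M - η
  weight_le : ∀ (Y : CloudState J M D) m s, IsMaxWeight sys Y m s →
    ∀ v : EuclideanSpace ℝ (Fin J), ‖v‖ ≤ r → inner ℝ c v = 0 →
      ∑ j, (lamk j + v j) * (workload (Y j m) : ℝ) ≤ M * ∑ j, (s j : ℝ) * (workload (Y j m) : ℝ)

/-- Work that is offered in excess of the arrivals, relative to the face: unused service plus the
distance of the schedules to the face. -/
noncomputable def slack (c : EuclideanSpace ℝ (Fin J)) (b : ℝ) (Y : CloudState J M D)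
    (ω : SlotInput J M D) : ℝ :=
  inner ℝ (faceVec M c) (queueIncr Y ω) - weightedArrival M c ω.1 + b / Real.sqrt M

/-- The definition of `slack` encodes the one-step identity for the weighted queue length; this form
makes its sign and its causes visible: schedules off the face, and unused service. -/
theorem slack_eq [NeZero M] (c : EuclideanSpace ℝ (Fin J)) (b : ℝ) (Y : CloudState J M D)
    (ω : SlotInput J M D) : slack c b Y ω =
      ∑ m, (b / M - inner ℝ c (natVec (ω.2.2 m))) / Real.sqrt M +
        ∑ j, ∑ m, c j / Real.sqrt M * unusedService Y ω j m := by
  have hM : (0 : ℝ) < M := by exact_mod_cast NeZero.pos M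
  have h1 : inner ℝ (faceVec M c) (queueIncr Y ω) =
      weightedArrival M c ω.1 - ∑ j, ∑ m, c j / Real.sqrt M * ω.2.2 m j +
        ∑ j, ∑ m, c j / Real.sqrt M * unusedService Y ω j m := by
    rw [inner_eq_sum_mul, Fintype.sum_prod_type, weightedArrival, ← Finset.sum_sub_distrib,
      ← Finset.sum_add_distrib]
    refine Finset.sum_congr rfl fun j _ => ?_
    rw [← sum_routedWork_mul ω j fun _ => c j / Real.sqrt M, ← Finset.sum_sub_distrib,
      ← Finset.sum_add_distrib]
    refine Finset.sum_congr rfl fun m _ => ?_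
    rw [queueIncr_apply', faceVec_apply]; ring
  have h2 : ∑ m : Fin M, (b / M - inner ℝ c (natVec (ω.2.2 m))) / Real.sqrt M =
      b / Real.sqrt M - ∑ j, ∑ m, c j / Real.sqrt M * ω.2.2 m j := by
    rw [Finset.sum_comm]
    simp only [sub_div, Finset.sum_sub_distrib, Finset.sum_const, Finset.card_univ,
      Fintype.card_fin, nsmul_eq_mul]
    congr 1
    · field_simp
    · refine Finset.sum_congr rfl fun m _ => ?_
      rw [inner_eq_sum_mul, Finset.sum_div]
      exact Finset.sum_congr rfl fun j _ => by rw [natVec_apply]; ring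
  rw [slack, h1, h2]; ring

theorem weightedQueue_nonneg {c : EuclideanSpace ℝ (Fin J)} (hc : ∀ j, 0 ≤ c j)
    (Y : CloudState J M D) : 0 ≤ weightedQueue c Y :=
  Finset.sum_nonneg fun j _ => Finset.sum_nonneg fun _ _ =>
    mul_nonneg (div_nonneg (hc j) (Real.sqrt_nonneg _)) (Nat.cast_nonneg _)

theorem weightedQueue_div_sqrt (c : EuclideanSpace ℝ (Fin J)) (Y : CloudState J M D) :
    weightedQueue c Y / Real.sqrt M = ∑ j, c j * ((∑ m, (workload (Y j m) : ℝ)) / M) := by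
  rw [weightedQueue, Finset.sum_div]
  refine Finset.sum_congr rfl fun j _ => ?_
  rw [← Finset.mul_sum, div_mul_eq_mul_div, div_div, Real.mul_self_sqrt (Nat.cast_nonneg _),
    mul_div_assoc]

theorem abs_apply_le_norm {κ : Type*} [Fintype κ] (x : EuclideanSpace ℝ κ) (i : κ) :
    |x i| ≤ ‖x‖ := by
  have := PiLp.norm_apply_le x i
  simpa using this

theorem one_le_sqrt_natCast [NeZero M] : 1 ≤ Real.sqrt M := by
  rw [Real.one_le_sqrt]; exact_mod_cast NeZero.pos M

theorem sqrt_natCast_le [NeZero M] : Real.sqrt M ≤ M := by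
  have h1 : (1 : ℝ) ≤ Real.sqrt M := one_le_sqrt_natCast
  calc Real.sqrt M ≤ Real.sqrt M * Real.sqrt M := le_mul_of_one_le_left (by linarith) h1
    _ = M := Real.mul_self_sqrt (Nat.cast_nonneg _)

/-- This is where JSQ enters. The arrivals meet the shortest queue, whose length does not depend on
how ties are broken, so the routing drops out. -/
theorem inner_queueVec_queueIncr [NeZero M] (Y : CloudState J M D) (ω : SlotInput J M D)
    (hρ : ∀ j m, workload (Y j (ω.2.1 j)) ≤ workload (Y j m)) :
    inner ℝ (queueVec Y) (queueIncr Y ω) = ∑ j, minQueue Y j * workload (ω.1 j) -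
      offeredWeight Y ω + ∑ j, ∑ m, (workload (Y j m) : ℝ) * unusedService Y ω j m := by
  rw [inner_eq_sum_mul, Fintype.sum_prod_type, offeredWeight, ← Finset.sum_sub_distrib,
    ← Finset.sum_add_distrib]
  refine Finset.sum_congr rfl fun j _ => ?_
  rw [← minQueue_eq (hρ j), ← sum_routedWork_mul ω j fun m => (workload (Y j m) : ℝ),
    ← Finset.sum_sub_distrib, ← Finset.sum_add_distrib]
  refine Finset.sum_congr rfl fun m _ => ?_
  rw [queueIncr_apply', queueVec_apply]; ring

theorem sum_queue_mul_unusedService_le {S : ℝ} (Y : CloudState J M D)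
    (ω : SlotInput J M D) (hs : ∀ m j, (ω.2.2 m j : ℝ) ≤ S) :
    ∑ j, ∑ m, (workload (Y j m) : ℝ) * unusedService Y ω j m ≤ J * M * (D * S * S) := by
  calc _ ≤ ∑ _j : Fin J, ∑ _m : Fin M, D * S * S :=
        Finset.sum_le_sum fun j _ => Finset.sum_le_sum fun m _ => by
          have hS : 0 ≤ S := (Nat.cast_nonneg _).trans (hs m j)
          refine (queue_mul_unusedService_le Y ω j m).trans ?_
          have h1 := hs m j
          have h2 := unusedService_le Y ω j m
          exact mul_le_mul (by gcongr) (h2.trans h1) (unusedService_nonneg _ _ _ _)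
            (by positivity)
    _ = _ := by simp; ring

theorem norm_queueIncr_le {S : ℝ} (Y : CloudState J M D) (ω : SlotInput J M D)
    (hs : ∀ m j, (ω.2.2 m j : ℝ) ≤ S) :
    ‖queueIncr Y ω‖ ≤ ∑ j, (workload (ω.1 j) : ℝ) + J * M * S := by
  have h1 : ‖queueIncr Y ω‖ ≤ ∑ p, |queueIncr Y ω p| := by
    have h2 : ‖queueIncr Y ω‖ ^ 2 ≤ (∑ p, |queueIncr Y ω p|) ^ 2 := by
      rw [EuclideanSpace.real_norm_sq_eq]
      calc ∑ p, queueIncr Y ω p ^ 2 = ∑ p, |queueIncr Y ω p| ^ 2 := by simp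
        _ ≤ _ := Finset.sum_sq_le_sq_sum_of_nonneg fun p _ => abs_nonneg _
    exact le_of_sq_le_sq h2 (Finset.sum_nonneg fun _ _ => abs_nonneg _)
  refine h1.trans ?_
  rw [Fintype.sum_prod_type]
  have h3 : ∀ j m, |queueIncr Y ω (j, m)| ≤ 1 * routedWork ω j m + S := fun j m => by
    rw [queueIncr_apply]
    have a1 := routedWork_nonneg ω j m
    have a2 : (servedJobs Y ω j m : ℝ) ≤ ω.2.2 m j := by exact_mod_cast min_le_left _ _
    have a3 := hs m j
    have a4 : (0 : ℝ) ≤ servedJobs Y ω j m := Nat.cast_nonneg _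
    rw [abs_le]; dsimp only; constructor <;> linarith
  calc _ ≤ ∑ j, ∑ m, (1 * routedWork ω j m + S) :=
        Finset.sum_le_sum fun j _ => Finset.sum_le_sum fun m _ => h3 j m
    _ = _ := by
        simp only [Finset.sum_add_distrib, sum_routedWork_mul ω _ fun _ => (1 : ℝ)]
        simp; ring

/-- Queue lengths at one server. -/
noncomputable def serverQueues (Y : CloudState J M D) (m : Fin M) :
    EuclideanSpace ℝ (Fin J) :=
  WithLp.toLp 2 fun j => (workload (Y j m) : ℝ)

theorem serverQueues_apply (Y : CloudState J M D) (m : Fin M) (j : Fin J) :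
    serverQueues Y m j = (workload (Y j m) : ℝ) := rfl

namespace FaceData

variable {sys : CloudSystem I J M} {c lamk : EuclideanSpace ℝ (Fin J)} {b S r η ℓ κ : ℝ}

theorem normal_le_one (h : FaceData D sys c lamk b S r η ℓ κ) (j : Fin J) : c j ≤ 1 := by
  have := abs_apply_le_norm c j
  rw [h.norm_normal] at this
  exact (le_abs_self _).trans this

/-- With `n = M` and arrival rate `lamk - ε c`, this is the mean deficit of the weighted arrivals
relative to the largest weighted service `b / √M`. -/
theorem sum_normal_mul_sub (h : FaceData D sys c lamk b S r η ℓ κ) (n : ℕ) (ε : ℝ) :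
    ∑ j, c j / Real.sqrt n * (lamk j - ε * c j) - b / Real.sqrt n = -(ε / Real.sqrt n) := by
  have hcc : ∑ j, c j * c j = 1 := by
    rw [← inner_eq_sum_mul, real_inner_self_eq_norm_sq, h.norm_normal, one_pow]
  have : ∑ j, c j / Real.sqrt n * (lamk j - ε * c j) =
      (∑ j, c j * lamk j - ε * ∑ j, c j * c j) / Real.sqrt n := by
    rw [Finset.mul_sum, ← Finset.sum_sub_distrib, Finset.sum_div]
    exact Finset.sum_congr rfl fun j _ => by ring
  rw [this, hcc, ← inner_eq_sum_mul, h.inner_point]; ring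

variable [NeZero M] (Y : CloudState J M D) (ω : SlotInput J M D)

theorem slack_nonneg (h : FaceData D sys c lamk b S r η ℓ κ)
    (hs : ∀ m, IsMaxWeight sys Y m (ω.2.2 m)) : 0 ≤ slack c b Y ω := by
  rw [slack_eq]
  refine add_nonneg (Finset.sum_nonneg fun m _ => ?_) (Finset.sum_nonneg fun j _ =>
    Finset.sum_nonneg fun m _ => ?_)
  · exact div_nonneg (sub_nonneg.2 (h.inner_le Y m _ (hs m))) (Real.sqrt_nonneg _)
  · exact mul_nonneg (div_nonneg (h.normal_nonneg j) (Real.sqrt_nonneg _))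
      (unusedService_nonneg _ _ _ _)

/-- Boundedness turns squares of the slack into multiples of the slack, whose stationary mean is of
order `ε`. -/
theorem slack_le (h : FaceData D sys c lamk b S r η ℓ κ)
    (hs : ∀ m, IsMaxWeight sys Y m (ω.2.2 m)) : slack c b Y ω ≤ b + J * M * S := by
  have hM : (0 : ℝ) < M := by exact_mod_cast NeZero.pos M
  have h1 : (1 : ℝ) ≤ Real.sqrt M := one_le_sqrt_natCast
  have hS := h.bound_nonneg
  have hb := h.offset_nonneg
  rw [slack_eq]
  refine add_le_add ?_ ?_
  · calc _ ≤ ∑ _m : Fin M, b / M := Finset.sum_le_sum fun m _ => by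
          refine (div_le_div_of_nonneg_right ?_ (Real.sqrt_nonneg _)).trans
            (div_le_self (by positivity) h1)
          have : (0 : ℝ) ≤ inner ℝ c (natVec (ω.2.2 m)) := by
            rw [inner_eq_sum_mul]
            exact Finset.sum_nonneg fun j _ => mul_nonneg (h.normal_nonneg j) (Nat.cast_nonneg _)
          linarith
      _ = b := by simp; field_simp
  · calc _ ≤ ∑ _j : Fin J, ∑ _m : Fin M, 1 * S := Finset.sum_le_sum fun j _ =>
          Finset.sum_le_sum fun m _ => mul_le_mul
            ((div_le_self (h.normal_nonneg j) h1).trans (h.normal_le_one j))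
            ((unusedService_le _ _ _ _).trans (h.config_le Y m _ (hs m) j))
            (unusedService_nonneg _ _ _ _) zero_le_one
      _ = _ := by simp; ring

/-- Slack occurs only if the queues are short or far from the direction of the face. -/
theorem weightedQueue_mul_slack_le (h : FaceData D sys c lamk b S r η ℓ κ)
    (hs : ∀ m, IsMaxWeight sys Y m (ω.2.2 m)) :
    weightedQueue c Y * slack c b Y ω ≤
      ((J * S + ∑ j, lamk j) * M / η + (D * S + 1) * M / κ) *
        (1 + ‖perp (faceVec M c) (queueVec Y)‖) * slack c b Y ω := by
  have hM : (0 : ℝ) < M := by exact_mod_cast NeZero.pos M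
  have hM1 : (1 : ℝ) ≤ M := by exact_mod_cast NeZero.pos M
  have hsq1 : (1 : ℝ) ≤ Real.sqrt M := one_le_sqrt_natCast
  have hsq0 : (0 : ℝ) < Real.sqrt M := by linarith
  have hsqM : Real.sqrt M ≤ M := sqrt_natCast_le
  have hS := h.bound_nonneg
  have hη := h.gap_pos
  have hκ := h.normal_gap_pos
  have hlam : ∀ j, 0 ≤ lamk j := fun j => h.point_pos.le.trans (h.le_point j)
  have hlams : 0 ≤ ∑ j, lamk j := Finset.sum_nonneg fun j _ => hlam j
  set y := weightedQueue c Y with hy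
  set x := perp (faceVec M c) (queueVec Y) with hx
  set w := ‖x‖ with hw
  have hw0 : 0 ≤ w := norm_nonneg _
  have hxjm : ∀ j m, (workload (Y j m) : ℝ) = y * (c j / Real.sqrt M) + x (j, m) := by
    intro j m
    rw [hx, perp, ← weightedQueue_eq_inner, PiLp.sub_apply, PiLp.smul_apply, smul_eq_mul,
      faceVec_apply, queueVec_apply, ← hy]
    ring
  have hxle : ∀ j m, |x (j, m)| ≤ w := fun j m => abs_apply_le_norm x (j, m)
  set L := J * S + ∑ j, lamk j with hL
  have hL0 : 0 ≤ L := by positivity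
  set C := L * M / η + (D * S + 1) * M / κ with hC
  have hC1 : L * M / η ≤ C := le_add_of_nonneg_right (by positivity)
  have hC2 : (D * S + 1) * M / κ ≤ C := le_add_of_nonneg_left (by positivity)
  -- The MaxWeight schedule is compared with `lamk`, which lies on the face. Along `u` it loses `y *
  -- d / √M`, and this loss can only be made up by the orthogonal part `x`, so it is at most `L *
  -- w`.
  have key1 : ∀ m, y * ((b / M - inner ℝ c (natVec (ω.2.2 m))) / Real.sqrt M) ≤
      C * (1 + w) * ((b / M - inner ℝ c (natVec (ω.2.2 m))) / Real.sqrt M) := by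
    intro m
    set d := b / M - inner ℝ c (natVec (ω.2.2 m)) with hd
    rcases h.gap Y m _ (hs m) with h0 | h0
    · have : d = 0 := by rw [hd, h0, sub_self]
      simp [this]
    · have hdη : η ≤ d := by rw [hd]; linarith
      have h1 := h.weight_le Y m _ (hs m) 0 (by rw [norm_zero]; exact h.radius_pos.le)
        (inner_zero_right _)
      simp only [PiLp.zero_apply, add_zero] at h1
      have h2 : ∑ j, lamk j * (workload (Y j m) : ℝ) =
          y / Real.sqrt M * b + ∑ j, lamk j * x (j, m) := by
        rw [← h.inner_point, inner_eq_sum_mul, Finset.mul_sum, ← Finset.sum_add_distrib]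
        exact Finset.sum_congr rfl fun j _ => by rw [hxjm]; ring
      have h3 : ∑ j, (ω.2.2 m j : ℝ) * (workload (Y j m) : ℝ) =
          y / Real.sqrt M * inner ℝ c (natVec (ω.2.2 m)) + ∑ j, (ω.2.2 m j : ℝ) * x (j, m) := by
        rw [inner_eq_sum_mul, Finset.mul_sum, ← Finset.sum_add_distrib]
        exact Finset.sum_congr rfl fun j _ => by rw [hxjm, natVec_apply]; ring
      have h4 : -(∑ j, lamk j * w) ≤ ∑ j, lamk j * x (j, m) := by
        rw [← Finset.sum_neg_distrib]
        refine Finset.sum_le_sum fun j _ => ?_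
        rw [← mul_neg]
        exact mul_le_mul_of_nonneg_left (abs_le.1 (hxle j m)).1 (hlam j)
      have h5 : ∑ j, (ω.2.2 m j : ℝ) * x (j, m) ≤ J * S * w := by
        calc _ ≤ ∑ _j : Fin J, S * w := Finset.sum_le_sum fun j _ =>
              (mul_le_mul_of_nonneg_left (abs_le.1 (hxle j m)).2 (Nat.cast_nonneg _)).trans
                (mul_le_mul_of_nonneg_right (h.config_le Y m _ (hs m) j) hw0)
          _ = _ := by simp; ring
      rw [h2, h3] at h1
      rw [← Finset.sum_mul] at h4
      have h6 : M * (y / Real.sqrt M * d) ≤ M * (L * w) := by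
        have e1 : M * (y / Real.sqrt M * d) =
            y / Real.sqrt M * b - M * (y / Real.sqrt M * inner ℝ c (natVec (ω.2.2 m))) := by
          rw [hd]; field_simp
        have e2 : (∑ j, lamk j) * w ≤ M * ((∑ j, lamk j) * w) :=
          le_mul_of_one_le_left (by positivity) hM1
        have e3 : M * (∑ j, (ω.2.2 m j : ℝ) * x (j, m)) ≤ M * (J * S * w) :=
          mul_le_mul_of_nonneg_left h5 hM.le
        have e4 : M * (L * w) = M * ((∑ j, lamk j) * w) + M * (J * S * w) := by rw [hL]; ring
        linarith
      have h7 := le_of_mul_le_mul_left h6 hM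
      -- A positive `d` is at least `η`, so a factor proportional to `d` can be inserted at the cost
      -- of a constant; this is what the finite number of configurations is good for.
      have h8 : L * w ≤ L * M / η * w * (d / Real.sqrt M) := by
        have : 1 ≤ M / Real.sqrt M * (d / η) := by
          have a1 : 1 ≤ M / Real.sqrt M := (one_le_div hsq0).2 hsqM
          have a2 : 1 ≤ d / η := (one_le_div hη).2 hdη
          nlinarith
        calc L * w ≤ L * w * (M / Real.sqrt M * (d / η)) :=
              le_mul_of_one_le_right (by positivity) this
          _ = _ := by ring
      have hd0 : 0 ≤ d / Real.sqrt M := div_nonneg (by linarith) hsq0.le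
      calc y * (d / Real.sqrt M) = y / Real.sqrt M * d := by ring
        _ ≤ L * M / η * w * (d / Real.sqrt M) := h7.trans h8
        _ ≤ C * (1 + w) * (d / Real.sqrt M) := by gcongr; linarith
  -- Where service is unused the queue is at most `D * S`, so `y * c j / √M` is at most `D * S + w`.
  -- The bound `κ ≤ c j` restores the factor `c j / √M` carried by the unused service in the slack.
  have key2 : ∀ j m, y * (c j / Real.sqrt M * unusedService Y ω j m) ≤
      C * (1 + w) * (c j / Real.sqrt M * unusedService Y ω j m) := by
    intro j m
    rcases h.normal_gap j with h0 | h0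
    · simp [h0]
    · have hu := unusedService_nonneg Y ω j m
      set u := unusedService Y ω j m with hu_def
      have h1 := queue_mul_unusedService_le Y ω j m
      rw [← hu_def, hxjm] at h1
      have h2 : (D : ℝ) * ω.2.2 m j * u ≤ D * S * u := by
        have := h.config_le Y m _ (hs m) j
        gcongr
      have h3 : -(w * u) ≤ x (j, m) * u := by
        rw [← neg_mul]; exact mul_le_mul_of_nonneg_right (abs_le.1 (hxle j m)).1 hu
      have hcj : 0 ≤ c j := h.normal_nonneg j
      have h4 : u ≤ M / κ * (c j / Real.sqrt M * u) := by
        have : 1 ≤ M / Real.sqrt M * (c j / κ) := by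
          have a1 : 1 ≤ M / Real.sqrt M := (one_le_div hsq0).2 hsqM
          have a2 : 1 ≤ c j / κ := (one_le_div hκ).2 h0
          nlinarith
        calc u ≤ (M / Real.sqrt M * (c j / κ)) * u := le_mul_of_one_le_left hu this
          _ = _ := by ring
      have hcu : 0 ≤ c j / Real.sqrt M * u := by positivity
      calc y * (c j / Real.sqrt M * u) ≤ (D * S + w) * u := by linarith
        _ ≤ ((D * S + 1) * (1 + w)) * u := by
            refine mul_le_mul_of_nonneg_right ?_ hu
            have : 0 ≤ D * S * w := by positivity
            linarith
        _ ≤ ((D * S + 1) * (1 + w)) * (M / κ * (c j / Real.sqrt M * u)) := by gcongr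
        _ = (D * S + 1) * M / κ * (1 + w) * (c j / Real.sqrt M * u) := by ring
        _ ≤ _ := by gcongr
  rw [slack_eq, mul_add, mul_add]
  simp only [Finset.mul_sum]
  refine add_le_add (Finset.sum_le_sum fun m _ => key1 m) ?_
  exact Finset.sum_le_sum fun j _ => Finset.sum_le_sum fun m _ => key2 j m

/-- Pathwise bound for the drift orthogonal to the direction of the face. -/
theorem inner_perp_queueIncr_le (h : FaceData D sys c lamk b S r η ℓ κ)
    (hρ : ∀ j m, workload (Y j (ω.2.1 j)) ≤ workload (Y j m))
    (hs : ∀ m, IsMaxWeight sys Y m (ω.2.2 m)) :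
    inner ℝ (perp (faceVec M c) (queueVec Y)) (queueIncr Y ω) ≤
      ∑ j, minQueue Y j * workload (ω.1 j) - offeredWeight Y ω + J * M * (D * S * S) -
        weightedQueue c Y * (weightedArrival M c ω.1 - b / Real.sqrt M) := by
  rw [inner_perp_left, inner_queueVec_queueIncr Y ω hρ, ← weightedQueue_eq_inner]
  have h1 := sum_queue_mul_unusedService_le Y ω fun m j => h.config_le Y m _ (hs m) j
  -- The slack enters the increment along `u` with a favourable sign, so the term `-y * slack` may
  -- be dropped.
  have h2 := mul_nonneg (weightedQueue_nonneg h.normal_nonneg Y) (slack_nonneg Y ω h hs)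
  rw [slack] at h2
  linarith

/-- Contribution of type `j` to the imbalance between the servers. -/
noncomputable def _root_.imbalance (Y : CloudState J M D) (j : Fin J) : ℝ :=
  (∑ m, (workload (Y j m) : ℝ)) / M - minQueue Y j

theorem _root_.imbalance_nonneg (j : Fin J) : 0 ≤ imbalance Y j := by
  have hM : (0 : ℝ) < M := by exact_mod_cast NeZero.pos M
  rw [imbalance, sub_nonneg, le_div_iff₀ hM]
  calc _ = ∑ _m : Fin M, minQueue Y j := by simp [mul_comm]
    _ ≤ _ := Finset.sum_le_sum fun m _ => minQueue_le Y j m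

/-- The queues can deviate from `u` in two ways: within a server from the direction `c`, and between
servers from their average. The block of server `m` is the sum of these two deviations. -/
theorem norm_perp_le_sum (h : FaceData D sys c lamk b S r η ℓ κ) :
    ‖perp (faceVec M c) (queueVec Y)‖ ≤
      ∑ m, ‖perp c (serverQueues Y m)‖ + 2 * M * ∑ j, imbalance Y j := by
  have hM : (0 : ℝ) < M := by exact_mod_cast NeZero.pos M
  set y := weightedQueue c Y with hy
  set x := perp (faceVec M c) (queueVec Y) with hx
  let col : Fin M → EuclideanSpace ℝ (Fin J) := fun m => WithLp.toLp 2 fun j => x (j, m)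
  have h1 : ‖x‖ ≤ ∑ m, ‖col m‖ := by
    have h2 : ‖x‖ ^ 2 ≤ (∑ m, ‖col m‖) ^ 2 := by
      calc ‖x‖ ^ 2 = ∑ m, ‖col m‖ ^ 2 := by
            simp only [EuclideanSpace.real_norm_sq_eq]
            rw [Fintype.sum_prod_type_right]
        _ ≤ _ := Finset.sum_sq_le_sq_sum_of_nonneg fun p _ => norm_nonneg _
    exact le_of_sq_le_sq h2 (Finset.sum_nonneg fun _ _ => norm_nonneg _)
  have hsq : Real.sqrt M * Real.sqrt M = M := Real.mul_self_sqrt hM.le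
  have hsq0 : 0 < Real.sqrt M := Real.sqrt_pos.2 hM
  have hyavg : y / Real.sqrt M = ∑ j, c j * ((∑ m, (workload (Y j m) : ℝ)) / M) :=
    weightedQueue_div_sqrt c Y
  have hcol : ∀ m, col m = perp c (serverQueues Y m) +
      (∑ j, c j * ((workload (Y j m) : ℝ) - (∑ m, (workload (Y j m) : ℝ)) / M)) • c := by
    intro m
    ext j
    have e : inner ℝ c (serverQueues Y m) = ∑ j, c j * (workload (Y j m) : ℝ) := by
      rw [inner_eq_sum_mul]; rfl
    simp only [mul_sub, Finset.sum_sub_distrib, ← hyavg, ← e]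
    simp only [col, hx, perp, ← weightedQueue_eq_inner, PiLp.add_apply, PiLp.sub_apply,
      PiLp.smul_apply, smul_eq_mul, faceVec_apply, queueVec_apply, serverQueues_apply, ← hy]
    ring
  have h3 : ∀ m, ‖col m‖ ≤ ‖perp c (serverQueues Y m)‖ +
      ∑ j, (((workload (Y j m) : ℝ) - minQueue Y j) + imbalance Y j) := by
    intro m
    rw [hcol m]
    refine (norm_add_le _ _).trans (add_le_add le_rfl ?_)
    rw [norm_smul, h.norm_normal, mul_one, Real.norm_eq_abs]
    refine (Finset.abs_sum_le_sum_abs _ _).trans (Finset.sum_le_sum fun j _ => ?_)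
    rw [abs_mul, abs_of_nonneg (h.normal_nonneg j)]
    refine (mul_le_of_le_one_left (abs_nonneg _) (h.normal_le_one j)).trans ?_
    have a1 := minQueue_le Y j m
    have a2 := imbalance_nonneg Y j
    rw [imbalance] at a2 ⊢
    rw [abs_le]; constructor <;> linarith
  -- Both the excess over the shortest queue and the imbalance itself contribute `M` times the
  -- imbalance.
  have h4 : ∑ m : Fin M, ∑ j, (((workload (Y j m) : ℝ) - minQueue Y j) + imbalance Y j) =
      2 * M * ∑ j, imbalance Y j := by
    rw [Finset.sum_comm, Finset.mul_sum]
    refine Finset.sum_congr rfl fun j _ => ?_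
    rw [Finset.sum_add_distrib, Finset.sum_sub_distrib]
    simp only [Finset.sum_const, Finset.card_univ, Fintype.card_fin, nsmul_eq_mul, imbalance]
    field_simp
    ring
  refine h1.trans ((Finset.sum_le_sum fun m _ => h3 m).trans ?_)
  rw [Finset.sum_add_distrib, h4]

/-- At each server, MaxWeight is compared with the point of the ball around `lamk` that is displaced
by `r` along the component of that server's queues orthogonal to `c`; the displacement gains `r`
times the length of this component. -/
theorem offeredWeight_ge (h : FaceData D sys c lamk b S r η ℓ κ)
    (hs : ∀ m, IsMaxWeight sys Y m (ω.2.2 m)) :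
    ∑ j, lamk j * ((∑ m, (workload (Y j m) : ℝ)) / M) +
      r / M * ∑ m, ‖perp c (serverQueues Y m)‖ ≤ offeredWeight Y ω := by
  have hM : (0 : ℝ) < M := by exact_mod_cast NeZero.pos M
  have h1 : ∀ m, ∑ j, lamk j * (workload (Y j m) : ℝ) + r * ‖perp c (serverQueues Y m)‖ ≤
      M * ∑ j, (ω.2.2 m j : ℝ) * (workload (Y j m) : ℝ) := by
    intro m
    set p := perp c (serverQueues Y m) with hp
    have hr := h.radius_pos
    -- If `p = 0`, the quotient `r / ‖p‖` is `0` and the displacement vanishes.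
    have h2 := h.weight_le Y m _ (hs m) ((r / ‖p‖) • p) (by
      rw [norm_smul, Real.norm_of_nonneg (by positivity)]
      by_cases h0 : ‖p‖ = 0
      · simp [h0, hr.le]
      · exact (div_mul_cancel₀ _ h0).le) (by
      rw [inner_smul_right, hp, inner_perp h.norm_normal, mul_zero])
    have h3 : inner ℝ ((r / ‖p‖) • p) (serverQueues Y m) = r * ‖p‖ := by
      rw [inner_smul_left, hp, ← norm_perp_sq h.norm_normal, ← hp]
      by_cases h0 : ‖p‖ = 0
      · simp [h0]
      · simp; field_simp
    rw [inner_eq_sum_mul] at h3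
    rw [← h3, ← Finset.sum_add_distrib]
    refine le_trans (le_of_eq (Finset.sum_congr rfl fun j _ => ?_)) h2
    rw [serverQueues_apply, add_mul]
  have h5 := Finset.sum_le_sum fun m (_ : m ∈ Finset.univ) => h1 m
  rw [Finset.sum_add_distrib, ← Finset.mul_sum, ← Finset.mul_sum] at h5
  have h6 : offeredWeight Y ω = ∑ m, ∑ j, (ω.2.2 m j : ℝ) * (workload (Y j m) : ℝ) := by
    rw [offeredWeight, Finset.sum_comm]; simp only [mul_comm]
  have h7 : ∑ j, lamk j * ((∑ m, (workload (Y j m) : ℝ)) / M) =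
      (∑ m, ∑ j, lamk j * (workload (Y j m) : ℝ)) / M := by
    rw [Finset.sum_comm, Finset.sum_div]
    exact Finset.sum_congr rfl fun j _ => by rw [← Finset.mul_sum, mul_div_assoc]
  rw [h6, h7, div_mul_eq_mul_div, ← add_div, div_le_iff₀ hM]
  linarith

/-- Rate of the negative drift towards the direction of the face. -/
noncomputable def _root_.collapseRate (M : ℕ) (r ℓ : ℝ) : ℝ := min (r / M) (ℓ / (4 * M))

theorem collapseRate_pos (h : FaceData D sys c lamk b S r η ℓ κ) : 0 < collapseRate M r ℓ := by
  have hM : (0 : ℝ) < M := by exact_mod_cast NeZero.pos M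
  have h1 := h.radius_pos
  have h2 := h.point_pos
  exact lt_min (by positivity) (by positivity)

/-- Mean drift orthogonal to the direction of the face, for arrival rates close to the face. -/
theorem mean_drift_le (h : FaceData D sys c lamk b S r η ℓ κ)
    (hs : ∀ m, IsMaxWeight sys Y m (ω.2.2 m)) {ε : ℝ} (hε0 : 0 ≤ ε) (hε : ε ≤ ℓ / 2) :
    ∑ j, minQueue Y j * (lamk j - ε * c j) - offeredWeight Y ω -
        weightedQueue c Y * (∑ j, c j / Real.sqrt M * (lamk j - ε * c j) - b / Real.sqrt M) ≤
      -(collapseRate M r ℓ * ‖perp (faceVec M c) (queueVec Y)‖) := by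
  have hM : (0 : ℝ) < M := by exact_mod_cast NeZero.pos M
  have hsq : Real.sqrt M * Real.sqrt M = M := Real.mul_self_sqrt hM.le
  have hsq0 : 0 < Real.sqrt M := Real.sqrt_pos.2 hM
  have h1 := h.sum_normal_mul_sub M ε
  have h2 : weightedQueue c Y * (ε / Real.sqrt M) =
      ∑ j, ε * c j * ((∑ m, (workload (Y j m) : ℝ)) / M) := by
    rw [← mul_div_assoc, mul_comm, mul_div_assoc, weightedQueue_div_sqrt, Finset.mul_sum]
    exact Finset.sum_congr rfl fun j _ => by ring
  have h3 := offeredWeight_ge Y ω h hs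
  -- As the arrival rate is `lamk - ε c`, the left side equals minus the sum of rate times
  -- imbalance, and the rates are at least `ℓ / 2`. The middle sum is the part of the drift along
  -- `u` that orthogonal projection takes away.
  have h4 : ∑ j, minQueue Y j * (lamk j - ε * c j) +
      ∑ j, ε * c j * ((∑ m, (workload (Y j m) : ℝ)) / M) -
      ∑ j, lamk j * ((∑ m, (workload (Y j m) : ℝ)) / M) ≤ -(ℓ / 2 * ∑ j, imbalance Y j) := by
    rw [← Finset.sum_add_distrib, ← Finset.sum_sub_distrib, Finset.mul_sum,
      ← Finset.sum_neg_distrib]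
    refine Finset.sum_le_sum fun j _ => ?_
    have a1 : ℓ / 2 ≤ lamk j - ε * c j := by
      have := h.le_point j
      have := mul_le_of_le_one_right hε0 (h.normal_le_one j)
      linarith
    have a2 := mul_le_mul_of_nonneg_right a1 (imbalance_nonneg Y j)
    rw [imbalance] at a2 ⊢
    linarith
  have h5 := norm_perp_le_sum Y h
  have hI : 0 ≤ ∑ j, imbalance Y j := Finset.sum_nonneg fun j _ => imbalance_nonneg Y j
  have hN : 0 ≤ ∑ m, ‖perp c (serverQueues Y m)‖ := Finset.sum_nonneg fun j _ => norm_nonneg _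
  have hγ := collapseRate_pos h
  -- The constant `ℓ / (4 * M)` in `collapseRate` is matched to the factor `2 * M` in
  -- `norm_perp_le_sum`.
  have h6 : collapseRate M r ℓ * ‖perp (faceVec M c) (queueVec Y)‖ ≤
      r / M * ∑ m, ‖perp c (serverQueues Y m)‖ + ℓ / 2 * ∑ j, imbalance Y j := by
    refine (mul_le_mul_of_nonneg_left h5 hγ.le).trans ?_
    rw [mul_add]
    refine add_le_add (mul_le_mul_of_nonneg_right (min_le_left _ _) hN) ?_
    rw [← mul_assoc]
    refine mul_le_mul_of_nonneg_right ?_ hI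
    calc collapseRate M r ℓ * (2 * M) ≤ ℓ / (4 * M) * (2 * M) :=
          mul_le_mul_of_nonneg_right (min_le_right _ _) (by positivity)
      _ = ℓ / 2 := by field_simp; ring
  rw [h1]
  linarith

end FaceData

end collapse

/-! ### Moments of the arrivals -/

section moments

variable {J D : ℕ}

/-- The second moments of the amounts of work arriving in one slot are at most `V`. -/
def SecondMomentLE (μ : PMF (Arrivals J D)) (V : ℝ) : Prop :=
  ∀ j, lexp μ (fun A => ENNReal.ofReal ((workload (A j) : ℝ) ^ 2)) ≤ ENNReal.ofReal V

/-- Bound for the norm of the increments of the queue lengths. -/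
noncomputable def incrBound (z : ℝ) (A : Arrivals J D) : ℝ := ∑ j, (workload (A j) : ℝ) + z

theorem lexp_ite_workload (μ : PMF (Arrivals J D)) (j : Fin J) (L : ℕ) :
    lexp μ (fun A => ENNReal.ofReal (if L < workload (A j) then (workload (A j) : ℝ) ^ 2 else 0)) =
      ∑' A, (if L < workload (A j) then μ A * (workload (A j) : ℝ≥0∞) ^ 2 else 0) := by
  refine tsum_congr fun A => ?_
  dsimp only
  split_ifs
  · rw [ENNReal.ofReal_pow (Nat.cast_nonneg _), ENNReal.ofReal_natCast]
  · simp

theorem UniformlySquareIntegrable.exists_secondMomentLE {ι : Type*} {μ : ι → PMF (Arrivals J D)}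
    (h : UniformlySquareIntegrable μ) : ∃ V ≥ 0, ∀ i, SecondMomentLE (μ i) V := by
  obtain ⟨L, hL⟩ := h 1 one_ne_zero
  refine ⟨(L : ℝ) ^ 2 + 1, by positivity, fun i j => ?_⟩
  have h1 : ∀ A : Arrivals J D, ENNReal.ofReal ((workload (A j) : ℝ) ^ 2) ≤
      ENNReal.ofReal ((L : ℝ) ^ 2) +
        ENNReal.ofReal (if L < workload (A j) then (workload (A j) : ℝ) ^ 2 else 0) := by
    intro A
    split_ifs with hA
    · exact le_add_self
    · refine le_add_right (ENNReal.ofReal_le_ofReal ?_)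
      have : (workload (A j) : ℝ) ≤ L := by exact_mod_cast not_lt.1 hA
      gcongr
  refine (lexp_mono _ h1).trans ?_
  rw [lexp_add, lexp_const, lexp_ite_workload, ENNReal.ofReal_add (by positivity) zero_le_one,
    ENNReal.ofReal_one]
  gcongr
  exact hL i j

theorem UniformlySquareIntegrable.exists_tail_le {ι : Type*} {μ : ι → PMF (Arrivals J D)}
    (h : UniformlySquareIntegrable μ) {z : ℝ} (hz : 0 ≤ z) {δ : ℝ} (hδ : 0 < δ) :
    ∃ K₀ : ℝ, ∀ K ≥ K₀, ∀ i, lexp (μ i) (fun A =>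
      ENNReal.ofReal (if K < incrBound z A then incrBound z A ^ 2 else 0)) ≤ ENNReal.ofReal δ := by
  -- The sum over `J` types costs `4 * J ^ 2 * J`; the summand `1` avoids division by zero for `J =
  -- 0`.
  set δ' : ℝ := δ / (4 * (J : ℝ) ^ 2 * J + 1) with hδ'
  have hδ'0 : 0 < δ' := by positivity
  obtain ⟨L, hL⟩ := h (ENNReal.ofReal δ') (ENNReal.ofReal_pos.2 hδ'0).ne'
  refine ⟨2 * z + 2 * J * L, fun K hK i => ?_⟩
  have h1 : ∀ A : Arrivals J D,
      ENNReal.ofReal (if K < incrBound z A then incrBound z A ^ 2 else 0) ≤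
      ENNReal.ofReal (4 * (J : ℝ) ^ 2) * ∑ j, ENNReal.ofReal
        (if L < workload (A j) then (workload (A j) : ℝ) ^ 2 else 0) := by
    intro A
    rw [← ENNReal.ofReal_sum_of_nonneg fun j _ => by split_ifs <;> positivity,
      ← ENNReal.ofReal_mul (by positivity)]
    refine ENNReal.ofReal_le_ofReal ?_
    have hnn : 0 ≤ ∑ j, (if L < workload (A j) then (workload (A j) : ℝ) ^ 2 else 0) :=
      Finset.sum_nonneg fun j _ => by split_ifs <;> positivity
    split_ifs with hA
    · rw [incrBound] at hA ⊢
      have hJL : (0 : ℝ) ≤ J * L := by positivity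
      have h2 : J * L < ∑ j, (workload (A j) : ℝ) := by linarith
      have hne : (Finset.univ : Finset (Fin J)).Nonempty := by
        by_contra hne
        rw [Finset.not_nonempty_iff_eq_empty] at hne
        rw [hne, Finset.sum_empty] at h2
        linarith
      -- Beyond the threshold `2 * z + 2 * J * L` the largest of the `J` amounts exceeds `L`, and
      -- the whole bound is at most `2 * J` times that amount.
      obtain ⟨j₀, -, hj₀⟩ := Finset.exists_max_image Finset.univ
        (fun j => (workload (A j) : ℝ)) hne
      have h3 : ∑ j, (workload (A j) : ℝ) ≤ J * workload (A j₀) := by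
        calc _ ≤ ∑ _j : Fin J, (workload (A j₀) : ℝ) :=
              Finset.sum_le_sum fun j _ => hj₀ j (Finset.mem_univ _)
          _ = _ := by simp
      have hJ : (0 : ℝ) < J := by
        have := hne.card_pos
        rw [Finset.card_univ, Fintype.card_fin] at this
        exact_mod_cast this
      have h4 : L < workload (A j₀) := by
        have : (L : ℝ) < workload (A j₀) := lt_of_mul_lt_mul_left (h2.trans_le h3) hJ.le
        exact_mod_cast this
      have h5 : (workload (A j₀) : ℝ) ^ 2 ≤
          ∑ j, (if L < workload (A j) then (workload (A j) : ℝ) ^ 2 else 0) := by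
        have := Finset.single_le_sum
          (f := fun j => if L < workload (A j) then (workload (A j) : ℝ) ^ 2 else 0)
          (fun j _ => by split_ifs <;> positivity) (Finset.mem_univ j₀)
        simpa only [h4, if_true] using this
      have h6 : ∑ j, (workload (A j) : ℝ) + z ≤ 2 * (J * workload (A j₀)) := by linarith
      calc _ ≤ (2 * (J * (workload (A j₀) : ℝ))) ^ 2 :=
            pow_le_pow_left₀ (add_nonneg (Finset.sum_nonneg fun j _ => Nat.cast_nonneg _) hz) h6 2
        _ = 4 * (J : ℝ) ^ 2 * (workload (A j₀) : ℝ) ^ 2 := by ring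
        _ ≤ _ := mul_le_mul_of_nonneg_left h5 (by positivity)
    · exact mul_nonneg (by positivity) hnn
  refine (lexp_mono _ h1).trans ?_
  rw [lexp_const_mul]
  have h7 : lexp (μ i) (fun A => ∑ j, ENNReal.ofReal
      (if L < workload (A j) then (workload (A j) : ℝ) ^ 2 else 0)) =
      ∑ j, lexp (μ i) fun A => ENNReal.ofReal
        (if L < workload (A j) then (workload (A j) : ℝ) ^ 2 else 0) := by
    simp only [lexp, Finset.mul_sum]
    exact Summable.tsum_finsetSum fun _ _ => ENNReal.summable
  rw [h7]
  calc _ ≤ ENNReal.ofReal (4 * (J : ℝ) ^ 2) * ∑ _j : Fin J, ENNReal.ofReal δ' := by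
        gcongr with j
        rw [lexp_ite_workload]; exact hL i j
    _ = ENNReal.ofReal (4 * (J : ℝ) ^ 2 * (J * δ')) := by
        rw [ENNReal.ofReal_mul (p := 4 * (J : ℝ) ^ 2) (by positivity),
          ENNReal.ofReal_mul (p := (J : ℝ)) (Nat.cast_nonneg _)]
        simp
    _ ≤ _ := by
        refine ENNReal.ofReal_le_ofReal ?_
        calc 4 * (J : ℝ) ^ 2 * (J * δ') = (4 * (J : ℝ) ^ 2 * J) * δ' := by ring
          _ ≤ (4 * (J : ℝ) ^ 2 * J + 1) * δ' := by gcongr; linarith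
          _ = δ := by rw [hδ']; field_simp

namespace SecondMomentLE

variable {μ : PMF (Arrivals J D)} {V : ℝ}

theorem integrable_sq (h : SecondMomentLE μ V) (j : Fin J) :
    PMFIntegrable μ fun A => (workload (A j) : ℝ) ^ 2 :=
  pmfIntegrable_of_lexp (fun _ => by positivity) (ne_top_of_le_ne_top ENNReal.ofReal_ne_top (h j))

theorem expect_sq_le (h : SecondMomentLE μ V) (hV : 0 ≤ V) (j : Fin J) :
    pmfExpect μ (fun A => (workload (A j) : ℝ) ^ 2) ≤ V := by
  have h1 := h j
  rw [lexp_ofReal (h.integrable_sq j) fun _ => by positivity] at h1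
  exact (ENNReal.ofReal_le_ofReal_iff hV).1 h1

theorem integrable (h : SecondMomentLE μ V) (j : Fin J) :
    PMFIntegrable μ fun A => (workload (A j) : ℝ) := by
  refine ((h.integrable_sq j).add (pmfIntegrable_const μ 1)).mono fun A _ => ?_
  rw [abs_of_nonneg (Nat.cast_nonneg _)]
  nlinarith [sq_nonneg ((workload (A j) : ℝ) - 1), (workload (A j)).cast_nonneg (α := ℝ)]

theorem integrable_mul_sub (h : SecondMomentLE μ V) (j j' : Fin J) (s t : ℝ) :
    PMFIntegrable μ fun A => ((workload (A j) : ℝ) - s) * ((workload (A j') : ℝ) - t) := by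
  refine (((((h.integrable_sq j).const_mul 2).add ((h.integrable_sq j').const_mul 2)).add
    (pmfIntegrable_const μ (2 * s ^ 2 + 2 * t ^ 2)))).mono fun A _ => ?_
  rw [abs_le]
  constructor <;>
  nlinarith [sq_nonneg ((workload (A j) : ℝ) - s + ((workload (A j') : ℝ) - t)),
    sq_nonneg ((workload (A j) : ℝ) - s - ((workload (A j') : ℝ) - t)),
    sq_nonneg ((workload (A j) : ℝ) + s), sq_nonneg ((workload (A j') : ℝ) + t)]

theorem integrable_incrBound_sq (h : SecondMomentLE μ V) (z : ℝ) :
    PMFIntegrable μ fun A => incrBound z A ^ 2 := by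
  refine (((PMFIntegrable.sum Finset.univ fun j _ => h.integrable_sq j).const_mul (2 * J)).add
    (pmfIntegrable_const μ (2 * z ^ 2))).mono fun A _ => ?_
  rw [abs_of_nonneg (sq_nonneg _), incrBound]
  have := sq_sum_le_card_mul_sum_sq (s := Finset.univ) (f := fun j => (workload (A j) : ℝ))
  rw [Finset.card_univ, Fintype.card_fin] at this
  nlinarith [sq_nonneg (∑ j, (workload (A j) : ℝ) - z)]

theorem expect_incrBound_sq_le (h : SecondMomentLE μ V) (hV : 0 ≤ V) (z : ℝ) :
    pmfExpect μ (fun A => incrBound z A ^ 2) ≤ 2 * J * (J * V) + 2 * z ^ 2 := by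
  have hi := (PMFIntegrable.sum (p := μ) Finset.univ fun j _ => h.integrable_sq j)
  calc _ ≤ pmfExpect μ fun A => 2 * J * (∑ j, (workload (A j) : ℝ) ^ 2) + 2 * z ^ 2 := by
        refine pmfExpect_mono (h.integrable_incrBound_sq z)
          ((hi.const_mul _).add (pmfIntegrable_const μ _)) fun A _ => ?_
        rw [incrBound]
        have := sq_sum_le_card_mul_sum_sq (s := Finset.univ) (f := fun j => (workload (A j) : ℝ))
        rw [Finset.card_univ, Fintype.card_fin] at this
        nlinarith [sq_nonneg (∑ j, (workload (A j) : ℝ) - z)]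
    _ = 2 * J * ∑ j, pmfExpect μ (fun A => (workload (A j) : ℝ) ^ 2) + 2 * z ^ 2 := by
        rw [pmfExpect_add (hi.const_mul _) (pmfIntegrable_const μ _), pmfExpect_const_mul,
          pmfExpect_const, pmfExpect_sum _ fun j _ => h.integrable_sq j]
    _ ≤ _ := by
        gcongr
        calc _ ≤ ∑ _j : Fin J, V := Finset.sum_le_sum fun j _ => h.expect_sq_le hV j
          _ = _ := by simp

theorem arrivalVar_le (h : SecondMomentLE μ V) (hV : 0 ≤ V) (j : Fin J) :
    arrivalVar μ j ≤ V := by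
  have h1 : arrivalVar μ j = pmfExpect μ (fun A => (workload (A j) : ℝ) ^ 2) -
      arrivalRate μ j ^ 2 := by
    have e : arrivalRate μ j = pmfExpect μ fun A => (workload (A j) : ℝ) := rfl
    rw [arrivalVar, arrivalCov]
    have : (fun A : Arrivals J D => ((workload (A j) : ℝ) - arrivalRate μ j) *
        ((workload (A j) : ℝ) - arrivalRate μ j)) = fun A => (workload (A j) : ℝ) ^ 2 -
          2 * arrivalRate μ j * (workload (A j) : ℝ) + arrivalRate μ j ^ 2 := by
      funext A; ring
    rw [this, pmfExpect_add ((h.integrable_sq j).sub ((h.integrable j).const_mul _))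
      (pmfIntegrable_const μ _), pmfExpect_sub (h.integrable_sq j) ((h.integrable j).const_mul _),
      pmfExpect_const_mul, pmfExpect_const, ← e]
    ring
  rw [h1]
  linarith [h.expect_sq_le hV j, sq_nonneg (arrivalRate μ j)]

theorem arrivalVar_nonneg (μ : PMF (Arrivals J D)) (j : Fin J) : 0 ≤ arrivalVar μ j :=
  pmfExpect_nonneg fun _ => mul_self_nonneg _

variable {M : ℕ} (c : EuclideanSpace ℝ (Fin J))

theorem integrable_weightedArrival (h : SecondMomentLE μ V) :
    PMFIntegrable μ fun A => weightedArrival M c A :=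
  PMFIntegrable.sum Finset.univ fun j _ => (h.integrable j).const_mul _

theorem expect_weightedArrival (h : SecondMomentLE μ V) :
    pmfExpect μ (fun A => weightedArrival M c A) = ∑ j, c j / Real.sqrt M * arrivalRate μ j := by
  simp only [weightedArrival]
  rw [pmfExpect_sum _ fun j _ => (h.integrable j).const_mul _]
  exact Finset.sum_congr rfl fun j _ => pmfExpect_const_mul _ _ _

theorem weightedArrival_sub_sq (A : Arrivals J D) (e : ℝ) (l : EuclideanSpace ℝ (Fin J)) :
    (weightedArrival M c A - ∑ j, c j / Real.sqrt M * l j - e) ^ 2 =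
      ∑ j, ∑ j', c j / Real.sqrt M * (c j' / Real.sqrt M) *
        (((workload (A j) : ℝ) - l j) * ((workload (A j') : ℝ) - l j')) +
      (e ^ 2 - 2 * e * (weightedArrival M c A - ∑ j, c j / Real.sqrt M * l j)) := by
  have h1 : weightedArrival M c A - ∑ j, c j / Real.sqrt M * l j =
      ∑ j, c j / Real.sqrt M * ((workload (A j) : ℝ) - l j) := by
    rw [weightedArrival, ← Finset.sum_sub_distrib]
    exact Finset.sum_congr rfl fun j _ => by ring
  have h2 : (∑ j, c j / Real.sqrt M * ((workload (A j) : ℝ) - l j)) ^ 2 =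
      ∑ j, ∑ j', c j / Real.sqrt M * (c j' / Real.sqrt M) *
        (((workload (A j) : ℝ) - l j) * ((workload (A j') : ℝ) - l j')) := by
    rw [sq, Finset.sum_mul_sum]
    exact Finset.sum_congr rfl fun j _ => Finset.sum_congr rfl fun j' _ => by ring
  rw [← h2, h1]; ring

theorem integrable_weightedArrival_sub_sq (h : SecondMomentLE μ V) (e : ℝ)
    (l : EuclideanSpace ℝ (Fin J)) : PMFIntegrable μ fun A =>
      (weightedArrival M c A - ∑ j, c j / Real.sqrt M * l j - e) ^ 2 := by
  simp only [weightedArrival_sub_sq]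
  exact (PMFIntegrable.sum _ fun j _ => PMFIntegrable.sum _ fun j' _ =>
    (h.integrable_mul_sub j j' _ _).const_mul _).add ((pmfIntegrable_const μ _).sub
      (((h.integrable_weightedArrival c).sub (pmfIntegrable_const μ _)).const_mul _))

/-- Uncorrelatedness leaves only the diagonal of the double sum. This is the source of the variance
term of the proposition. -/
theorem expect_weightedArrival_sub_sq (h : SecondMomentLE μ V)
    (huncorr : ∀ j j' : Fin J, j ≠ j' → arrivalCov μ j j' = 0) (e : ℝ) :
    pmfExpect μ (fun A =>
      (weightedArrival M c A - ∑ j, c j / Real.sqrt M * arrivalRate μ j - e) ^ 2) =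
      (∑ j, c j ^ 2 * arrivalVar μ j) / M + e ^ 2 := by
  simp only [weightedArrival_sub_sq]
  have hw := h.integrable_weightedArrival (M := M) c
  have hs : ∀ j ∈ Finset.univ, PMFIntegrable μ fun A : Arrivals J D =>
      ∑ j', c j / Real.sqrt M * (c j' / Real.sqrt M) *
        (((workload (A j) : ℝ) - arrivalRate μ j) *
          ((workload (A j') : ℝ) - arrivalRate μ j')) := fun j _ =>
    PMFIntegrable.sum _ fun j' _ => (h.integrable_mul_sub j j' _ _).const_mul _
  rw [pmfExpect_add (PMFIntegrable.sum _ hs) ((pmfIntegrable_const μ _).sub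
      ((hw.sub (pmfIntegrable_const μ _)).const_mul _)),
    pmfExpect_sub (pmfIntegrable_const μ _) ((hw.sub (pmfIntegrable_const μ _)).const_mul _),
    pmfExpect_const_mul, pmfExpect_sub hw (pmfIntegrable_const μ _), pmfExpect_const,
    pmfExpect_const, h.expect_weightedArrival, sub_self, mul_zero, sub_zero, pmfExpect_sum _ hs]
  congr 1
  rw [Finset.sum_div]
  refine Finset.sum_congr rfl fun j _ => ?_
  rw [pmfExpect_sum _ fun j' _ => (h.integrable_mul_sub j j' _ _).const_mul _,
    Finset.sum_eq_single j]
  · rw [pmfExpect_const_mul, div_mul_div_comm, Real.mul_self_sqrt (Nat.cast_nonneg _)]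
    change c j * c j / M * arrivalVar μ j = _
    ring
  · intro j' _ hj'
    rw [pmfExpect_const_mul]
    change _ * arrivalCov μ j j' = 0
    rw [huncorr j j' hj'.symm, mul_zero]
  · simp

end SecondMomentLE

end moments

/-! ### Stability -/

section stability

variable {I J M D : ℕ} {sys : CloudSystem I J M}

/-- The offered weight is a maximum, the same for all maximizers. One sample `ω₀` of the slot can
thus stand for all of them, and the choice among MaxWeight schedules drops out. -/
theorem offeredWeight_congr {Y : CloudState J M D} {ω ω' : SlotInput J M D}
    (h : ∀ m, IsMaxWeight sys Y m (ω.2.2 m)) (h' : ∀ m, IsMaxWeight sys Y m (ω'.2.2 m)) :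
    offeredWeight Y ω = offeredWeight Y ω' := by
  have e : ∀ ω : SlotInput J M D, offeredWeight Y ω =
      ∑ m, ∑ j, (ω.2.2 m j : ℝ) * (workload (Y j m) : ℝ) := fun ω => by
    rw [offeredWeight, Finset.sum_comm]; simp only [mul_comm]
  rw [e, e]
  refine Finset.sum_congr rfl fun m _ => le_antisymm ?_ ?_
  · exact (h' m).2.2 _ (h m).2.1
  · exact (h m).2.2 _ (h' m).2.1

/-- Total amount of work in the system. -/
noncomputable def totalQueue (Y : CloudState J M D) : ℝ := ∑ j, ∑ m, (workload (Y j m) : ℝ)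

theorem totalQueue_nonneg (Y : CloudState J M D) : 0 ≤ totalQueue Y :=
  Finset.sum_nonneg fun _ _ => Finset.sum_nonneg fun _ _ => Nat.cast_nonneg _

theorem finite_setOf_totalQueue_le (t : ℝ) : {Y : CloudState J M D | totalQueue Y ≤ t}.Finite := by
  refine (finite_setOf_workload_le ⌊t⌋₊).subset fun Y hY => ?_
  have hY' : totalQueue Y ≤ t := hY
  refine Nat.le_floor (le_trans (le_of_eq ?_) hY')
  rw [totalQueue]; push_cast; rfl

variable [NeZero M]

/-- Bound for the constant part of the drift of the squared queue lengths. -/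
noncomputable def driftConst (J M D : ℕ) (S V : ℝ) : ℝ :=
  2 * (J * M * (D * S * S)) + (2 * J * (J * V) + 2 * (J * M * S) ^ 2)

theorem expect_sum_minQueue_mul {μ : PMF (Arrivals J D)} {V : ℝ} (hV : SecondMomentLE μ V)
    (Y : CloudState J M D) :
    PMFIntegrable μ (fun A => ∑ j, minQueue Y j * (workload (A j) : ℝ)) ∧
    pmfExpect μ (fun A => ∑ j, minQueue Y j * (workload (A j) : ℝ)) =
      ∑ j, minQueue Y j * arrivalRate μ j := by
  refine ⟨PMFIntegrable.sum _ fun j _ => (hV.integrable j).const_mul _, ?_⟩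
  rw [pmfExpect_sum _ fun j _ => (hV.integrable j).const_mul _]
  exact Finset.sum_congr rfl fun j _ => pmfExpect_const_mul _ _ _

theorem sum_minQueue_mul_add_le {l : Fin J → ℝ} (hl : ∀ j, 0 ≤ l j) {δ : ℝ}
    {Y : CloudState J M D} {ω : SlotInput J M D}
    (hw : ∀ m, ∑ j, (l j + δ) * (workload (Y j m) : ℝ) ≤
      M * ∑ j, (ω.2.2 m j : ℝ) * (workload (Y j m) : ℝ)) :
    ∑ j, minQueue Y j * l j + δ / M * totalQueue Y ≤ offeredWeight Y ω := by
  have hM : (0 : ℝ) < M := by exact_mod_cast NeZero.pos M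
  have h1 := Finset.sum_le_sum fun m (_ : m ∈ Finset.univ) => hw m
  rw [← Finset.mul_sum] at h1
  have e1 : offeredWeight Y ω = ∑ m, ∑ j, (ω.2.2 m j : ℝ) * (workload (Y j m) : ℝ) := by
    rw [offeredWeight, Finset.sum_comm]; simp only [mul_comm]
  rw [← e1] at h1
  have e2 : ∑ m, ∑ j, (l j + δ) * (workload (Y j m) : ℝ) =
      ∑ j, l j * ∑ m, (workload (Y j m) : ℝ) + δ * totalQueue Y := by
    rw [Finset.sum_comm, totalQueue, Finset.mul_sum, ← Finset.sum_add_distrib]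
    exact Finset.sum_congr rfl fun j _ => by rw [← Finset.mul_sum]; ring
  rw [e2] at h1
  have h2 : M * ∑ j, minQueue Y j * l j ≤ ∑ j, l j * ∑ m, (workload (Y j m) : ℝ) := by
    rw [Finset.mul_sum]
    refine Finset.sum_le_sum fun j _ => ?_
    calc M * (minQueue Y j * l j) = l j * ∑ _m : Fin M, minQueue Y j := by simp; ring
      _ ≤ _ := mul_le_mul_of_nonneg_left (Finset.sum_le_sum fun m _ => minQueue_le Y j m) (hl j)
  refine le_of_mul_le_mul_left ?_ hM
  have e3 : (M : ℝ) * (δ / M * totalQueue Y) = δ * totalQueue Y := by field_simp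
  rw [mul_add, e3]
  linarith

variable {P : MaxWeightPolicy sys D} {μ : PMF (Arrivals J D)} {S V δ : ℝ}

/-- Foster–Lyapunov inequality for the squared norm of the queue lengths. -/
theorem lexp_cloudStep_norm_sq_le (hS : ∀ (Y : CloudState J M D) m s, IsMaxWeight sys Y m s →
      ∀ j, (s j : ℝ) ≤ S)
    (hδ : 0 ≤ δ) (hV0 : 0 ≤ V) (hV : SecondMomentLE μ V) (hl : ∀ j, 0 ≤ arrivalRate μ j)
    (hw : ∀ (Y : CloudState J M D) m s, IsMaxWeight sys Y m s →
      ∑ j, (arrivalRate μ j + δ) * (workload (Y j m) : ℝ) ≤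
        M * ∑ j, (s j : ℝ) * (workload (Y j m) : ℝ)) (Y : CloudState J M D) :
    lexp (cloudStep P μ Y) (fun Y' => ENNReal.ofReal (‖queueVec Y'‖ ^ 2)) +
        ENNReal.ofReal (2 * δ / M * totalQueue Y) ≤
      ENNReal.ofReal (‖queueVec Y‖ ^ 2) + ENNReal.ofReal (driftConst J M D S V) := by
  obtain ⟨ω₀, hω₀⟩ := (slotLaw P μ Y).support_nonempty
  have hω₀' := (mem_support_slotLaw P μ Y hω₀).2
  -- A bound for the new squared norm that depends on the arrivals alone, so that its mean can be
  -- computed under `μ`.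
  set G : Arrivals J D → ℝ := fun A => ‖queueVec Y‖ ^ 2 +
    (2 * (∑ j, minQueue Y j * (workload (A j) : ℝ) - offeredWeight Y ω₀ + J * M * (D * S * S)) +
      incrBound (J * M * S) A ^ 2) with hG
  obtain ⟨hi1, he1⟩ := expect_sum_minQueue_mul hV Y
  have hi2 := hV.integrable_incrBound_sq (J * M * S)
  have hi3 := ((hi1.sub (pmfIntegrable_const μ (offeredWeight Y ω₀))).add
    (pmfIntegrable_const μ (J * M * (D * S * S)))).const_mul 2
  have hGi : PMFIntegrable μ G := (pmfIntegrable_const μ _).add (hi3.add hi2)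
  have hGe : pmfExpect μ G = ‖queueVec Y‖ ^ 2 + (2 * (∑ j, minQueue Y j * arrivalRate μ j -
      offeredWeight Y ω₀ + J * M * (D * S * S)) +
        pmfExpect μ (fun A => incrBound (J * M * S) A ^ 2)) := by
    rw [hG, pmfExpect_add (pmfIntegrable_const μ _) (hi3.add hi2), pmfExpect_add hi3 hi2,
      pmfExpect_const, pmfExpect_const_mul,
      pmfExpect_add (hi1.sub (pmfIntegrable_const μ _)) (pmfIntegrable_const μ _),
      pmfExpect_sub hi1 (pmfIntegrable_const μ _), he1, pmfExpect_const, pmfExpect_const]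
  have hle : ∀ ω ∈ (slotLaw P μ Y).support, ‖queueVec Y + queueIncr Y ω‖ ^ 2 ≤ G ω.1 := by
    intro ω hω
    obtain ⟨hρ, hs⟩ := mem_support_slotLaw P μ Y hω
    rw [norm_add_sq_real, inner_queueVec_queueIncr Y ω hρ, offeredWeight_congr hs hω₀', hG]
    have h1 := sum_queue_mul_unusedService_le Y ω fun m j => hS Y m _ (hs m) j
    have h2 := pow_le_pow_left₀ (norm_nonneg _)
      (norm_queueIncr_le Y ω fun m j => hS Y m _ (hs m) j) 2
    rw [← incrBound] at h2
    dsimp only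
    linarith
  have h3 : lexp (cloudStep P μ Y) (fun Y' => ENNReal.ofReal (‖queueVec Y'‖ ^ 2)) ≤
      ENNReal.ofReal (pmfExpect μ G) := by
    rw [lexp_cloudStep_queueVec P μ Y fun v => ENNReal.ofReal (‖v‖ ^ 2),
      ← pmfExpect_slotLaw_fst P μ Y hGi]
    exact lexp_le_ofReal ((pmfIntegrable_slotLaw_fst P μ Y).2 hGi)
      (fun ω hω => (sq_nonneg _).trans (hle ω hω)) hle
  have h4 : 0 ≤ pmfExpect μ G := by
    rw [← pmfExpect_slotLaw_fst P μ Y hGi, ← pmfExpect_const (slotLaw P μ Y) 0]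
    exact pmfExpect_mono (pmfIntegrable_const _ _) ((pmfIntegrable_slotLaw_fst P μ Y).2 hGi)
      fun ω hω => (sq_nonneg _).trans (hle ω hω)
  have h5 := sum_minQueue_mul_add_le hl fun m => hw Y m _ (hω₀' m)
  have h6 := hV.expect_incrBound_sq_le hV0 (J * M * S)
  have hS0 : 0 ≤ J * M * (D * S * S) := by
    rw [mul_assoc (D : ℝ)]; have := mul_self_nonneg S; positivity
  refine (add_le_add_left h3 _).trans ?_
  rw [← ENNReal.ofReal_add h4 (mul_nonneg (by positivity) (totalQueue_nonneg Y)),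
    ← ENNReal.ofReal_add (sq_nonneg _) (by rw [driftConst]; positivity)]
  refine ENNReal.ofReal_le_ofReal ?_
  rw [hGe, driftConst]
  have e : 2 * δ / M * totalQueue Y = 2 * (δ / M * totalQueue Y) := by ring
  rw [e]
  linarith

/-- A MaxWeight system whose arrival rate is inside the capacity region is stable. -/
theorem exists_isSteadyState (hS : ∀ (Y : CloudState J M D) m s, IsMaxWeight sys Y m s →
      ∀ j, (s j : ℝ) ≤ S)
    (hδ : 0 < δ) (hV0 : 0 ≤ V) (hV : SecondMomentLE μ V) (hl : ∀ j, 0 ≤ arrivalRate μ j)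
    (hw : ∀ (Y : CloudState J M D) m s, IsMaxWeight sys Y m s →
      ∑ j, (arrivalRate μ j + δ) * (workload (Y j m) : ℝ) ≤
        M * ∑ j, (s j : ℝ) * (workload (Y j m) : ℝ)) : ∃ π, IsSteadyState P μ π := by
  have hM : (0 : ℝ) < M := by exact_mod_cast NeZero.pos M
  refine exists_stationary_of_drift (cloudStep P μ) (fun _ _ => [])
    (fun Y => ENNReal.ofReal (‖queueVec Y‖ ^ 2))
    (fun Y => ENNReal.ofReal (2 * δ / M * totalQueue Y)) (ENNReal.ofReal (driftConst J M D S V))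
    ENNReal.ofReal_ne_top ENNReal.ofReal_ne_top (fun L => ?_)
    fun Y => lexp_cloudStep_norm_sq_le hS hδ.le hV0 hV hl hw Y
  refine (finite_setOf_totalQueue_le (L / (2 * δ / M))).subset fun Y hY => ?_
  have hY' : ENNReal.ofReal (2 * δ / M * totalQueue Y) ≤ (L : ℝ≥0∞) := hY
  rw [← ENNReal.ofReal_natCast, ENNReal.ofReal_le_ofReal_iff (Nat.cast_nonneg _)] at hY'
  exact (le_div_iff₀' (by positivity)).2 hY'

theorem lexp_totalQueue_le (hS : ∀ (Y : CloudState J M D) m s, IsMaxWeight sys Y m s →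
      ∀ j, (s j : ℝ) ≤ S)
    (hδ : 0 < δ) (hV0 : 0 ≤ V) (hV : SecondMomentLE μ V) (hl : ∀ j, 0 ≤ arrivalRate μ j)
    (hw : ∀ (Y : CloudState J M D) m s, IsMaxWeight sys Y m s →
      ∑ j, (arrivalRate μ j + δ) * (workload (Y j m) : ℝ) ≤
        M * ∑ j, (s j : ℝ) * (workload (Y j m) : ℝ)) {π : PMF (CloudState J M D)}
    (hπ : IsSteadyState P μ π) :
    lexp π (fun Y => ENNReal.ofReal (2 * δ / M * totalQueue Y)) ≤
      ENNReal.ofReal (driftConst J M D S V) := by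
  have h := lexp_le_of_drift hπ (fun Y => ENNReal.ofReal (‖queueVec Y‖ ^ 2))
    (fun Y => ENNReal.ofReal (2 * δ / M * totalQueue Y))
    (fun _ => ENNReal.ofReal (driftConst J M D S V)) (fun _ => ENNReal.ofReal_ne_top)
    fun Y => lexp_cloudStep_norm_sq_le hS hδ.le hV0 hV hl hw Y
  rwa [lexp_const] at h

theorem weightedQueue_le_totalQueue {c : EuclideanSpace ℝ (Fin J)} (hc1 : ∀ j, c j ≤ 1)
    (Y : CloudState J M D) : weightedQueue c Y ≤ totalQueue Y := by
  refine Finset.sum_le_sum fun j _ => Finset.sum_le_sum fun m _ => ?_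
  have h1 : (1 : ℝ) ≤ Real.sqrt M := one_le_sqrt_natCast
  refine mul_le_of_le_one_left (Nat.cast_nonneg _) ?_
  rw [div_le_one (by linarith)]
  exact (hc1 j).trans h1

/-- The explicit bound matters as well: it involves the law only through `δ` and `V`, which keeps
the error function of the proposition finite at each fixed distance. -/
theorem weightedQueue_integrable {c : EuclideanSpace ℝ (Fin J)} (hc0 : ∀ j, 0 ≤ c j)
    (hc1 : ∀ j, c j ≤ 1) (hS : ∀ (Y : CloudState J M D) m s, IsMaxWeight sys Y m s →
      ∀ j, (s j : ℝ) ≤ S)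
    (hδ : 0 < δ) (hV0 : 0 ≤ V) (hV : SecondMomentLE μ V) (hl : ∀ j, 0 ≤ arrivalRate μ j)
    (hw : ∀ (Y : CloudState J M D) m s, IsMaxWeight sys Y m s →
      ∑ j, (arrivalRate μ j + δ) * (workload (Y j m) : ℝ) ≤
        M * ∑ j, (s j : ℝ) * (workload (Y j m) : ℝ)) {π : PMF (CloudState J M D)}
    (hπ : IsSteadyState P μ π) :
    PMFIntegrable π (weightedQueue c) ∧
      2 * δ / M * pmfExpect π (weightedQueue c) ≤ max (driftConst J M D S V) 0 := by
  have hM : (0 : ℝ) < M := by exact_mod_cast NeZero.pos M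
  have h1 := lexp_totalQueue_le hS hδ hV0 hV hl hw hπ
  have hy := weightedQueue_nonneg hc0 (M := M) (D := D)
  have h2 : lexp π (fun Y => ENNReal.ofReal (2 * δ / M * weightedQueue c Y)) ≤
      ENNReal.ofReal (driftConst J M D S V) := by
    refine le_trans (lexp_mono _ fun Y => ENNReal.ofReal_le_ofReal ?_) h1
    exact mul_le_mul_of_nonneg_left (weightedQueue_le_totalQueue hc1 Y) (by positivity)
  have h3 : PMFIntegrable π fun Y => 2 * δ / M * weightedQueue c Y :=
    pmfIntegrable_of_lexp (fun Y => mul_nonneg (by positivity) (hy Y))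
      (ne_top_of_le_ne_top ENNReal.ofReal_ne_top h2)
  constructor
  · have := h3.const_mul (2 * δ / M)⁻¹
    refine this.mono fun Y _ => ?_
    rw [inv_mul_cancel_left₀ (by positivity), abs_of_nonneg (hy Y)]
  · rw [lexp_ofReal h3 fun Y => mul_nonneg (by positivity) (hy Y), pmfExpect_const_mul] at h2
    exact (ENNReal.ofReal_le_ofReal_iff (le_max_right _ _)).1
      (h2.trans (ENNReal.ofReal_le_ofReal (le_max_left _ _)))

end stability

/-! ### State-space collapse -/

section spaceCollapse

variable {I J M D : ℕ} [NeZero M] {sys : CloudSystem I J M}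
  {c lamk : EuclideanSpace ℝ (Fin J)} {b S r η ℓ κ : ℝ}

/-- Distance of the queue lengths to the direction of the face. -/
noncomputable def perpNorm (c : EuclideanSpace ℝ (Fin J)) (Y : CloudState J M D) : ℝ :=
  ‖perp (faceVec M c) (queueVec Y)‖

/-- One-step bound for the square of the excess of a nonnegative quantity over `K`. -/
theorem sq_posPart_sub_le {w w' p n Z K : ℝ} (hw : 0 ≤ w) (hK : 0 ≤ K)
    (hn : 0 ≤ n) (hnZ : n ≤ Z) (hsq : w' ^ 2 ≤ w ^ 2 + 2 * p + n ^ 2) (hd : |w' - w| ≤ n) :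
    max (w' - K) 0 ^ 2 ≤ max (w - K) 0 ^ 2 + max (w - K) 0 / w * (2 * p + Z ^ 2) +
      ((if K / 2 < w then Z ^ 2 else 0) + if K / 2 < Z then Z ^ 2 else 0) := by
  have hd' := abs_le.1 hd
  have hnZ2 : n ^ 2 ≤ Z ^ 2 := pow_le_pow_left₀ hn hnZ 2
  have hdn : (w' - w) ^ 2 ≤ n ^ 2 := by rw [← sq_abs]; exact pow_le_pow_left₀ (abs_nonneg _) hd 2
  have hi1 : 0 ≤ if K / 2 < w then Z ^ 2 else 0 := by split_ifs <;> positivity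
  have hi2 : 0 ≤ if K / 2 < Z then Z ^ 2 else 0 := by split_ifs <;> positivity
  -- Since `w' ≤ w + Z`, exceeding `K` requires that `w` or `Z` exceed `K / 2`. The quadratic error
  -- is thus charged only to rare events.
  have hind : K < w' → Z ^ 2 ≤ (if K / 2 < w then Z ^ 2 else 0) +
      if K / 2 < Z then Z ^ 2 else 0 := by
    intro h
    by_cases h1 : K / 2 < w
    · rw [if_pos h1]; linarith
    · rw [if_pos (show K / 2 < Z by linarith)]; linarith
  by_cases hwK : K < w
  · have hw0 : 0 < w := lt_of_le_of_lt hK hwK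
    rw [max_eq_left (by linarith : 0 ≤ w - K)]
    -- The drift of the square is first turned into one of `w` itself, then rescaled by `(w - K) /
    -- w`.
    have h1 : 2 * w * (w' - w) ≤ 2 * p + n ^ 2 := by nlinarith [sq_nonneg (w' - w)]
    have h2 : 2 * (w - K) * (w' - w) ≤ (w - K) / w * (2 * p + Z ^ 2) := by
      have : (w - K) / w * (2 * w * (w' - w)) ≤ (w - K) / w * (2 * p + Z ^ 2) :=
        mul_le_mul_of_nonneg_left (by linarith) (div_nonneg (by linarith) hw)
      have e : (w - K) / w * (2 * w * (w' - w)) = 2 * (w - K) * (w' - w) := by field_simp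
      linarith
    by_cases h3 : K < w'
    · rw [max_eq_left (by linarith : 0 ≤ w' - K)]
      have := hind h3
      nlinarith
    · rw [max_eq_right (by linarith : w' - K ≤ 0)]
      have : 0 ≤ (w - K) ^ 2 + 2 * (w - K) * (w' - w) + n ^ 2 := by
        nlinarith [sq_nonneg (w - K + (w' - w))]
      have hw2 : K / 2 < w := by linarith
      rw [if_pos hw2]
      nlinarith
  · rw [max_eq_right (by linarith : w - K ≤ 0)]
    by_cases h3 : K < w'
    · rw [max_eq_left (by linarith : 0 ≤ w' - K)]
      have := hind h3
      have h4 : (w' - K) ^ 2 ≤ n ^ 2 := pow_le_pow_left₀ (by linarith) (by linarith) 2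
      simp only [zero_div, zero_mul]
      linarith
    · rw [max_eq_right (by linarith : w' - K ≤ 0)]
      simp only [zero_div, zero_mul]
      linarith

variable {P : MaxWeightPolicy sys D} {μ : PMF (Arrivals J D)} {V ε : ℝ}

/-- Lyapunov inequality for the distance to the direction of the face. -/
theorem lexp_cloudStep_perpNorm_le (h : FaceData D sys c lamk b S r η ℓ κ) (hV0 : 0 ≤ V)
    (hV : SecondMomentLE μ V) (hε0 : 0 ≤ ε) (hε : ε ≤ ℓ / 2)
    (hrate : ∀ j, arrivalRate μ j = lamk j - ε * c j) {K : ℝ}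
    (hK : driftConst J M D S V / collapseRate M r ℓ ≤ K) (Y : CloudState J M D) :
    lexp (cloudStep P μ Y) (fun Y' => ENNReal.ofReal (max (perpNorm c Y' - K) 0 ^ 2)) +
        ENNReal.ofReal (collapseRate M r ℓ * max (perpNorm c Y - K) 0) ≤
      ENNReal.ofReal (max (perpNorm c Y - K) 0 ^ 2) +
        (ENNReal.ofReal (driftConst J M D S V * if K / 2 < perpNorm c Y then 1 else 0) +
          lexp μ (fun A => ENNReal.ofReal (if K / 2 < incrBound (J * M * S) A then
            incrBound (J * M * S) A ^ 2 else 0))) := by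
  have hu : ‖faceVec M c‖ = 1 := norm_faceVec h.norm_normal
  have hγ := h.collapseRate_pos (M := M)
  have hS0 := h.bound_nonneg
  have hC0 : 0 ≤ driftConst J M D S V := by rw [driftConst]; positivity
  have hK0 : 0 ≤ K := (div_nonneg hC0 hγ.le).trans hK
  obtain ⟨ω₀, hω₀⟩ := (slotLaw P μ Y).support_nonempty
  have hω₀' := (mem_support_slotLaw P μ Y hω₀).2
  set z : ℝ := J * M * S with hz
  have hz0 : 0 ≤ z := by positivity
  set w := perpNorm c Y with hw
  have hw0 : 0 ≤ w := norm_nonneg _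
  set y := weightedQueue c Y with hy
  set θ := max (w - K) 0 / w with hθ
  have hθ0 : 0 ≤ θ := div_nonneg (le_max_right _ _) hw0
  set T : Arrivals J D → ℝ := fun A =>
    if K / 2 < incrBound z A then incrBound z A ^ 2 else 0 with hT
  set X : ℝ := if K / 2 < w then 1 else 0 with hX
  have hX0 : 0 ≤ X := by rw [hX]; split_ifs <;> norm_num
  have hX1 : X ≤ 1 := by rw [hX]; split_ifs <;> norm_num
  let Q : Arrivals J D → ℝ := fun A =>
    ∑ j, minQueue Y j * (workload (A j) : ℝ) - y * weightedArrival M c A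
  obtain ⟨hi1, he1⟩ := expect_sum_minQueue_mul hV Y
  have hi2 := hV.integrable_incrBound_sq z
  have hi3 := hV.integrable_weightedArrival (M := M) c
  have hQi : PMFIntegrable μ Q := hi1.sub (hi3.const_mul y)
  have hQe : pmfExpect μ Q = ∑ j, minQueue Y j * arrivalRate μ j -
      y * ∑ j, c j / Real.sqrt M * arrivalRate μ j := by
    rw [pmfExpect_sub hi1 (hi3.const_mul y), he1, pmfExpect_const_mul,
      hV.expect_weightedArrival]
  have hTi : PMFIntegrable μ T := hi2.mono fun A _ => by
    rw [hT]; dsimp only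
    split_ifs
    · rw [abs_of_nonneg (sq_nonneg _)]
    · rw [abs_zero]; positivity
  have hT0 : ∀ A, 0 ≤ T A := fun A => by
    rw [hT]; dsimp only; split_ifs <;> positivity
  set a : ℝ := max (w - K) 0 ^ 2 +
    2 * θ * (J * M * (D * S * S) - offeredWeight Y ω₀ + y * (b / Real.sqrt M)) with ha
  let G : Arrivals J D → ℝ := fun A => a + (2 * θ * Q A + ((θ + X) * incrBound z A ^ 2 + T A))
  have hGi : PMFIntegrable μ G := (pmfIntegrable_const μ a).add
    ((hQi.const_mul _).add ((hi2.const_mul _).add hTi))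
  have hGe : pmfExpect μ G = a + (2 * θ * pmfExpect μ Q +
      ((θ + X) * pmfExpect μ (fun A => incrBound z A ^ 2) + pmfExpect μ T)) := by
    rw [pmfExpect_add (pmfIntegrable_const μ a) ((hQi.const_mul _).add ((hi2.const_mul _).add hTi)),
      pmfExpect_add (hQi.const_mul _) ((hi2.const_mul _).add hTi),
      pmfExpect_add (hi2.const_mul _) hTi, pmfExpect_const, pmfExpect_const_mul,
      pmfExpect_const_mul]
  have hle : ∀ ω ∈ (slotLaw P μ Y).support,
      max (‖perp (faceVec M c) (queueVec Y + queueIncr Y ω)‖ - K) 0 ^ 2 ≤ G ω.1 := by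
    intro ω hω
    obtain ⟨hρ, hs⟩ := mem_support_slotLaw P μ Y hω
    have h1 := h.inner_perp_queueIncr_le Y ω hρ hs
    rw [offeredWeight_congr hs hω₀'] at h1
    have h2 : ‖queueIncr Y ω‖ ≤ incrBound z ω.1 :=
      norm_queueIncr_le Y ω fun m j => h.config_le Y m _ (hs m) j
    have h3 := sq_posPart_sub_le hw0 hK0 (norm_nonneg _) h2
      (norm_perp_add_sq_le hu (queueVec Y) (queueIncr Y ω))
      (abs_norm_perp_add_sub_le hu (queueVec Y) (queueIncr Y ω))
    refine h3.trans ?_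
    have e1 : (if K / 2 < w then incrBound z ω.1 ^ 2 else 0) = X * incrBound z ω.1 ^ 2 := by
      rw [hX]; split_ifs <;> simp
    rw [e1]
    have h4 := mul_le_mul_of_nonneg_left h1 hθ0
    simp only [G, ha, Q, hT]
    rw [← hy] at h4
    linarith
  have h3 : lexp (cloudStep P μ Y) (fun Y' => ENNReal.ofReal (max (perpNorm c Y' - K) 0 ^ 2)) ≤
      ENNReal.ofReal (pmfExpect μ G) := by
    simp only [perpNorm]
    rw [lexp_cloudStep_queueVec P μ Y fun v =>
        ENNReal.ofReal (max (‖perp (faceVec M c) v‖ - K) 0 ^ 2),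
      ← pmfExpect_slotLaw_fst P μ Y hGi]
    exact lexp_le_ofReal ((pmfIntegrable_slotLaw_fst P μ Y).2 hGi)
      (fun ω hω => (sq_nonneg _).trans (hle ω hω)) hle
  have h4 : 0 ≤ pmfExpect μ G := by
    rw [← pmfExpect_slotLaw_fst P μ Y hGi, ← pmfExpect_const (slotLaw P μ Y) 0]
    exact pmfExpect_mono (pmfIntegrable_const _ _) ((pmfIntegrable_slotLaw_fst P μ Y).2 hGi)
      fun ω hω => (sq_nonneg _).trans (hle ω hω)
  have h5 := h.mean_drift_le Y ω₀ hω₀' hε0 hε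
  have h6 := hV.expect_incrBound_sq_le hV0 z
  rw [lexp_ofReal hTi hT0]
  refine (add_le_add_left h3 _).trans ?_
  rw [← ENNReal.ofReal_add h4 (mul_nonneg hγ.le (le_max_right _ _)),
    ← ENNReal.ofReal_add (mul_nonneg hC0 hX0) (pmfExpect_nonneg hT0),
    ← ENNReal.ofReal_add (sq_nonneg _)
      (add_nonneg (mul_nonneg hC0 hX0) (pmfExpect_nonneg hT0))]
  refine ENNReal.ofReal_le_ofReal ?_
  rw [hGe, hQe]
  simp only [hrate]
  rw [ha]
  -- For `w = 0` the quotient `θ` is `0`, consistent with `K ≥ 0`.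
  have hθw : θ * w = max (w - K) 0 := by
    by_cases hw1 : w = 0
    · rw [hθ, hw1, mul_zero, max_eq_right (by linarith)]
    · exact div_mul_cancel₀ _ hw1
  have hE : 2 * (J * M * (D * S * S)) + pmfExpect μ (fun A => incrBound z A ^ 2) ≤
      driftConst J M D S V := by rw [driftConst]; linarith
  have hE2 : pmfExpect μ (fun A => incrBound z A ^ 2) ≤ driftConst J M D S V := by
    have : 0 ≤ J * M * (D * S * S) := by positivity
    linarith
  -- The negative drift amounts to `-2 * collapseRate * (w - K)⁺`. Above the level `K ≥ driftConst /
  -- collapseRate`, half of it absorbs the constant part.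
  have hθK : θ * driftConst J M D S V ≤ collapseRate M r ℓ * max (w - K) 0 := by
    rw [← hθw]
    by_cases hwK : K < w
    · have h7 : driftConst J M D S V ≤ collapseRate M r ℓ * w := by
        rw [div_le_iff₀ hγ] at hK
        nlinarith
      calc _ ≤ θ * (collapseRate M r ℓ * w) := mul_le_mul_of_nonneg_left h7 hθ0
        _ = _ := by ring
    · have : θ = 0 := by rw [hθ, max_eq_right (by linarith), zero_div]
      simp [this]
  have h8 := mul_le_mul_of_nonneg_left h5 (by linarith : 0 ≤ 2 * θ)
  have h9 := mul_le_mul_of_nonneg_left hE hθ0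
  have h10 := mul_le_mul_of_nonneg_left hE2 hX0
  have h11 : 2 * θ * -(collapseRate M r ℓ * ‖perp (faceVec M c) (queueVec Y)‖) =
      -(2 * (collapseRate M r ℓ * max (w - K) 0)) := by
    rw [← hθw, hw, perpNorm]; ring
  rw [h11] at h8
  rw [← hy] at h8
  linarith

theorem mul_lexp_perpNorm_le (h : FaceData D sys c lamk b S r η ℓ κ) (hV0 : 0 ≤ V)
    (hV : SecondMomentLE μ V) (hε0 : 0 ≤ ε) (hε : ε ≤ ℓ / 2)
    (hrate : ∀ j, arrivalRate μ j = lamk j - ε * c j) {K : ℝ}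
    (hK : driftConst J M D S V / collapseRate M r ℓ ≤ K) {π : PMF (CloudState J M D)}
    (hπ : IsSteadyState P μ π) :
    lexp π (fun Y => ENNReal.ofReal (collapseRate M r ℓ * max (perpNorm c Y - K) 0)) ≤
      lexp π (fun Y =>
        ENNReal.ofReal (driftConst J M D S V * if K / 2 < perpNorm c Y then 1 else 0)) +
        lexp μ (fun A => ENNReal.ofReal (if K / 2 < incrBound (J * M * S) A then
            incrBound (J * M * S) A ^ 2 else 0)) := by
  have h1 := lexp_le_of_drift hπ _ _ _ (fun _ => ENNReal.ofReal_ne_top)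
    fun Y => lexp_cloudStep_perpNorm_le (P := P) h hV0 hV hε0 hε hrate hK Y
  rwa [lexp_add, lexp_const] at h1

/-- State-space collapse: uniform integrability of the distance to the direction of the face,
under all stationary laws with arrival rates close to the face. -/
theorem exists_lexp_perpNorm_le (h : FaceData D sys c lamk b S r η ℓ κ) (hV0 : 0 ≤ V)
    {ι : Type*} {μ : ι → PMF (Arrivals J D)} (hsq : UniformlySquareIntegrable μ)
    (hV : ∀ i, SecondMomentLE (μ i) V) {δ : ℝ} (hδ : 0 < δ) :
    ∃ K ≥ 0, ∀ i ε, 0 ≤ ε → ε ≤ ℓ / 2 → (∀ j, arrivalRate (μ i) j = lamk j - ε * c j) →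
      ∀ (P : MaxWeightPolicy sys D) (π : PMF (CloudState J M D)), IsSteadyState P (μ i) π →
        lexp π (fun Y => ENNReal.ofReal (max (perpNorm c Y - K) 0)) ≤ ENNReal.ofReal δ := by
  have hγ := h.collapseRate_pos (M := M)
  have hS0 := h.bound_nonneg
  set γ := collapseRate M r ℓ with hγ_def
  set C := driftConst J M D S V with hC
  have hC0 : 0 ≤ C := by rw [hC, driftConst]; positivity
  set z : ℝ := J * M * S with hz
  have hz0 : 0 ≤ z := by positivity
  set K₁ := C / γ with hK₁
  have hK₁0 : 0 ≤ K₁ := div_nonneg hC0 hγ.le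
  obtain ⟨K₀, hK₀⟩ := hsq.exists_tail_le hz0 (show 0 < γ * δ / 2 by positivity)
  -- Chosen for Markov's inequality in `h4`: if `K / 2 - K₁ > R`, then `C * 2 * C / (γ * (K / 2 -
  -- K₁)) ≤ γ * δ / 2`. The level `K` below also ensures `K₀ ≤ K / 2` and `K₁ ≤ K`.
  set R := 4 * C * C / (γ * (γ * δ)) with hR
  have hR0 : 0 ≤ R := by positivity
  set K := 2 * (K₁ + R + 1) + 2 * max K₀ 0 with hKdef
  have hm0 : 0 ≤ max K₀ 0 := le_max_right _ _
  have hm1 : K₀ ≤ max K₀ 0 := le_max_left _ _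
  refine ⟨K, by positivity, fun i ε hε0 hε hrate P π hπ => ?_⟩
  have hE2 : ∀ K' : ℝ, lexp (μ i) (fun A => ENNReal.ofReal (if K' < incrBound z A then
      incrBound z A ^ 2 else 0)) ≤ ENNReal.ofReal C := by
    intro K'
    calc _ ≤ lexp (μ i) (fun A => ENNReal.ofReal (incrBound z A ^ 2)) :=
          lexp_mono _ fun A => ENNReal.ofReal_le_ofReal (by split_ifs <;> first | rfl | positivity)
      _ = ENNReal.ofReal (pmfExpect (μ i) fun A => incrBound z A ^ 2) :=
          lexp_ofReal ((hV i).integrable_incrBound_sq z) fun _ => sq_nonneg _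
      _ ≤ _ := by
          refine ENNReal.ofReal_le_ofReal (((hV i).expect_incrBound_sq_le hV0 z).trans ?_)
          rw [hC, driftConst, hz]
          have : 0 ≤ J * M * (D * S * S) := by positivity
          linarith
  -- The level `K₁` gives a crude bound for the mean excess. It controls the probability of `K / 2 <
  -- perpNorm c Y`, which is what the high level `K` requires.
  have h1 : ENNReal.ofReal γ * lexp π (fun Y => ENNReal.ofReal (max (perpNorm c Y - K₁) 0)) ≤
      ENNReal.ofReal (2 * C) := by
    have h2 := mul_lexp_perpNorm_le h hV0 (hV i) hε0 hε hrate le_rfl hπ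
    rw [← lexp_const_mul]
    simp only [← ENNReal.ofReal_mul hγ.le]
    refine h2.trans ?_
    rw [two_mul, ENNReal.ofReal_add hC0 hC0]
    refine add_le_add ?_ (hE2 _)
    rw [← lexp_const π (ENNReal.ofReal C)]
    refine lexp_mono _ fun Y => ENNReal.ofReal_le_ofReal ?_
    refine mul_le_of_le_one_right hC0 ?_
    split_ifs <;> norm_num
  have h2 := mul_lexp_perpNorm_le h hV0 (hV i) hε0 hε hrate (K := K)
    (by rw [hKdef, ← hC, ← hγ_def, ← hK₁]; linarith) hπ
  have h3 := hK₀ (K / 2) (by rw [hKdef]; linarith) i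
  have hKR : R < K / 2 - K₁ := by rw [hKdef]; linarith
  have hKR0 : 0 < K / 2 - K₁ := by linarith
  have h4 : lexp π (fun Y => ENNReal.ofReal (C * if K / 2 < perpNorm c Y then 1 else 0)) ≤
      ENNReal.ofReal (γ * δ / 2) := by
    calc _ ≤ lexp π (fun Y => ENNReal.ofReal (C / (γ * (K / 2 - K₁))) *
          (ENNReal.ofReal γ * ENNReal.ofReal (max (perpNorm c Y - K₁) 0))) := by
          refine lexp_mono _ fun Y => ?_
          rw [← ENNReal.ofReal_mul hγ.le, ← ENNReal.ofReal_mul (by positivity)]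
          refine ENNReal.ofReal_le_ofReal ?_
          split_ifs with hY
          · have : K / 2 - K₁ ≤ max (perpNorm c Y - K₁) 0 :=
              le_trans (by linarith) (le_max_left _ _)
            calc C * 1 = C / (γ * (K / 2 - K₁)) * (γ * (K / 2 - K₁)) := by
                  rw [mul_one, div_mul_cancel₀ _ (by positivity)]
              _ ≤ _ := by gcongr
          · rw [mul_zero]
            exact mul_nonneg (by positivity) (mul_nonneg hγ.le (le_max_right _ _))
      _ ≤ ENNReal.ofReal (C / (γ * (K / 2 - K₁))) * ENNReal.ofReal (2 * C) := by
          rw [lexp_const_mul, lexp_const_mul]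
          gcongr
      _ ≤ _ := by
          rw [← ENNReal.ofReal_mul (by positivity)]
          refine ENNReal.ofReal_le_ofReal ?_
          have hR' : R * (γ * (γ * δ)) = 4 * C * C := by rw [hR]; field_simp
          rw [div_mul_eq_mul_div, div_le_iff₀ (by positivity)]
          have := mul_le_mul_of_nonneg_right hKR.le (show 0 ≤ γ * (γ * δ) by positivity)
          nlinarith
  have h5 : ENNReal.ofReal γ * lexp π (fun Y => ENNReal.ofReal (max (perpNorm c Y - K) 0)) ≤
      ENNReal.ofReal γ * ENNReal.ofReal δ := by
    rw [← lexp_const_mul, ← ENNReal.ofReal_mul hγ.le]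
    simp only [← ENNReal.ofReal_mul hγ.le]
    refine h2.trans ?_
    calc _ ≤ ENNReal.ofReal (γ * δ / 2) + ENNReal.ofReal (γ * δ / 2) := add_le_add h4 h3
      _ = _ := by rw [← ENNReal.ofReal_add (by positivity) (by positivity), add_halves]
  exact (ENNReal.mul_le_mul_iff_right (ENNReal.ofReal_pos.2 hγ).ne' ENNReal.ofReal_ne_top).1 h5

end spaceCollapse

/-! ### Drift along the direction of the face -/

section heavyTraffic

variable {I J M D : ℕ} {sys : CloudSystem I J M}
  {c lamk : EuclideanSpace ℝ (Fin J)} {b S r η ℓ κ : ℝ}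
  {P : MaxWeightPolicy sys D} {μ : PMF (Arrivals J D)} {V ε : ℝ} {π : PMF (CloudState J M D)}

theorem inner_faceVec_add (c : EuclideanSpace ℝ (Fin J)) (b : ℝ) (Y : CloudState J M D)
    (ω : SlotInput J M D) : inner ℝ (faceVec M c) (queueVec Y + queueIncr Y ω) =
      weightedQueue c Y + (weightedArrival M c ω.1 + slack c b Y ω - b / Real.sqrt M) := by
  rw [inner_add_right, ← weightedQueue_eq_inner, slack]; ring

theorem weightedArrival_nonneg (hc : ∀ j, 0 ≤ c j) (A : Arrivals J D) :
    0 ≤ weightedArrival M c A :=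
  Finset.sum_nonneg fun j _ => mul_nonneg (div_nonneg (hc j) (Real.sqrt_nonneg _))
    (Nat.cast_nonneg _)

/-- Constant in the bound of the product of queue length and slack. -/
noncomputable def slackConst (M D : ℕ) {J : ℕ} (lamk : EuclideanSpace ℝ (Fin J))
    (S η κ : ℝ) : ℝ :=
  (J * S + ∑ j, lamk j) * M / η + (D * S + 1) * M / κ

theorem slackConst_nonneg (h : FaceData D sys c lamk b S r η ℓ κ) :
    0 ≤ slackConst M D lamk S η κ := by
  have h1 := h.bound_nonneg
  have h2 := h.gap_pos
  have h3 := h.normal_gap_pos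
  have h4 : 0 ≤ ∑ j, lamk j := Finset.sum_nonneg fun j _ => h.point_pos.le.trans (h.le_point j)
  rw [slackConst]; positivity

/-- The difference is the mean of `weightedArrival`. -/
theorem mean_weightedArrival_nonneg (h : FaceData D sys c lamk b S r η ℓ κ)
    (hV : SecondMomentLE μ V) (hrate : ∀ j, arrivalRate μ j = lamk j - ε * c j) :
    0 ≤ b / Real.sqrt M - ε / Real.sqrt M := by
  have h1 := h.sum_normal_mul_sub M ε
  have h2 := hV.expect_weightedArrival (M := M) c
  simp only [hrate] at h2
  have h3 : 0 ≤ pmfExpect μ fun A => weightedArrival M c A :=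
    pmfExpect_nonneg fun A => weightedArrival_nonneg h.normal_nonneg A
  linarith

variable [NeZero M]

theorem lexp_cloudStep_weightedQueue (c : EuclideanSpace ℝ (Fin J)) (b : ℝ)
    (Y : CloudState J M D) (F : ℝ → ℝ≥0∞) :
    lexp (cloudStep P μ Y) (fun Y' => F (weightedQueue c Y')) =
      lexp (slotLaw P μ Y) fun ω => F (weightedQueue c Y +
        (weightedArrival M c ω.1 + slack c b Y ω - b / Real.sqrt M)) := by
  simp only [weightedQueue_eq_inner]
  rw [lexp_cloudStep_queueVec P μ Y fun v => F (inner ℝ (faceVec M c) v)]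
  simp only [inner_faceVec_add c b, weightedQueue_eq_inner]

/-- Mean of the slack in a slot that starts in state `Y`. -/
noncomputable def meanSlack (P : MaxWeightPolicy sys D) (μ : PMF (Arrivals J D))
    (c : EuclideanSpace ℝ (Fin J)) (b : ℝ) (Y : CloudState J M D) : ℝ≥0∞ :=
  lexp (slotLaw P μ Y) fun ω => ENNReal.ofReal (slack c b Y ω)

theorem lexp_slotLaw_weightedArrival (h : FaceData D sys c lamk b S r η ℓ κ)
    (hV : SecondMomentLE μ V) (hrate : ∀ j, arrivalRate μ j = lamk j - ε * c j)
    (Y : CloudState J M D) {a : ℝ} (ha : 0 ≤ a) :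
    lexp (slotLaw P μ Y) (fun ω => ENNReal.ofReal (a * weightedArrival M c ω.1)) =
      ENNReal.ofReal (a * (b / Real.sqrt M - ε / Real.sqrt M)) := by
  rw [lexp_slotLaw_fst P μ Y fun A => ENNReal.ofReal (a * weightedArrival M c A),
    lexp_ofReal ((hV.integrable_weightedArrival c).const_mul a)
      fun A => mul_nonneg ha (weightedArrival_nonneg h.normal_nonneg A),
    pmfExpect_const_mul, hV.expect_weightedArrival]
  simp only [hrate]
  have := h.sum_normal_mul_sub M ε
  congr 2
  linarith

/-- In equilibrium the mean weighted queue length, which is finite, does not change, so the mean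
slack can only make up for the deficit `ε / √M` of the arrivals. -/
theorem lexp_meanSlack_le (h : FaceData D sys c lamk b S r η ℓ κ) (hV : SecondMomentLE μ V)
    (hε0 : 0 ≤ ε) (hrate : ∀ j, arrivalRate μ j = lamk j - ε * c j) (hπ : IsSteadyState P μ π)
    (hint : PMFIntegrable π (weightedQueue c)) :
    lexp π (meanSlack P μ c b) ≤ ENNReal.ofReal (ε / Real.sqrt M) := by
  have hy0 := fun Y : CloudState J M D => weightedQueue_nonneg h.normal_nonneg Y
  have ha0 := mean_weightedArrival_nonneg (M := M) h hV hrate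
  have hb0 : 0 ≤ b / Real.sqrt M := div_nonneg h.offset_nonneg (Real.sqrt_nonneg _)
  have he0 : 0 ≤ ε / Real.sqrt M := div_nonneg hε0 (Real.sqrt_nonneg _)
  have h1 : ∀ Y, ENNReal.ofReal (weightedQueue c Y) +
      ENNReal.ofReal (b / Real.sqrt M - ε / Real.sqrt M) + meanSlack P μ c b Y ≤
      lexp (cloudStep P μ Y) (fun Y' => ENNReal.ofReal (weightedQueue c Y')) +
        ENNReal.ofReal (b / Real.sqrt M) := by
    intro Y
    have e1 := lexp_slotLaw_weightedArrival (P := P) h hV hrate Y zero_le_one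
    simp only [one_mul] at e1
    rw [lexp_cloudStep_weightedQueue c b Y fun x => ENNReal.ofReal x, ← e1, meanSlack,
      ← lexp_const (slotLaw P μ Y) (ENNReal.ofReal (weightedQueue c Y)),
      ← lexp_const (slotLaw P μ Y) (ENNReal.ofReal (b / Real.sqrt M)), ← lexp_add, ← lexp_add,
      ← lexp_add]
    refine lexp_mono_support _ fun ω hω => ?_
    have hs := h.slack_nonneg Y ω (mem_support_slotLaw P μ Y hω).2
    have hA := weightedArrival_nonneg (M := M) h.normal_nonneg ω.1
    rw [← ENNReal.ofReal_add (hy0 Y) hA,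
      ← ENNReal.ofReal_add (add_nonneg (hy0 Y) hA) hs]
    refine le_trans (ENNReal.ofReal_le_ofReal (le_of_eq ?_)) ENNReal.ofReal_add_le
    ring
  have h2 := lexp_mono π h1
  rw [lexp_add, lexp_add, lexp_add, lexp_stationary hπ
    fun Y => ENNReal.ofReal (weightedQueue c Y), lexp_const, lexp_const, add_assoc] at h2
  have h3 : lexp π (fun Y => ENNReal.ofReal (weightedQueue c Y)) ≠ ∞ := by
    rw [lexp_ofReal hint hy0]; exact ENNReal.ofReal_ne_top
  have h4 := (ENNReal.add_le_add_iff_left h3).1 h2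
  have h5 : ENNReal.ofReal (b / Real.sqrt M) =
      ENNReal.ofReal (b / Real.sqrt M - ε / Real.sqrt M) + ENNReal.ofReal (ε / Real.sqrt M) := by
    rw [← ENNReal.ofReal_add ha0 he0, sub_add_cancel]
  rw [h5] at h4
  exact (ENNReal.add_le_add_iff_left ENNReal.ofReal_ne_top).1 h4

/-- Upper bound for the stationary mean of the weighted queue length. -/
theorem weightedQueue_upper_bound (h : FaceData D sys c lamk b S r η ℓ κ)
    (hV : SecondMomentLE μ V) (huncorr : ∀ j j' : Fin J, j ≠ j' → arrivalCov μ j j' = 0)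
    (hε0 : 0 ≤ ε) (hrate : ∀ j, arrivalRate μ j = lamk j - ε * c j)
    (hπ : IsSteadyState P μ π) (hint : PMFIntegrable π (weightedQueue c)) {t K τ : ℝ}
    (ht : 0 < t) (hK : 0 ≤ K) (hτ : 0 ≤ τ)
    (hcol : lexp π (fun Y => ENNReal.ofReal (max (perpNorm c Y - K) 0)) ≤ ENNReal.ofReal τ) :
    2 * (ε / Real.sqrt M) * pmfExpect π (weightedQueue c) ≤
      (2 * slackConst M D lamk S η κ * (1 + K) + (1 + 1 / t) * (b + J * M * S)) *
          (ε / Real.sqrt M) +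
        2 * slackConst M D lamk S η κ * (b + J * M * S) * τ +
        (1 + t) * ((∑ j, c j ^ 2 * arrivalVar μ j) / M + (ε / Real.sqrt M) ^ 2) := by
  have hy0 := fun Y : CloudState J M D => weightedQueue_nonneg h.normal_nonneg Y
  have ha0 := mean_weightedArrival_nonneg (M := M) h hV hrate
  have hb0 : 0 ≤ b / Real.sqrt M := div_nonneg h.offset_nonneg (Real.sqrt_nonneg _)
  have he0 : 0 ≤ ε / Real.sqrt M := div_nonneg hε0 (Real.sqrt_nonneg _)
  have hS0 := h.bound_nonneg
  have hC0 := slackConst_nonneg h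
  set C := slackConst M D lamk S η κ with hC
  set B := b + J * M * S with hB
  have hB0 : 0 ≤ B := by have := h.offset_nonneg; positivity
  set e := ε / Real.sqrt M with he
  set β := b / Real.sqrt M with hβ
  set κ₁ := 2 * C * (1 + K) + (1 + 1 / t) * B with hκ₁
  have hκ₁0 : 0 ≤ κ₁ := by positivity
  set κ₂ := 2 * C * B with hκ₂
  have hκ₂0 : 0 ≤ κ₂ := by positivity
  set v := (∑ j, c j ^ 2 * arrivalVar μ j) / M with hv
  have hv0 : 0 ≤ v := div_nonneg (Finset.sum_nonneg fun j _ =>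
    mul_nonneg (sq_nonneg _) (SecondMomentLE.arrivalVar_nonneg μ j)) (Nat.cast_nonneg _)
  set abar := ∑ j, c j / Real.sqrt M * arrivalRate μ j with habar
  have habar' : abar = β - e := by
    have := h.sum_normal_mul_sub M ε
    simp only [habar, hrate]; linarith
  -- The drift of `y²`, to be averaged by `lexp_le_of_drift`. Negative terms are kept on the other
  -- side, as subtraction in `ℝ≥0∞` truncates.
  have hdrift : ∀ Y, lexp (cloudStep P μ Y) (fun Y' => ENNReal.ofReal (weightedQueue c Y' ^ 2)) +
      ENNReal.ofReal (2 * e * weightedQueue c Y) ≤ ENNReal.ofReal (weightedQueue c Y ^ 2) +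
        (ENNReal.ofReal κ₁ * meanSlack P μ c b Y +
          ENNReal.ofReal κ₂ * ENNReal.ofReal (max (perpNorm c Y - K) 0) +
          ENNReal.ofReal ((1 + t) * (v + e ^ 2))) := by
    intro Y
    set y := weightedQueue c Y with hy
    have hyY : 0 ≤ y := hy0 Y
    have hm0 : 0 ≤ max (perpNorm c Y - K) 0 := le_max_right _ _
    have hpt : ∀ ω ∈ (slotLaw P μ Y).support,
        ENNReal.ofReal ((y + (weightedArrival M c ω.1 + slack c b Y ω - β)) ^ 2) +
          ENNReal.ofReal (2 * y * β) ≤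
        ENNReal.ofReal (y ^ 2) + ENNReal.ofReal (2 * y * weightedArrival M c ω.1) +
          (ENNReal.ofReal κ₁ * ENNReal.ofReal (slack c b Y ω) +
            ENNReal.ofReal κ₂ * ENNReal.ofReal (max (perpNorm c Y - K) 0) +
            ENNReal.ofReal ((1 + t) * (weightedArrival M c ω.1 - abar - e) ^ 2)) := by
      intro ω hω
      have hs := (mem_support_slotLaw P μ Y hω).2
      have hW0 := h.slack_nonneg Y ω hs
      have hWB := h.slack_le Y ω hs
      have hyW := h.weightedQueue_mul_slack_le Y ω hs
      have hA := weightedArrival_nonneg (M := M) h.normal_nonneg ω.1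
      rw [← slackConst, ← hC, ← hy, ← perpNorm] at hyW
      rw [← hB] at hWB
      set W := slack c b Y ω with hW
      set α := weightedArrival M c ω.1 with hα
      rw [← ENNReal.ofReal_mul hκ₁0, ← ENNReal.ofReal_mul hκ₂0,
        ← ENNReal.ofReal_add (sq_nonneg _) (by positivity),
        ← ENNReal.ofReal_add (by positivity) (by positivity),
        ← ENNReal.ofReal_add (by positivity) (by positivity),
        ← ENNReal.ofReal_add (by positivity) (by positivity),
        ← ENNReal.ofReal_add (by positivity) (by positivity)]
      refine ENNReal.ofReal_le_ofReal ?_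
      -- The distance to `u` is split at the level `K`: the part below multiplies `W`, whose mean is
      -- of order `ε`; for the excess, which is small in mean, `W ≤ B` is used.
      have h1 : y * W ≤ C * (1 + K) * W + C * B * max (perpNorm c Y - K) 0 := by
        have a1 : perpNorm c Y ≤ K + max (perpNorm c Y - K) 0 := by
          linarith [le_max_left (perpNorm c Y - K) 0]
        have a2 : C * (1 + perpNorm c Y) * W ≤ C * (1 + (K + max (perpNorm c Y - K) 0)) * W := by
          gcongr
        have a3 : C * max (perpNorm c Y - K) 0 * W ≤ C * max (perpNorm c Y - K) 0 * B := by
          gcongr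
        linarith
      -- Young's inequality with parameter `t` separates the arrivals from the slack; their
      -- covariance is never needed.
      have h2 : (α + W - β) ^ 2 ≤ (1 + t) * (α - abar - e) ^ 2 + (1 + 1 / t) * (B * W) := by
        have a1 : α + W - β = (α - abar - e) + W := by rw [habar']; ring
        have a2 : (1 + 1 / t) * W ^ 2 ≤ (1 + 1 / t) * (B * W) := by
          rw [sq]; gcongr
        have a3 : ((α - abar - e) + W) ^ 2 ≤ (1 + t) * (α - abar - e) ^ 2 + (1 + 1 / t) * W ^ 2 := by
          have : 0 ≤ (t * (α - abar - e) - W) ^ 2 / t := by positivity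
          have e2 : (t * (α - abar - e) - W) ^ 2 / t =
              t * (α - abar - e) ^ 2 - 2 * (α - abar - e) * W + 1 / t * W ^ 2 := by
            field_simp; ring
          rw [e2] at this
          linarith
        rw [a1]
        linarith
      rw [hκ₁, hκ₂]
      linarith
    have h1 := lexp_mono_support _ hpt
    rw [lexp_add, lexp_add, lexp_add, lexp_add, lexp_add, lexp_const, lexp_const, lexp_const,
      lexp_const_mul, lexp_slotLaw_weightedArrival h hV hrate Y (by positivity),
      lexp_slotLaw_fst P μ Y fun A =>
        ENNReal.ofReal ((1 + t) * (weightedArrival M c A - abar - e) ^ 2),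
      lexp_ofReal ((hV.integrable_weightedArrival_sub_sq c e (arrivalRate μ)).const_mul (1 + t))
        fun A => by positivity,
      pmfExpect_const_mul, hV.expect_weightedArrival_sub_sq c huncorr e,
      ← lexp_cloudStep_weightedQueue c b Y fun x => ENNReal.ofReal (x ^ 2)] at h1
    have h2 : ENNReal.ofReal (2 * y * β) =
        ENNReal.ofReal (2 * y * (β - e)) + ENNReal.ofReal (2 * e * y) := by
      rw [← ENNReal.ofReal_add (by positivity) (by positivity)]; ring_nf
    rw [h2] at h1
    refine (ENNReal.add_le_add_iff_left
      (ENNReal.ofReal_ne_top (r := 2 * y * (β - e)))).1 (le_trans (le_of_eq ?_)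
      (h1.trans (le_of_eq ?_)))
    · ring
    · rw [meanSlack]; ring
  have h1 := lexp_le_of_drift hπ _ _ _ (fun _ => ENNReal.ofReal_ne_top) hdrift
  rw [lexp_add, lexp_add, lexp_const, lexp_const_mul, lexp_const_mul,
    lexp_ofReal (hint.const_mul (2 * e)) fun Y => mul_nonneg (by positivity) (hy0 Y),
    pmfExpect_const_mul] at h1
  have h2 : ENNReal.ofReal (2 * e * pmfExpect π (weightedQueue c)) ≤
      ENNReal.ofReal (κ₁ * e + κ₂ * τ + (1 + t) * (v + e ^ 2)) := by
    refine h1.trans ?_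
    rw [ENNReal.ofReal_add (p := κ₁ * e + κ₂ * τ) (by positivity) (by positivity),
      ENNReal.ofReal_add (p := κ₁ * e) (by positivity) (by positivity), ENNReal.ofReal_mul hκ₁0,
      ENNReal.ofReal_mul hκ₂0]
    gcongr
    exact lexp_meanSlack_le h hV hε0 hrate hπ hint
  exact (ENNReal.ofReal_le_ofReal_iff (by positivity)).1 h2

/-- The square, continued linearly beyond `n`. -/
noncomputable def linearizedSq (n y : ℝ) : ℝ := if y ≤ n then y ^ 2 else 2 * n * y - n ^ 2

theorem linearizedSq_nonneg {n : ℝ} (hn : 0 ≤ n) (y : ℝ) : 0 ≤ linearizedSq n y := by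
  rw [linearizedSq]; split_ifs with h
  · positivity
  · nlinarith

theorem linearizedSq_le {n y : ℝ} (hn : 0 ≤ n) (hy : 0 ≤ y) :
    linearizedSq n y ≤ 2 * n * y := by
  rw [linearizedSq]; split_ifs with h
  · nlinarith
  · nlinarith

/-- The function is convex with slope `2 * min y n` at `y`, and it is exactly quadratic as long as
both arguments are at most `n`. It grows linearly, so its stationary mean is finite. -/
theorem linearizedSq_add_le {n y z : ℝ} :
    linearizedSq n y + 2 * min y n * z + (if y ≤ n ∧ y + z ≤ n then z ^ 2 else 0) ≤
      linearizedSq n (y + z) := by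
  rw [linearizedSq, linearizedSq]
  by_cases h1 : y ≤ n
  · rw [min_eq_left h1, if_pos h1]
    by_cases h2 : y + z ≤ n
    · rw [if_pos ⟨h1, h2⟩, if_pos h2]; linarith [sq_nonneg z]
    · rw [if_neg (fun h => h2 h.2), if_neg h2]
      nlinarith
  · rw [min_eq_right (not_le.1 h1).le, if_neg h1, if_neg fun h => h1 h.1]
    split_ifs
    · nlinarith [sq_nonneg (y + z - n)]
    · linarith

/-- The drift of the squared weighted queue length, bounded from below. -/
theorem lexp_sq_incr_le (h : FaceData D sys c lamk b S r η ℓ κ) (hV : SecondMomentLE μ V)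
    (hε0 : 0 ≤ ε) (hrate : ∀ j, arrivalRate μ j = lamk j - ε * c j)
    (hπ : IsSteadyState P μ π) (hint : PMFIntegrable π (weightedQueue c)) :
    lexp π (fun Y => lexp (slotLaw P μ Y) fun ω =>
      ENNReal.ofReal ((weightedArrival M c ω.1 + slack c b Y ω - b / Real.sqrt M) ^ 2)) ≤
      ENNReal.ofReal (2 * (ε / Real.sqrt M) * pmfExpect π (weightedQueue c)) := by
  have hy0 := fun Y : CloudState J M D => weightedQueue_nonneg h.normal_nonneg Y
  have ha0 := mean_weightedArrival_nonneg (M := M) h hV hrate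
  have hb0 : 0 ≤ b / Real.sqrt M := div_nonneg h.offset_nonneg (Real.sqrt_nonneg _)
  have he0 : 0 ≤ ε / Real.sqrt M := div_nonneg hε0 (Real.sqrt_nonneg _)
  set e := ε / Real.sqrt M with he
  set β := b / Real.sqrt M with hβ
  let Z : CloudState J M D → SlotInput J M D → ℝ := fun Y ω =>
    weightedArrival M c ω.1 + slack c b Y ω - β
  let T : ℕ → CloudState J M D → SlotInput J M D → ℝ≥0∞ := fun n Y ω =>
    ENNReal.ofReal (if weightedQueue c Y ≤ n ∧ weightedQueue c Y + Z Y ω ≤ n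
      then Z Y ω ^ 2 else 0)
  -- The contribution of the slack is nonnegative and is discarded; letting `n` grow at the end
  -- recovers the full square by monotone convergence.
  have hstep : ∀ (n : ℕ) Y, ENNReal.ofReal (linearizedSq n (weightedQueue c Y)) +
      lexp (slotLaw P μ Y) (T n Y) ≤
      lexp (cloudStep P μ Y) (fun Y' => ENNReal.ofReal (linearizedSq n (weightedQueue c Y'))) +
        ENNReal.ofReal (2 * e * weightedQueue c Y) := by
    intro n Y
    set y := weightedQueue c Y with hy
    have hyY : 0 ≤ y := hy0 Y
    have hn0 : (0 : ℝ) ≤ n := Nat.cast_nonneg n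
    have hmin0 : 0 ≤ min y n := le_min hyY hn0
    have hpt : ∀ ω ∈ (slotLaw P μ Y).support,
        ENNReal.ofReal (linearizedSq n y) +
          ENNReal.ofReal (2 * min y n * weightedArrival M c ω.1) + T n Y ω ≤
        ENNReal.ofReal (linearizedSq n (y + (weightedArrival M c ω.1 + slack c b Y ω - β))) +
          ENNReal.ofReal (2 * min y n * β) := by
      intro ω hω
      have hW0 := h.slack_nonneg Y ω (mem_support_slotLaw P μ Y hω).2
      have hA := weightedArrival_nonneg (M := M) h.normal_nonneg ω.1
      have hl := linearizedSq_nonneg hn0 y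
      have hT0 : 0 ≤ if y ≤ n ∧ y + Z Y ω ≤ n then Z Y ω ^ 2 else 0 := by
        split_ifs <;> positivity
      have h1 := linearizedSq_add_le (n := (n : ℝ)) (y := y) (z := Z Y ω)
      have h2 : 0 ≤ 2 * min y n * slack c b Y ω := by positivity
      simp only [T, ← hy]
      rw [← ENNReal.ofReal_add hl (by positivity),
        ← ENNReal.ofReal_add (by positivity) hT0,
        ← ENNReal.ofReal_add (linearizedSq_nonneg hn0 _) (by positivity)]
      refine ENNReal.ofReal_le_ofReal ?_
      have h3 : 2 * min y n * Z Y ω = 2 * min y n * weightedArrival M c ω.1 +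
          2 * min y n * slack c b Y ω - 2 * min y n * β := by simp only [Z]; ring
      have h4 : linearizedSq n (y + Z Y ω) =
        linearizedSq n (y + (weightedArrival M c ω.1 + slack c b Y ω - β)) := rfl
      linarith
    have h1 := lexp_mono_support _ hpt
    rw [lexp_add, lexp_add, lexp_add, lexp_const, lexp_const,
      lexp_slotLaw_weightedArrival h hV hrate Y (by positivity),
      ← lexp_cloudStep_weightedQueue c b Y fun x => ENNReal.ofReal (linearizedSq n x)] at h1
    have h2 : ENNReal.ofReal (2 * min y n * β) =
        ENNReal.ofReal (2 * min y n * (β - e)) + ENNReal.ofReal (2 * min y n * e) := by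
      rw [← ENNReal.ofReal_add (by positivity) (by positivity)]; ring_nf
    rw [h2] at h1
    have h3 : ENNReal.ofReal (2 * min y n * e) ≤ ENNReal.ofReal (2 * e * y) := by
      refine ENNReal.ofReal_le_ofReal ?_
      have := mul_le_mul_of_nonneg_left (min_le_left y (n : ℝ)) he0
      linarith
    refine le_trans ?_ (add_le_add_right h3 _)
    refine (ENNReal.add_le_add_iff_left
      (ENNReal.ofReal_ne_top (r := 2 * min y n * (β - e)))).1 (le_trans (le_of_eq ?_)
      (h1.trans (le_of_eq ?_))) <;> ring
  have hn : ∀ n : ℕ, lexp π (fun Y => lexp (slotLaw P μ Y) (T n Y)) ≤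
      ENNReal.ofReal (2 * e * pmfExpect π (weightedQueue c)) := by
    intro n
    have h1 := lexp_mono π (hstep n)
    rw [lexp_add, lexp_add, lexp_stationary hπ
      fun Y => ENNReal.ofReal (linearizedSq n (weightedQueue c Y)),
      lexp_ofReal (hint.const_mul (2 * e)) fun Y => mul_nonneg (by positivity) (hy0 Y),
      pmfExpect_const_mul] at h1
    refine (ENNReal.add_le_add_iff_left ?_).1 h1
    have h2 : lexp π (fun Y => ENNReal.ofReal (2 * n * weightedQueue c Y)) ≠ ∞ := by
      rw [lexp_ofReal (hint.const_mul (2 * n)) fun Y => mul_nonneg (by positivity) (hy0 Y)]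
      exact ENNReal.ofReal_ne_top
    exact ne_top_of_le_ne_top h2 (lexp_mono _ fun Y => ENNReal.ofReal_le_ofReal
      (linearizedSq_le (Nat.cast_nonneg n) (hy0 Y)))
  have hmono : ∀ Y ω, Monotone fun n => T n Y ω := by
    intro Y ω n m hnm
    refine ENNReal.ofReal_le_ofReal ?_
    have hnm' : (n : ℝ) ≤ m := by exact_mod_cast hnm
    split_ifs with h1 h2
    · exact le_rfl
    · exact absurd ⟨h1.1.trans hnm', h1.2.trans hnm'⟩ h2
    · positivity
    · exact le_rfl
  have hsup : ∀ Y ω, ENNReal.ofReal (Z Y ω ^ 2) = ⨆ n, T n Y ω := by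
    intro Y ω
    refine le_antisymm ?_ (iSup_le fun n => ENNReal.ofReal_le_ofReal ?_)
    · obtain ⟨n, hn⟩ := exists_nat_ge (max (weightedQueue c Y) (weightedQueue c Y + Z Y ω))
      refine le_iSup_of_le n (ENNReal.ofReal_le_ofReal ?_)
      rw [if_pos ⟨(le_max_left _ _).trans hn, (le_max_right _ _).trans hn⟩]
    · split_ifs
      · exact le_rfl
      · positivity
  have e1 : (fun Y => lexp (slotLaw P μ Y) fun ω => ENNReal.ofReal (Z Y ω ^ 2)) =
      fun Y => ⨆ n, lexp (slotLaw P μ Y) (T n Y) := by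
    funext Y
    simp only [hsup]
    exact lexp_iSup_nat _ (fun n => T n Y) (hmono Y)
  change lexp π (fun Y => lexp (slotLaw P μ Y) fun ω => ENNReal.ofReal (Z Y ω ^ 2)) ≤ _
  rw [e1, lexp_iSup_nat π (fun n Y => lexp (slotLaw P μ Y) (T n Y))
    fun Y n m hnm => lexp_mono _ fun ω => hmono Y ω hnm]
  exact iSup_le hn

/-- Lower bound for the stationary mean of the weighted queue length. -/
theorem weightedQueue_lower_bound (h : FaceData D sys c lamk b S r η ℓ κ)
    (hV : SecondMomentLE μ V) (huncorr : ∀ j j' : Fin J, j ≠ j' → arrivalCov μ j j' = 0)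
    (hε0 : 0 ≤ ε) (hrate : ∀ j, arrivalRate μ j = lamk j - ε * c j)
    (hπ : IsSteadyState P μ π) (hint : PMFIntegrable π (weightedQueue c)) {t : ℝ}
    (ht : 0 < t) (ht1 : t ≤ 1) :
    (1 - t) * ((∑ j, c j ^ 2 * arrivalVar μ j) / M + (ε / Real.sqrt M) ^ 2) ≤
      2 * (ε / Real.sqrt M) * pmfExpect π (weightedQueue c) +
        (b + J * M * S) / t * (ε / Real.sqrt M) := by
  have hy0 := fun Y : CloudState J M D => weightedQueue_nonneg h.normal_nonneg Y
  have he0 : 0 ≤ ε / Real.sqrt M := div_nonneg hε0 (Real.sqrt_nonneg _)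
  have hS0 := h.bound_nonneg
  set B := b + J * M * S with hB
  have hB0 : 0 ≤ B := by have := h.offset_nonneg; positivity
  have h1 := lexp_sq_incr_le h hV hε0 hrate hπ hint
  have h2 := lexp_meanSlack_le h hV hε0 hrate hπ hint
  set e := ε / Real.sqrt M with he
  set β := b / Real.sqrt M with hβ
  set abar := ∑ j, c j / Real.sqrt M * arrivalRate μ j with habar
  have habar' : abar = β - e := by
    have := h.sum_normal_mul_sub M ε
    simp only [habar, hrate]; linarith
  have ht1' : 0 ≤ 1 - t := by linarith
  have hpt : ∀ Y, ENNReal.ofReal ((1 - t) * ((∑ j, c j ^ 2 * arrivalVar μ j) / M + e ^ 2)) ≤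
      lexp (slotLaw P μ Y) (fun ω =>
        ENNReal.ofReal ((weightedArrival M c ω.1 + slack c b Y ω - β) ^ 2)) +
        ENNReal.ofReal (B / t) * meanSlack P μ c b Y := by
    intro Y
    rw [meanSlack, ← lexp_const_mul, ← lexp_add,
      ← hV.expect_weightedArrival_sub_sq c huncorr e, ← pmfExpect_const_mul,
      ← lexp_ofReal ((hV.integrable_weightedArrival_sub_sq c e (arrivalRate μ)).const_mul (1 - t))
        (fun A => by positivity),
      ← lexp_slotLaw_fst P μ Y fun A => ENNReal.ofReal ((1 - t) *
        (weightedArrival M c A - ∑ j, c j / Real.sqrt M * arrivalRate μ j - e) ^ 2)]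
    refine lexp_mono_support _ fun ω hω => ?_
    have hs := (mem_support_slotLaw P μ Y hω).2
    have hW0 := h.slack_nonneg Y ω hs
    have hWB := h.slack_le Y ω hs
    rw [← hB] at hWB
    set W := slack c b Y ω with hW
    set α := weightedArrival M c ω.1 with hα
    rw [← ENNReal.ofReal_mul (by positivity), ← ENNReal.ofReal_add (sq_nonneg _) (by positivity)]
    refine ENNReal.ofReal_le_ofReal ?_
    rw [← habar]
    have a1 : α + W - β = (α - abar - e) + W := by rw [habar']; ring
    have a2 : 1 / t * W ^ 2 ≤ B / t * W := by
      rw [sq, div_mul_eq_mul_div, div_mul_eq_mul_div, one_mul]; gcongr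
    -- Young's inequality in the opposite direction: the slack may cancel at most a fraction `t` of
    -- the square, up to `W ^ 2 / t`.
    have a3 : (1 - t) * (α - abar - e) ^ 2 ≤ ((α - abar - e) + W) ^ 2 + 1 / t * W ^ 2 := by
      have : 0 ≤ (t * (α - abar - e) + W) ^ 2 / t := by positivity
      have e2 : (t * (α - abar - e) + W) ^ 2 / t =
          t * (α - abar - e) ^ 2 + 2 * (α - abar - e) * W + 1 / t * W ^ 2 := by
        field_simp; ring
      rw [e2] at this
      linarith [sq_nonneg W]
    rw [a1]
    linarith
  have h3 := lexp_mono π hpt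
  rw [lexp_const, lexp_add, lexp_const_mul] at h3
  have hE0 : 0 ≤ pmfExpect π (weightedQueue c) := pmfExpect_nonneg hy0
  have h4 : ENNReal.ofReal ((1 - t) * ((∑ j, c j ^ 2 * arrivalVar μ j) / M + e ^ 2)) ≤
      ENNReal.ofReal (2 * e * pmfExpect π (weightedQueue c) + B / t * e) := by
    rw [ENNReal.ofReal_add (by positivity) (by positivity),
      ENNReal.ofReal_mul (p := B / t) (by positivity)]
    refine h3.trans ?_
    gcongr
  exact (ENNReal.ofReal_le_ofReal_iff (by positivity)).1 h4

end heavyTraffic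

/-! ### The heavy-traffic limit -/

section main

variable {I J M D K : ℕ} [NeZero M] {sys : CloudSystem I J M}

theorem closestPoint_eq_add {c : Fin K → EuclideanSpace ℝ (Fin J)} {b : Fin K → ℝ}
    {C : Set (EuclideanSpace ℝ (Fin J))} (hdesc : IsHyperplaneDescription C c b)
    {l : EuclideanSpace ℝ (Fin J)} (hl : l ∈ interior C) (k : Fin K) :
    0 < hyperplaneDist (c k) (b k) l ∧ inner ℝ (c k) (closestPoint (c k) (b k) l) = b k := by
  have h1 := hyperplaneDist_eq (hdesc.norm_eq_one k) (hdesc.inner_lt hl k).le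
  refine ⟨by rw [h1]; linarith [hdesc.inner_lt hl k], ?_⟩
  rw [closestPoint, inner_add_right, inner_smul_right, real_inner_self_eq_norm_sq,
    hdesc.norm_eq_one k, h1]
  ring

/-- The constants of the drift estimates exist for every facet that is relevant for some
arrival rate. -/
theorem exists_faceData (D : ℕ) (hident : sys.Identical) {c : Fin K → EuclideanSpace ℝ (Fin J)}
    {b : Fin K → ℝ} (hdesc : IsHyperplaneDescription sys.capacityRegion c b) {k : Fin K}
    {l : EuclideanSpace ℝ (Fin J)} (hl : l ∈ interior sys.capacityRegion)
    (hk : k ∈ dominantFaces sys.capacityRegion c b l) :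
    ∃ S r η ℓ κ, FaceData D sys (c k) (closestPoint (c k) (b k) l) (b k) S r η ℓ κ := by
  have hM : (0 : ℝ) < M := by exact_mod_cast NeZero.pos M
  obtain ⟨hε, hlamk⟩ := closestPoint_eq_add hdesc hl k
  set lamk := closestPoint (c k) (b k) l with hlamk_def
  -- Interior rates have positive entries, and the shift along `c ≥ 0` to the face only increases
  -- them. The balancing of the servers needs this positivity.
  have hpos : ∀ j, 0 < lamk j := by
    intro j
    rw [hlamk_def, closestPoint, PiLp.add_apply, PiLp.smul_apply, smul_eq_mul]
    have h1 := hdesc.pos_of_mem_interior hl j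
    have h2 := mul_nonneg hε.le (hdesc.normal_nonneg k j)
    linarith
  obtain ⟨S, hS⟩ := hident.exists_config_bound ⟨l, interior_subset hl⟩
  obtain ⟨r, hr, hball⟩ := hdesc.exists_ball_of_mem_intrinsicInterior hl hk.2
  obtain ⟨ℓ, hℓ, hℓ'⟩ := exists_pos_gap (Set.range fun j => lamk j) (Set.finite_range _)
  obtain ⟨κ, hκ, hκ'⟩ := exists_pos_gap (Set.range fun j => c k j) (Set.finite_range _)
  have hfin : {s : Fin J → ℕ | ∀ j, s j ≤ S}.Finite :=
    (Set.Finite.pi' fun _ : Fin J => Set.finite_Iic S).subset fun s hs j => hs j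
  obtain ⟨η, hη, hη'⟩ := exists_pos_gap
    ((fun s : Fin J → ℕ => b k / M - inner ℝ (c k) (natVec s)) '' {s | ∀ j, s j ≤ S})
    (hfin.image _)
  -- Using the same point of the hull at all `M` servers gives a point of the capacity region.
  have hle : ∀ (Y : CloudState J M D) m s, IsMaxWeight sys Y m s →
      inner ℝ (c k) (natVec s) ≤ b k / M := by
    intro Y m s hs
    have h1 := hdesc.inner_le (hident.smul_mem_capacityRegion hs.2.1) k
    rw [inner_smul_right] at h1
    rw [le_div_iff₀ hM]; linarith
  exact ⟨S, r, η, ℓ, κ,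
    { norm_normal := hdesc.norm_eq_one k
      normal_nonneg := hdesc.normal_nonneg k
      normal_gap := fun j => by
        rcases (hdesc.normal_nonneg k j).eq_or_lt with h | h
        · exact Or.inl h.symm
        · exact Or.inr (hκ' _ ⟨j, rfl⟩ h)
      offset_nonneg := hdesc.offset_nonneg k
      inner_point := hlamk
      le_point := fun j => hℓ' _ ⟨j, rfl⟩ (hpos j)
      bound_nonneg := Nat.cast_nonneg S
      radius_pos := hr
      gap_pos := hη
      point_pos := hℓ
      normal_gap_pos := hκ
      config_le := fun Y m s hs j => by exact_mod_cast hS m s hs.1 j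
      inner_le := hle
      gap := fun Y m s hs => by
        rcases (hle Y m s hs).eq_or_lt with h | h
        · exact Or.inl h
        · have := hη' _ ⟨s, hS m s hs.1, rfl⟩ (sub_pos.2 h)
          exact Or.inr (by linarith)
      weight_le := fun Y m s hs v hv hcv => by
        have := hident.weight_le hs (hball v hv hcv)
        simpa only [PiLp.add_apply] using this }⟩

/-- Interior arrival rates leave some capacity. -/
theorem exists_weight_margin (D : ℕ) (hident : sys.Identical) {l : EuclideanSpace ℝ (Fin J)}
    (hl : l ∈ interior sys.capacityRegion) : ∃ δ > 0, ∀ (Y : CloudState J M D) m s,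
      IsMaxWeight sys Y m s → ∑ j, (l j + δ) * (workload (Y j m) : ℝ) ≤
        M * ∑ j, (s j : ℝ) * (workload (Y j m) : ℝ) := by
  obtain ⟨δ, hδ, hb⟩ := exists_ball_subset_of_mem_interior hl
  let o : EuclideanSpace ℝ (Fin J) := WithLp.toLp 2 fun _ => 1
  have ho : 0 < ‖o‖ + 1 := by positivity
  refine ⟨δ / (‖o‖ + 1), by positivity, fun Y m s hs => ?_⟩
  have h1 := hb ((δ / (‖o‖ + 1)) • o) (by
    rw [norm_smul, Real.norm_of_nonneg (by positivity), div_mul_eq_mul_div, div_le_iff₀ ho]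
    nlinarith)
  have h2 := hident.weight_le hs h1
  simpa [o] using h2

/-- Uniform upper bounds that tend to zero give a modulus that tends to zero. -/
theorem exists_modulus {T : Type*} (x e : T → ℝ)
    (h1 : ∀ η > 0, ∃ ε₀ > 0, ∀ t, 0 < e t → e t < ε₀ → x t ≤ η)
    (h2 : ∀ s, ∃ C, ∀ t, e t = s → x t ≤ C) :
    ∃ B : ℝ → ℝ, Tendsto B (𝓝[>] 0) (𝓝 0) ∧ ∀ t, x t ≤ B (e t) := by
  -- The supremum over the fibre is the smallest bound that works. The maximum with `0` keeps it
  -- from being negative, where `h1` would give no control.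
  refine ⟨fun s => max 0 (sSup (x '' {t | e t = s})), ?_, fun t => ?_⟩
  · rw [Metric.tendsto_nhdsWithin_nhds]
    intro η hη
    obtain ⟨ε₀, hε₀, h⟩ := h1 (η / 2) (by positivity)
    refine ⟨ε₀, hε₀, fun s hs hd => ?_⟩
    have hs0 : 0 < s := hs
    rw [Real.dist_eq, sub_zero, abs_of_pos hs0] at hd
    rw [Real.dist_eq, sub_zero, abs_of_nonneg (le_max_left _ _)]
    refine lt_of_le_of_lt (max_le (by positivity) (Real.sSup_le ?_ (by positivity)))
      (half_lt_self hη)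
    rintro _ ⟨t, ht, rfl⟩
    have ht' : e t = s := ht
    exact h t (ht'.symm ▸ hs0) (ht'.symm ▸ hd)
  · obtain ⟨C, hC⟩ := h2 (e t)
    refine le_max_of_le_right (le_csSup ⟨C, ?_⟩ ⟨t, rfl, rfl⟩)
    rintro _ ⟨t', ht', rfl⟩
    exact hC t' ht'

theorem sum_sq_mul_arrivalVar_le {c : EuclideanSpace ℝ (Fin J)} (hc : ‖c‖ = 1)
    {μ : PMF (Arrivals J D)} {V : ℝ} (hV0 : 0 ≤ V) (hV : SecondMomentLE μ V) :
    (∑ j, c j ^ 2 * arrivalVar μ j) / M ≤ V := by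
  have hM : (1 : ℝ) ≤ M := by exact_mod_cast NeZero.pos M
  have h1 : ∑ j, c j ^ 2 * arrivalVar μ j ≤ V := by
    calc _ ≤ ∑ j, c j ^ 2 * V := Finset.sum_le_sum fun j _ =>
          mul_le_mul_of_nonneg_left (hV.arrivalVar_le hV0 j) (sq_nonneg _)
      _ = V := by rw [← Finset.sum_mul, ← EuclideanSpace.real_norm_sq_eq, hc]; ring
  exact (div_le_div_of_nonneg_right h1 (by linarith)).trans (div_le_self hV0 hM)

/-- Heavy-traffic approximation, uniform in the arrival law, the policy and the stationary law. -/
theorem exists_heavyTraffic_bound {c lamk : EuclideanSpace ℝ (Fin J)} {b S r η ℓ κ : ℝ}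
    (h : FaceData D sys c lamk b S r η ℓ κ) {ι : Type*} {μ : ι → PMF (Arrivals J D)}
    (hsq : UniformlySquareIntegrable μ)
    (huncorr : ∀ i, ∀ j j' : Fin J, j ≠ j' → arrivalCov (μ i) j j' = 0) {ε : ι → ℝ}
    (hε0 : ∀ i, 0 < ε i) (hrate : ∀ i j, arrivalRate (μ i) j = lamk j - ε i * c j)
    {δ : ℝ} (hδ : 0 < δ) :
    ∃ ε₀ > 0, ∀ i, ε i < ε₀ → ∀ (P : MaxWeightPolicy sys D) π, IsSteadyState P (μ i) π →
      PMFIntegrable π (weightedQueue c) →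
      |ε i * pmfExpect π (weightedQueue c) -
        (1 / Real.sqrt M * ∑ j, c j ^ 2 * arrivalVar (μ i) j) / 2| ≤ δ := by
  have hM : (0 : ℝ) < M := by exact_mod_cast NeZero.pos M
  have hN1 : (1 : ℝ) ≤ Real.sqrt M := one_le_sqrt_natCast
  have hNN : Real.sqrt M * Real.sqrt M = M := Real.mul_self_sqrt hM.le
  set N := Real.sqrt M with hN
  have hN0 : 0 < N := by linarith
  obtain ⟨V, hV0, hV⟩ := hsq.exists_secondMomentLE
  have hC0 := slackConst_nonneg h
  set C := slackConst M D lamk S η κ with hC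
  have hS0 := h.bound_nonneg
  have hb0 := h.offset_nonneg
  set B := b + J * M * S with hB
  have hB0 : 0 ≤ B := by positivity
  set κ₂ := 2 * C * B with hκ₂
  have hκ₂0 : 0 ≤ κ₂ := by positivity
  set τ := δ / (N * (κ₂ + 1)) with hτ
  have hτ0 : 0 < τ := by positivity
  have hκτ : κ₂ * τ ≤ δ / N := by
    rw [hτ, ← mul_div_assoc, div_le_div_iff₀ (by positivity) hN0]
    have : 0 ≤ δ * N := by positivity
    nlinarith
  obtain ⟨L, hL0, hL⟩ := exists_lexp_perpNorm_le h hV0 hsq hV hτ0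
  -- Collects the errors of both bounds for the choice `t = √e`, for which `t` and `e / t` both tend
  -- to zero.
  let F : ℝ → ℝ := fun x => 2 * C * (1 + L) * x + (x + √x) * B + √x * (V + x ^ 2) + x ^ 2 +
    √x * (V + B)
  have hFc : Continuous F := by fun_prop
  have hF0 : F 0 = 0 := by simp [F]
  obtain ⟨x₀, hx₀, hx⟩ := Metric.continuousAt_iff.1 (hFc.continuousAt (x := 0)) (δ / N) (by positivity)
  rw [hF0] at hx
  -- Below `ℓ / 2` the rates stay at least `ℓ / 2`; below `1` the parameter `√e` is at most one, as
  -- the lower bound requires.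
  refine ⟨min (min (ℓ / 2) x₀) 1, lt_min (lt_min (half_pos h.point_pos) hx₀) one_pos,
    fun i hi P π hπ hint => ?_⟩
  have hi1 : ε i < ℓ / 2 := hi.trans_le ((min_le_left _ _).trans (min_le_left _ _))
  have hi2 : ε i < x₀ := hi.trans_le ((min_le_left _ _).trans (min_le_right _ _))
  have hi3 : ε i < 1 := hi.trans_le (min_le_right _ _)
  have hcol := hL i (ε i) (hε0 i).le hi1.le (hrate i) P π hπ
  set e := ε i / N with he
  have he0 : 0 < e := div_pos (hε0 i) hN0
  have hee : e ≤ ε i := div_le_self (hε0 i).le hN1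
  have hsq0 : 0 < √e := Real.sqrt_pos.2 he0
  have hsq1 : √e ≤ 1 := Real.sqrt_le_one.2 (by linarith)
  have hss : √e * √e = e := Real.mul_self_sqrt he0.le
  have hup := weightedQueue_upper_bound h (hV i) (huncorr i) (hε0 i).le (hrate i) hπ hint hsq0
    hL0 hτ0.le hcol
  have hlow := weightedQueue_lower_bound h (hV i) (huncorr i) (hε0 i).le (hrate i) hπ hint hsq0
    hsq1
  rw [← hN, ← he, ← hC, ← hB, ← hκ₂] at hup
  rw [← hN, ← he, ← hB] at hlow
  set v := (∑ j, c j ^ 2 * arrivalVar (μ i) j) / M with hv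
  have hvV : v ≤ V := sum_sq_mul_arrivalVar_le h.norm_normal hV0 (hV i)
  set E := pmfExpect π (weightedQueue c) with hE
  have hFe : F e < δ / N := by
    have := hx (x := e) (by rw [Real.dist_eq, sub_zero, abs_of_pos he0]; linarith)
    rw [Real.dist_eq, sub_zero] at this
    exact (le_abs_self _).trans_lt this
  have hve : √e * v ≤ √e * V := mul_le_mul_of_nonneg_left hvV hsq0.le
  have e1 : 1 / √e * e = √e := by
    rw [div_mul_eq_mul_div, one_mul, div_eq_iff hsq0.ne', hss]
  have e2 : B / √e * e = B * √e := by
    rw [div_eq_mul_one_div, mul_assoc, e1]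
  have hn1 : 0 ≤ 2 * C * (1 + L) * e := by positivity
  have hn2 : 0 ≤ (e + √e) * B := by positivity
  have hn3 : 0 ≤ √e * (V + e ^ 2) := by positivity
  have hn4 : 0 ≤ √e * (V + B) := by positivity
  have hn5 : 0 ≤ (1 - √e) * e ^ 2 := mul_nonneg (by linarith) (sq_nonneg _)
  have k1 : 2 * e * E - v ≤ 2 * (δ / N) := by
    have : (2 * C * (1 + L) + (1 + 1 / √e) * B) * e = 2 * C * (1 + L) * e + (e + √e) * B := by
      calc _ = 2 * C * (1 + L) * e + (e + 1 / √e * e) * B := by ring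
        _ = _ := by rw [e1]
    rw [this] at hup
    simp only [F] at hFe
    linarith
  have k2 : v - 2 * e * E ≤ 2 * (δ / N) := by
    rw [e2] at hlow
    simp only [F] at hFe
    have : 0 < δ / N := by positivity
    have := sq_nonneg e
    linarith
  -- The bounds are in terms of `e = ε / √M` and the variance of `α`; the factor `√M / 2` converts
  -- them.
  have e3 : ε i * E - (1 / N * ∑ j, c j ^ 2 * arrivalVar (μ i) j) / 2 =
      N / 2 * (2 * e * E - v) := by
    rw [he, hv, ← hNN]; field_simp
  rw [e3, abs_mul, abs_of_pos (by positivity : 0 < N / 2)]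
  calc N / 2 * |2 * e * E - v| ≤ N / 2 * (2 * (δ / N)) := by
        gcongr
        exact abs_le.2 ⟨by linarith, k1⟩
    _ = δ := by field_simp

end main

theorem proposition1 {I J M D K : ℕ} [NeZero M]
    (sys : CloudSystem I J M) (hident : sys.Identical)
    (c : Fin K → EuclideanSpace ℝ (Fin J)) (b : Fin K → ℝ)
    (hdesc : IsHyperplaneDescription sys.capacityRegion c b)
    (k : Fin K) (lamk : EuclideanSpace ℝ (Fin J))
    {ι : Type*} (μ : ι → PMF (Arrivals J D))
    (hsq : UniformlySquareIntegrable μ)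
    (huncorr : ∀ i, ∀ j j' : Fin J, j ≠ j' → arrivalCov (μ i) j j' = 0)
    (hint : ∀ i, arrivalRate (μ i) ∈ interior sys.capacityRegion)
    (hk : ∀ i, k ∈ dominantFaces sys.capacityRegion c b (arrivalRate (μ i)))
    (hlamk : ∀ i, closestPoint (c k) (b k) (arrivalRate (μ i)) = lamk) :
    (∃ B : ℝ → ℝ, Tendsto B (𝓝[>] 0) (𝓝 0) ∧
      ∀ i, ∀ P : MaxWeightPolicy sys D,
        (∃ π, IsSteadyState P (μ i) π) ∧
        ∀ π, IsSteadyState P (μ i) π →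
          PMFIntegrable π (weightedQueue (c k)) ∧
          hyperplaneDist (c k) (b k) (arrivalRate (μ i)) * pmfExpect π (weightedQueue (c k)) ≤
            (1 / Real.sqrt M * ∑ j, (c k j) ^ 2 * arrivalVar (μ i) j +
              hyperplaneDist (c k) (b k) (arrivalRate (μ i)) ^ 2 / Real.sqrt M) / 2 +
            B (hyperplaneDist (c k) (b k) (arrivalRate (μ i)))) ∧
    (∀ (l : Filter ι) (σ : Fin J → ℝ),
      Tendsto (fun i => hyperplaneDist (c k) (b k) (arrivalRate (μ i))) l (𝓝 0) →
      (∀ j, Tendsto (fun i => arrivalVar (μ i) j) l (𝓝 (σ j ^ 2))) →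
      ∀ (P : ι → MaxWeightPolicy sys D) (π : ι → PMF (CloudState J M D)),
        (∀ i, IsSteadyState (P i) (μ i) (π i)) →
        Tendsto (fun i => hyperplaneDist (c k) (b k) (arrivalRate (μ i)) *
            pmfExpect (π i) (weightedQueue (c k))) l
          (𝓝 ((1 / Real.sqrt M * ∑ j, (c k j) ^ 2 * σ j ^ 2) / 2))) := by

  have hε : ∀ i, 0 < hyperplaneDist (c k) (b k) (arrivalRate (μ i)) := fun i =>
    (closestPoint_eq_add hdesc (hint i) k).1
  have hrate : ∀ i j, arrivalRate (μ i) j =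
      lamk j - hyperplaneDist (c k) (b k) (arrivalRate (μ i)) * c k j := fun i j => by
    rw [← hlamk i, closestPoint, PiLp.add_apply, PiLp.smul_apply, smul_eq_mul,
      add_sub_cancel_right]
  -- The constants of the face are extracted from one member of the family, so the empty family is
  -- treated apart.
  rcases isEmpty_or_nonempty ι with hι | ⟨⟨i₀⟩⟩
  · refine ⟨⟨fun _ => 0, tendsto_const_nhds, fun i => hι.elim i⟩, fun l σ _ _ P π _ => ?_⟩
    rw [Filter.filter_eq_bot_of_isEmpty l]
    exact tendsto_bot
  obtain ⟨S, r, η, ℓ, κ, hface⟩ := exists_faceData D hident hdesc (hint i₀) (hk i₀)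
  rw [hlamk i₀] at hface
  obtain ⟨V, hV0, hV⟩ := hsq.exists_secondMomentLE
  have hpos : ∀ i j, 0 ≤ arrivalRate (μ i) j := fun i j =>
    (hdesc.pos_of_mem_interior (hint i) j).le
  have hinteg : ∀ i (P : MaxWeightPolicy sys D) π, IsSteadyState P (μ i) π →
      PMFIntegrable π (weightedQueue (c k)) := by
    intro i P π hπ
    obtain ⟨δ, hδ, hw⟩ := exists_weight_margin D hident (hint i)
    exact (weightedQueue_integrable hface.normal_nonneg hface.normal_le_one hface.config_le hδ hV0
      (hV i) (hpos i) hw hπ).1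
  have hheavy := fun δ (hδ : (0 : ℝ) < δ) =>
    exists_heavyTraffic_bound hface hsq huncorr hε hrate hδ
  refine ⟨?_, ?_⟩
  -- The modulus is taken over all triples of law, policy and stationary law, which makes it uniform
  -- in them.
  · let T := {p : ι × MaxWeightPolicy sys D × PMF (CloudState J M D) //
      IsSteadyState p.2.1 (μ p.1) p.2.2}
    let e : T → ℝ := fun p => hyperplaneDist (c k) (b k) (arrivalRate (μ p.1.1))
    let ζ : T → ℝ := fun p => 1 / Real.sqrt M * ∑ j, (c k j) ^ 2 * arrivalVar (μ p.1.1) j +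
      e p ^ 2 / Real.sqrt M
    have hζ0 : ∀ p, 0 ≤ ζ p := fun p => add_nonneg (mul_nonneg (by positivity)
      (Finset.sum_nonneg fun j _ => mul_nonneg (sq_nonneg _)
        (SecondMomentLE.arrivalVar_nonneg _ j))) (by positivity)
    obtain ⟨B, hB, hBx⟩ := exists_modulus
      (fun p : T => e p * pmfExpect p.1.2.2 (weightedQueue (c k)) - ζ p / 2) e (by
        intro δ hδ
        obtain ⟨ε₀, hε₀, hb⟩ := hheavy δ hδ
        refine ⟨ε₀, hε₀, fun p _ hp => ?_⟩
        have h1 := (abs_le.1 (hb p.1.1 hp p.1.2.1 p.1.2.2 p.2 (hinteg _ _ _ p.2))).2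
        have h2 : 0 ≤ e p ^ 2 / Real.sqrt M := by positivity
        simp only [ζ, e] at h2 ⊢
        linarith) (by
        intro s
        by_cases hs : ∃ p : T, e p = s
        · obtain ⟨p, hp⟩ := hs
          obtain ⟨δ, hδ, hw⟩ := exists_weight_margin D hident (hint p.1.1)
          refine ⟨s * (max (driftConst J M D S V) 0 / (2 * δ / M)), fun p' hp' => ?_⟩
          have hM : (0 : ℝ) < M := by exact_mod_cast NeZero.pos M
          -- At a fixed distance `s` the rate is `lamk - s c`, the same for all such members. The
          -- capacity margin `δ` of one of them therefore serves all, and the error is bounded on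
          -- the fibre.
          have hrr : ∀ j, arrivalRate (μ p.1.1) j = arrivalRate (μ p'.1.1) j := fun j => by
            rw [hrate, hrate p'.1.1]
            have : e p = e p' := hp.trans hp'.symm
            simp only [e] at this
            rw [this]
          simp only [hrr] at hw
          have h1 := (weightedQueue_integrable hface.normal_nonneg hface.normal_le_one
            hface.config_le hδ hV0 (hV p'.1.1) (hpos p'.1.1) hw p'.2).2
          have h2 : pmfExpect p'.1.2.2 (weightedQueue (c k)) ≤
              max (driftConst J M D S V) 0 / (2 * δ / M) := by
            rw [le_div_iff₀ (by positivity)]; linarith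
          have hs0 : 0 ≤ s := hp ▸ (hε p.1.1).le
          have h3 := mul_le_mul_of_nonneg_left h2 hs0
          have h4 := hζ0 p'
          rw [hp']
          linarith
        · exact ⟨0, fun p hp => absurd ⟨p, hp⟩ hs⟩)
    refine ⟨B, hB, fun i P => ⟨?_, fun π hπ => ⟨hinteg i P π hπ, ?_⟩⟩⟩
    · obtain ⟨δ, hδ, hw⟩ := exists_weight_margin D hident (hint i)
      exact exists_isSteadyState hface.config_le hδ hV0 (hV i) (hpos i) hw
    · have := hBx ⟨(i, P, π), hπ⟩
      simp only [ζ, e] at this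
      linarith
  · intro l σ hεl hσ P π hπ
    have hlim : Tendsto (fun i => (1 / Real.sqrt M * ∑ j, (c k j) ^ 2 * arrivalVar (μ i) j) / 2) l
        (𝓝 ((1 / Real.sqrt M * ∑ j, (c k j) ^ 2 * σ j ^ 2) / 2)) :=
      ((tendsto_finsetSum _ fun j _ => (hσ j).const_mul _).const_mul _).div_const _
    have hdiff : Tendsto (fun i => hyperplaneDist (c k) (b k) (arrivalRate (μ i)) *
        pmfExpect (π i) (weightedQueue (c k)) -
          (1 / Real.sqrt M * ∑ j, (c k j) ^ 2 * arrivalVar (μ i) j) / 2) l (𝓝 0) := by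
      rw [Metric.tendsto_nhds]
      intro δ hδ
      obtain ⟨ε₀, hε₀, hb⟩ := hheavy (δ / 2) (by positivity)
      filter_upwards [hεl.eventually_lt_const hε₀] with i hi
      rw [Real.dist_eq, sub_zero]
      exact (hb i hi (P i) (π i) (hπ i) (hinteg i _ _ (hπ i))).trans_lt (half_lt_self hδ)
    simpa using hdiff.add hlim
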